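/- Let $n,m\ge 2$ and let $\vec v=(v^1,\dots,v^{n-1})$ (horizontal variable) and $\overleftarrow v=(v^{n+1},\dots,v^{n+m-1})$ (vertical variable) be vector functions of the arclength $\mathbf l$. Let $\mathcal A$ be the algebra of real polynomials in the components of $\vec v,\overleftarrow v$ and of their $\mathbf l$-derivatives of all orders, $D=\partial_{\mathbf l}$ the total derivative on $\mathcal A$ (the derivatives $\mathbf D_{h\mathbf X}$, $\mathbf D_{v\mathbf X}$ along the curve, acting on scalar components in a parallel frame), and let $D^{-1}f$ denote, for $f\in D\mathcal A$, the unique $g\in\mathcal A$ without constant term with $Dg=f$. Expressions equal up to $D\mathcal A$ have equal integrals $\int\cdot\,d\mathbf l$. Consider, each on the set of fields for which all the $D^{-1}$ exist in $\mathcal A$, the operators $$h\mathcal J(e)=De+D^{-1}(\vec v\cdot e)\,\vec v,\qquad h\mathcal H(\omega)=D\omega+\vec v\,\rfloor\, D^{-1}(\vec v\wedge\omega),$$ where $\vec v\wedge\omega$ is the matrix $(v_i\omega_j-\omega_iv_j)_{ij}$ and $\vec v\rfloor A$ is the row vector $\vec v$ times $A$; let $v\mathcal J,v\mathcal H$ be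 given by the same formulas with $\overleftarrow v$ for $\vec v$. Put $\mathcal J=(h\mathcal J,v\mathcal J)$, $\mathcal H=(h\mathcal H,v\mathcal H)$, $\mathfrak R=\mathcal H\circ\mathcal J$ (the recursion d-operator), $\mathfrak R^*=\mathcal J\circ\mathcal H$. A linear single-valued operator $L$ with graph in $\mathcal A^{n+m-2}\times\mathcal A^{n+m-2}$ is called Hamiltonian if no nonzero linear differential operator with coefficients in $\mathcal A$ vanishes on its domain and, modulo $D\mathcal A$, for all $(\xi_i,h_i)$ in the graph, $\xi_1\cdot h_2+\xi_2\cdot h_1\equiv0$ and $\langle\mathcal L_{h_1}\xi_2,h_3\rangle+\langle\mathcal L_{h_2}\xi_3,h_1\rangle+\langle\mathcal L_{h_3}\xi_1,h_2\rangle\equiv0$ (vanishing Schouten bracket), where $\langle\mathcal L_h\xi,k\rangle=\xi'[h]\cdot k+\xi\cdot h'[k]$ and $'$ is the Fréchet derivative. $J$ is called symplectic if $J^{-1}$ is Hamiltonian, and $H$, $J$ are called compatible if $aH+bJ^{-1}$ (on the intersection of the domains) is Hamiltonian for all $a,b\in\mathbb R$. An object is called N-adapted if it respects the splitting into horizontal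 and vertical parts (for a pair of fields: the horizontal part depends only on $\vec v$ and its derivatives, the vertical part only on $\overleftarrow v$ and its derivatives). Then: 1. $\mathcal H$ and $\mathcal J$ are N-adapted, $\mathcal H$ is Hamiltonian, $\mathcal J$ is symplectic, and $\mathcal H$ and $\mathcal J$ are compatible. The operator ${}^a\mathcal H=\mathcal H\circ\mathcal J\circ\mathcal H=\mathfrak R\circ\mathcal H$ is Hamiltonian too. 2. There are N-adapted sequences of vector fields $(h\vec e_\perp^{(k)},v\overleftarrow e_\perp^{(k)})$ and covector fields $(\vec\varpi^{(k)},\overleftarrow\varpi^{(k)})$, $k=0,1,2,\dots$, with components in $\mathcal A$, and Hamiltonians $hH^{(k)}$, $vH^{(k)}\in\mathcal A$, depending only on the horizontal, respectively vertical, variable and its derivatives, such that $h\vec e_\perp^{(0)}=\vec v_{\mathbf l}$, $\vec\varpi^{(0)}=\vec v$, $hH^{(0)}=\frac12|\vec v|^2$, and, for all $k$, $$h\vec e_\perp^{(k+1)}=h\mathfrak R(h\vec e_\perp^{(k)}),\quad \vec\varpi^{(k+1)}=h\mathfrak R^*(\vec\varpi^{(k)}),\quad h\vec e_\perp^{(k)}=h\mathcal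 H(\vec\varpi^{(k)}),\quad \vec\varpi^{(k+1)}=h\mathcal J(h\vec e_\perp^{(k)}),\quad \vec\varpi^{(k)}=\frac{\delta hH^{(k)}}{\delta\vec v}$$ (in particular all the $D^{-1}$ that occur exist), and likewise for the vertical objects and $\overleftarrow v$. All flows of the vector fields $(h\vec e_\perp^{(k)},v\overleftarrow e_\perp^{(j)})$, $k,j\ge0$, commute with each other (the Lie brackets of the corresponding evolutionary vector fields vanish). 3. For all real constants $\vec R,\overleftarrow S$ (the constant scalar curvatures) put $hH^{(k,\vec R)}=hH^{(k+1)}-\vec R\,hH^{(k)}$ and $vH^{(k,\overleftarrow S)}=vH^{(k+1)}-\overleftarrow S\,vH^{(k)}$. Then for $k=0,1,2,\dots$ the evolution equations $$\vec v_\tau=h\vec e_\perp^{(k+1)}-\vec R\,h\vec e_\perp^{(k)}=h\mathcal H\left(\frac{\delta hH^{(k,\vec R)}}{\delta\vec v}\right)=(h\mathcal J)^{-1}\left(\frac{\delta hH^{(k+1,\vec R)}}{\delta\vec v}\right),$$ $$\overleftarrow v_\tau=v\overleftarrow e_\perp^{(k+1)}-\overleftarrow S\,v\overleftarrow e_\perp^{(k)}=v\mathcal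 H\left(\frac{\delta vH^{(k,\overleftarrow S)}}{\delta\overleftarrow v}\right)=(v\mathcal J)^{-1}\left(\frac{\delta vH^{(k+1,\overleftarrow S)}}{\delta\overleftarrow v}\right)$$ hold as stated (both Hamiltonian forms agree with the first expression). The systems formed by the horizontal equation with index $k$ and the vertical equation with index $j$, $k,j\ge0$, are N-adapted, invariant under $O(n-1)\oplus O(m-1)$, and their flows commute with each other. -/

import Mathlib

open MvPolynomial

namespace CurveFlow

/-! ### Formal calculus of variations for finitely many functions of the arclength -/

/-- Differential polynomials in functions `u i` (`i : ι`) of one variable `l`: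
the variable indexed by `(i, k)` is the `k`-th `l`-derivative of `u i`. -/
abbrev Jet (ι : Type) : Type := MvPolynomial (ι × ℕ) ℝ

/-- The jet variable `u i` itself. -/
noncomputable def u {ι : Type} (i : ι) : Jet ι := X (i, 0)

/-- The (total) derivative along the curve with respect to the arclength `l`. -/
noncomputable def D {ι : Type} : Derivation ℝ (Jet ι) (Jet ι) :=
  mkDerivation ℝ fun p => (X (p.1, p.2 + 1) : Jet ι)

/-- `f` is a total derivative, that is, its integral over `l` vanishes formally. -/
def IsTotal {ι : Type} (f : Jet ι) : Prop := ∃ g : Jet ι, D g = f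

/-- `g = D⁻¹ f`: the antiderivative without constant term (it is unique when it exists). -/
def IsPrimitive {ι : Type} (f g : Jet ι) : Prop := D g = f ∧ constantCoeff g = 0

/-- The evolutionary vector field of characteristic `Q`, i.e. the derivation of differential
polynomials along the flow of the evolution equation `∂u/∂τ = Q`. -/
noncomputable def evo {ι : Type} (Q : ι → Jet ι) : Derivation ℝ (Jet ι) (Jet ι) :=
  mkDerivation ℝ fun p => (D : Jet ι → Jet ι)^[p.2] (Q p.1)

/-- The evolution equations `∂u/∂τ = P` and `∂u/∂τ = Q` have commuting flows:
the Lie bracket of their evolutionary vector fields vanishes. -/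
def CommutingFlows {ι : Type} (P Q : ι → Jet ι) : Prop :=
  ∀ i, evo P (Q i) - evo Q (P i) = 0

/-- The variational derivative `δF/δ(u i) = ∑ₖ (-D)ᵏ (∂F/∂uᵢ⁽ᵏ⁾)`; the terms beyond the order
of `F` vanish. -/
noncomputable def varDeriv {ι : Type} (F : Jet ι) (i : ι) : Jet ι :=
  ∑ k ∈ Finset.range (F.vars.sup Prod.snd + 1),
    (-1) ^ k * (D : Jet ι → Jet ι)^[k] (pderiv (i, k) F)

/-- The pointwise pairing of a covector field with a vector field. -/
noncomputable def pair {κ ι : Type} [Fintype κ] (ξ h : κ → Jet ι) : Jet ι := ∑ i, ξ i * h i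

/-! ### Hamiltonian operators

A nonlocal operator (one containing `D⁻¹`) is not defined on all fields of differential
polynomials. It is given by its graph, on the domain on which all the `D⁻¹` it contains exist. -/

/-- Graphs of operators; `L ξ h` means that `ξ` is in the domain and is mapped to `h`. -/
abbrev Op (κ ι : Type) : Type := (κ → Jet ι) → (κ → Jet ι) → Prop

/-- The composition `S ∘ T`. -/
def Op.comp {κ ι : Type} (S T : Op κ ι) : Op κ ι := fun ξ h => ∃ η, T ξ η ∧ S η h

/-- The inverse operator. -/
def Op.inv {κ ι : Type} (S : Op κ ι) : Op κ ι := fun ξ h => S h ξ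

/-- The linear combination `a S + b T`, on the intersection of the domains. -/
def Op.lin {κ ι : Type} (a b : ℝ) (S T : Op κ ι) : Op κ ι :=
  fun ξ h => ∃ k l, S ξ k ∧ T ξ l ∧ h = a • k + b • l

/-- The pairing of the Lie derivative of the covector field `ξ` along `h` with the vector field
`k`, up to total derivatives: `⟨ξ'[h], k⟩ + ⟨ξ, h'[k]⟩`. -/
noncomputable def lieDer {ι : Type} [Fintype ι] (h ξ k : ι → Jet ι) : Jet ι :=
  pair (fun i => evo h (ξ i)) k + pair ξ (fun i => evo k (h i))

/-- Hamiltonian (cosymplectic, Poisson) operators, from covector fields to vector fields: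
linear operators which are skew-adjoint and have vanishing Schouten bracket with themselves (the
condition on the graph which expresses the Jacobi identity for the bracket
`{F, G} = ∫ δF/δu · L (δG/δu) dl`), and whose domain is so large that no nonzero linear
differential operator vanishes on it. -/
structure IsHamiltonianOp {ι : Type} [Fintype ι] (L : Op ι ι) : Prop where
  zero : L 0 0
  add : ∀ {ξ h η k}, L ξ h → L η k → L (ξ + η) (h + k)
  smul : ∀ (c : ℝ) {ξ h}, L ξ h → L (c • ξ) (c • h)
  single_valued : ∀ {ξ h k}, L ξ h → L ξ k → h = k
  skew : ∀ {ξ h η k}, L ξ h → L η k → IsTotal (pair ξ k + pair η h)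
  jacobi : ∀ {ξ₁ h₁ ξ₂ h₂ ξ₃ h₃}, L ξ₁ h₁ → L ξ₂ h₂ → L ξ₃ h₃ →
    IsTotal (lieDer h₁ ξ₂ h₃ + lieDer h₂ ξ₃ h₁ + lieDer h₃ ξ₁ h₂)
  domain_large : ∀ c : ι × ℕ →₀ Jet ι, c ≠ 0 →
    ∃ ξ h, L ξ h ∧ (c.sum fun p a => a * (D : Jet ι → Jet ι)^[p.2] (ξ p.1)) ≠ 0

/-- `J` is a symplectic operator, from vector fields to covector fields: its inverse is
Hamiltonian. -/
def IsSymplecticOp {ι : Type} [Fintype ι] (J : Op ι ι) : Prop := IsHamiltonianOp J.inv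

/-- The Hamiltonian operator `H` and the symplectic operator `J` are compatible: all linear
combinations of `H` and `J⁻¹` are Hamiltonian. -/
def AreCompatible {ι : Type} [Fintype ι] (H J : Op ι ι) : Prop :=
  ∀ a b : ℝ, IsHamiltonianOp (Op.lin a b H J.inv)

/-! ### The operators `J` and `H` on a block of variables -/

/-- `J e = D e + D⁻¹(v · e) v`, where `v = (u (b i))ᵢ`. -/
def opJ {κ ι : Type} [Fintype κ] (b : κ → ι) : Op κ ι := fun e ω =>
  ∃ p : Jet ι, IsPrimitive (∑ i, u (b i) * e i) p ∧ ∀ i, ω i = D (e i) + p * u (b i)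

/-- `H ω = D ω + v ⌟ D⁻¹(v ∧ ω)`, where `v = (u (b i))ᵢ`, the matrix `v ∧ ω` has the entries
`vᵢ ωⱼ - ωᵢ vⱼ`, and `v ⌟ A` is the row vector `v` times the matrix `A`. -/
def opH {κ ι : Type} [Fintype κ] (b : κ → ι) : Op κ ι := fun ω h =>
  ∃ A : κ → κ → Jet ι,
    (∀ i j, IsPrimitive (u (b i) * ω j - ω i * u (b j)) (A i j)) ∧
      ∀ j, h j = D (ω j) + ∑ i, u (b i) * A i j

/-! ### Distinguished objects: horizontal block `Fin N`, vertical block `Fin M` -/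

/-- Indices of the pair of horizontal and vertical variables. -/
abbrev Ix (N M : ℕ) : Type := Fin N ⊕ Fin M

/-- Horizontal operators on horizontal fields. -/
abbrev HOp (N M : ℕ) : Type := Op (Fin N) (Ix N M)

/-- Vertical operators on vertical fields. -/
abbrev VOp (N M : ℕ) : Type := Op (Fin M) (Ix N M)

def hJ (N M : ℕ) : HOp N M := opJ Sum.inl
def vJ (N M : ℕ) : VOp N M := opJ Sum.inr
def hH (N M : ℕ) : HOp N M := opH Sum.inl
def vH (N M : ℕ) : VOp N M := opH Sum.inr

/-- The d-operator with horizontal part `S` and vertical part `T`. -/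
def dOp {N M : ℕ} (S : HOp N M) (T : VOp N M) : Op (Ix N M) (Ix N M) := fun ξ h =>
  S (ξ ∘ Sum.inl) (h ∘ Sum.inl) ∧ T (ξ ∘ Sum.inr) (h ∘ Sum.inr)

def dJ (N M : ℕ) : Op (Ix N M) (Ix N M) := dOp (hJ N M) (vJ N M)
def dH (N M : ℕ) : Op (Ix N M) (Ix N M) := dOp (hH N M) (vH N M)

/-- The recursion d-operator, with horizontal part `hH ∘ hJ` and vertical part `vH ∘ vJ`. -/
def dR (N M : ℕ) : Op (Ix N M) (Ix N M) :=
  dOp ((hH N M).comp (hJ N M)) ((vH N M).comp (vJ N M))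

/-- The adjoint recursion d-operator `J ∘ H`. -/
def dRadj (N M : ℕ) : Op (Ix N M) (Ix N M) :=
  dOp ((hJ N M).comp (hH N M)) ((vJ N M).comp (vH N M))

/-- Differential polynomials in the horizontal variables only. -/
noncomputable def hFun (N M : ℕ) : Subalgebra ℝ (Jet (Ix N M)) :=
  supported ℝ {p | p.1.isLeft}

/-- Differential polynomials in the vertical variables only. -/
noncomputable def vFun (N M : ℕ) : Subalgebra ℝ (Jet (Ix N M)) :=
  supported ℝ {p | p.1.isRight}

/-- A d-vector or d-covector field whose horizontal part depends only on the horizontal variables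
and whose vertical part depends only on the vertical variables. -/
def IsNAdapted {N M : ℕ} (Q : Ix N M → Jet (Ix N M)) : Prop :=
  (∀ i, Q (Sum.inl i) ∈ hFun N M) ∧ ∀ a, Q (Sum.inr a) ∈ vFun N M

/-- The horizontal part of a d-vector field. -/
noncomputable def hPart {N M : ℕ} (Q : Ix N M → Jet (Ix N M)) : Ix N M → Jet (Ix N M) :=
  Sum.elim (Q ∘ Sum.inl) 0

/-- The vertical part of a d-vector field. -/
noncomputable def vPart {N M : ℕ} (Q : Ix N M → Jet (Ix N M)) : Ix N M → Jet (Ix N M) :=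
  Sum.elim 0 (Q ∘ Sum.inr)

/-- An operator that respects the splitting into horizontal and vertical parts. -/
structure IsNAdaptedOp {N M : ℕ} (L : Op (Ix N M) (Ix N M)) : Prop where
  split : ∀ ξ h, L ξ h ↔ L (hPart ξ) (hPart h) ∧ L (vPart ξ) (vPart h)
  adapted : ∀ {ξ h}, L ξ h → IsNAdapted ξ → IsNAdapted h

/-- Linear substitution `u ↦ G u` in a differential polynomial. -/
noncomputable def subst {ι : Type} [Fintype ι] (G : Matrix ι ι ℝ) : Jet ι →ₐ[ℝ] Jet ι :=
  aeval fun p => ∑ j, C (G p.1 j) * (X (j, p.2) : Jet ι)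

/-- The evolution equation `∂u/∂τ = Q` is `O(N) ⊕ O(M)`-invariant: `Q (G u) = G (Q u)` for every
block diagonal matrix `G` with orthogonal diagonal blocks. -/
def IsInvariant {N M : ℕ} (Q : Ix N M → Jet (Ix N M)) : Prop :=
  ∀ A ∈ Matrix.orthogonalGroup (Fin N) ℝ, ∀ B ∈ Matrix.orthogonalGroup (Fin M) ℝ, ∀ i,
    subst (Matrix.fromBlocks A 0 0 B) (Q i) =
      ∑ j, C (Matrix.fromBlocks A 0 0 B i j) * Q j

/-- `F⁽ᵏ⁺¹⁾ - r F⁽ᵏ⁾`, for a sequence of functions or of fields. -/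
noncomputable def shifted {V : Type} [AddCommGroup V] [Module ℝ V] (F : ℕ → V) (r : ℝ) (k : ℕ) : V :=
  F (k + 1) - r • F k

/-- The right-hand side of the pair of evolution equations
`∂v⃗/∂τ = he⁽ᵏ⁺¹⁾ - R he⁽ᵏ⁾`, `∂v⃖/∂τ = ve⁽ʲ⁺¹⁾ - S ve⁽ʲ⁾`. -/
noncomputable def dFlow {N M : ℕ} (he : ℕ → Fin N → Jet (Ix N M))
    (ve : ℕ → Fin M → Jet (Ix N M)) (R S : ℝ) (k j : ℕ) : Ix N M → Jet (Ix N M) :=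
  Sum.elim (shifted he R k) (shifted ve S j)

end CurveFlow

namespace CurveFlow

/-! ### Partial derivatives, orders and antiderivatives of differential polynomials -/

section Basics

variable {ι : Type}

/-! On one block put `v = (u (b i))`. Three facts about differential polynomials underlie
everything: only constants have zero derivative, an antiderivative has order one less than its
derivative, and `f = 0` if `f * g` is a total derivative for all `g`.

Hamiltonian properties. By integration by parts the Jacobi expressions of `H` and `J⁻¹` reduce to
trilinear expressions in the fields and their nonlocal potentials `A = D⁻¹(v ∧ ω)` and `p = D⁻¹(v ·
e)`, free of Fréchet derivatives. For `J⁻¹` the cyclic sum cancels identically. For `H`, and for the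
mixed bracket of `H` and `J⁻¹`, an explicit antiderivative is written down
(`HData.isTotal_schouten`, `isTotal_mixed_schouten`). These two identities also give the result for
`H J H`. That `J⁻¹` is single-valued follows from the first integral `p² + |e|²` of `J e = 0`.

Locality and commutation. The recursion consists of the coefficients of a resolvent: a power series
`M` in `X = 1/λ` with values in an orthogonal Lie algebra, which solves `X M' = [a + X U, M]`. With
components `p, x, y, A`, the equation says `x = X H y` and `y = X J x`, where `p` and `A` are the
potentials. Two of the component equations are kept, and the potentials are determined algebraically
by requiring `M` to be a decomposable bivector of fixed norm; the resulting system is an `X`-adic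
contraction, so no integration is needed (`exists_resolvent`). The remaining components of the Lax
equation follow from rigidity: a tangent vector to the orbit of `M` is controlled by its `x`- and
`y`-components (`IsResolvent.lax`). Hence all `D⁻¹` exist in the algebra.

Rigidity also determines the variation of `M` along its own flows (`IsResolvent.variation`), and an
antisymmetry in the two indices gives commutation (`IsResolvent.commute`). The invariant symplectic
form of the orbit, applied to the `X`-derivative and a variation of `M`, gives the Hamiltonians as
multiples of coefficients of `p` (`IsResolvent.gradient`). The hierarchy elements have leading terms
of arbitrarily high order, which makes the domains large. Equivariance follows from uniqueness of
`D⁻¹`, and the two blocks are joined componentwise. -/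

lemma D_X (q : ι × ℕ) : D (X q : Jet ι) = X (q.1, q.2 + 1) := mkDerivation_X _ _ _

lemma D_C (r : ℝ) : D (C r : Jet ι) = 0 := Derivation.map_algebraMap D r

lemma evo_X (Q : ι → Jet ι) (q : ι × ℕ) : evo Q (X q) = (D : Jet ι → Jet ι)^[q.2] (Q q.1) :=
  mkDerivation_X _ _ _

lemma evo_u (Q : ι → Jet ι) (i : ι) : evo Q (u i) = Q i := evo_X _ _

/-- In characteristic zero a monomial containing `q` survives differentiation by `q`. Questions
about supports and orders thus become questions about vanishing partial derivatives, whose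
commutators with `D` are known. -/
lemma mem_supported_iff_pderiv {σ : Type} {s : Set σ} {f : MvPolynomial σ ℝ} :
    f ∈ supported ℝ s ↔ ∀ q ∉ s, pderiv q f = 0 := by
  classical
  rw [mem_supported]
  constructor
  · intro h q hq
    exact pderiv_eq_zero_of_notMem_vars fun hm => hq (h hm)
  · intro h q hq
    by_contra hqs
    obtain ⟨d, hd, hqd⟩ := (mem_vars_iff_mem_support q).1 hq
    have hle : Finsupp.single q 1 ≤ d := by
      rw [Finsupp.single_le_iff]
      exact Nat.one_le_iff_ne_zero.2 (Finsupp.mem_support_iff.1 hqd)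
    have h0 := congrArg (coeff (d - Finsupp.single q 1)) (h q hqs)
    rw [coeff_pderiv, tsub_add_cancel_of_le hle, coeff_zero] at h0
    rcases mul_eq_zero.1 h0 with h1 | h1
    · exact (mem_support_iff.1 hd) h1
    · have : (0 : ℝ) ≤ (((d - Finsupp.single q 1 : σ →₀ ℕ) q : ℕ) : ℝ) := Nat.cast_nonneg _
      linarith

lemma pderiv_succ_D (i : ι) (k : ℕ) (g : Jet ι) :
    pderiv (i, k + 1) (D g) = pderiv (i, k) g + D (pderiv (i, k + 1) g) := by
  classical
  have h : ⁅(pderiv (i, k + 1) : Derivation ℝ (Jet ι) (Jet ι)), (D : Derivation ℝ (Jet ι) (Jet ι))⁆ = pderiv (i, k) := by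
    refine derivation_ext fun q => ?_
    rw [Derivation.commutator_apply, D_X]
    by_cases h : q = (i, k)
    · subst h
      simp [pderiv_X]
    · have h1 : ((q.1, q.2 + 1) : ι × ℕ) ≠ (i, k + 1) := by
        rintro h2
        simp only [Prod.mk.injEq, add_left_inj] at h2
        exact h (Prod.ext h2.1 h2.2)
      rw [pderiv_X_of_ne h1, pderiv_X_of_ne h, pderiv_X]
      by_cases h3 : q = (i, k + 1)
      · subst h3; simp
      · simp [h3]
  have := congrArg (fun d => d g) h
  simp only [Derivation.commutator_apply] at this
  rw [← this]; ring

lemma pderiv_zero_D (i : ι) (g : Jet ι) :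
    pderiv (i, 0) (D g) = D (pderiv (i, 0) g) := by
  classical
  have h : ⁅(pderiv (i, 0) : Derivation ℝ (Jet ι) (Jet ι)), (D : Derivation ℝ (Jet ι) (Jet ι))⁆ = 0 := by
    refine derivation_ext fun q => ?_
    rw [Derivation.commutator_apply, D_X]
    have h1 : ((q.1, q.2 + 1) : ι × ℕ) ≠ (i, 0) := by simp
    rw [pderiv_X_of_ne h1, pderiv_X]
    by_cases h3 : q = (i, 0)
    · subst h3; simp
    · simp [h3]
  have := congrArg (fun d => d g) h
  simp only [Derivation.commutator_apply, Derivation.coe_zero, Pi.zero_apply] at this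
  exact sub_eq_zero.1 this

lemma pderiv_eq_zero_of_sup_lt {f : Jet ι} {q : ι × ℕ} (h : f.vars.sup Prod.snd < q.2) :
    pderiv q f = 0 :=
  pderiv_eq_zero_of_notMem_vars fun hq =>
    absurd (Finset.le_sup (f := Prod.snd) hq) (not_le.2 h)

/-- An antiderivative depends on the `i`-th variable only up to one order less. -/
lemma pderiv_antideriv {g : Jet ι} {i : ι} {m : ℕ}
    (h : ∀ k ≥ m, pderiv (i, k + 1) (D g) = 0) : ∀ k ≥ m, pderiv (i, k) g = 0 := by
  -- Descending induction from above the order of `g`, where all partial derivatives vanish; `n`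
  -- bounds the distance from `k` to that range.
  have key : ∀ n k, m ≤ k → g.vars.sup Prod.snd + 1 ≤ k + n → pderiv (i, k) g = 0 := by
    intro n
    induction n with
    | zero => exact fun k _ hn => pderiv_eq_zero_of_sup_lt (by simpa using hn)
    | succ n ih =>
      intro k hk hn
      have h1 := h k hk
      rw [pderiv_succ_D, ih (k + 1) (by omega) (by omega), map_zero, add_zero] at h1
      exact h1
  exact fun k hk => key _ k hk (Nat.le_add_left _ k)

/-- Differential polynomials of order less than `m`. -/
noncomputable def ordLT (ι : Type) (m : ℕ) : Subalgebra ℝ (Jet ι) := supported ℝ {q | q.2 < m}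

lemma mem_ordLT {m : ℕ} {f : Jet ι} :
    f ∈ ordLT ι m ↔ ∀ i k, m ≤ k → pderiv (i, k) f = 0 := by
  rw [ordLT, mem_supported_iff_pderiv]
  simp [Prod.forall]

lemma ordLT_mono {m n : ℕ} (h : m ≤ n) : ordLT ι m ≤ ordLT ι n :=
  supported_mono fun _ hq => lt_of_lt_of_le hq h

lemma X_mem_ordLT {q : ι × ℕ} {m : ℕ} (h : q.2 < m) : (X q : Jet ι) ∈ ordLT ι m :=
  X_mem_supported.2 h

lemma D_mem_ordLT {m : ℕ} {f : Jet ι} (hf : f ∈ ordLT ι m) : D f ∈ ordLT ι (m + 1) := by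
  rw [mem_ordLT] at *
  intro i k hk
  obtain ⟨k, rfl⟩ : ∃ l, k = l + 1 := ⟨k - 1, by omega⟩
  rw [pderiv_succ_D, hf i k (by omega), hf i (k + 1) (by omega), map_zero, add_zero]

lemma antideriv_mem_ordLT {m : ℕ} {g : Jet ι} (h : D g ∈ ordLT ι (m + 1)) : g ∈ ordLT ι m := by
  rw [mem_ordLT] at *
  exact fun i => pderiv_antideriv fun k hk => h i (k + 1) (by omega)

lemma exists_mem_ordLT (f : Jet ι) : ∃ m, f ∈ ordLT ι m :=
  ⟨f.vars.sup Prod.snd + 1, mem_ordLT.2 fun _ _ h => pderiv_eq_zero_of_sup_lt h⟩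

/-- The differential polynomials in the variables from a set `s`. -/
lemma D_mem_supported {s : Set ι} {f : Jet ι} (h : f ∈ supported ℝ {q : ι × ℕ | q.1 ∈ s}) :
    D f ∈ supported ℝ {q : ι × ℕ | q.1 ∈ s} := by
  rw [mem_supported_iff_pderiv] at *
  rintro ⟨i, k⟩ hi
  cases k with
  | zero => rw [pderiv_zero_D, h _ hi, map_zero]
  | succ k => rw [pderiv_succ_D, h (i, k) hi, h _ hi, map_zero, add_zero]

lemma antideriv_mem_supported {s : Set ι} {g : Jet ι}
    (h : D g ∈ supported ℝ {q : ι × ℕ | q.1 ∈ s}) : g ∈ supported ℝ {q : ι × ℕ | q.1 ∈ s} := by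
  rw [mem_supported_iff_pderiv] at *
  rintro ⟨i, k⟩ hi
  exact pderiv_antideriv (m := 0) (fun k _ => h (i, k + 1) hi) k (Nat.zero_le k)

/-- The descent of `pderiv_antideriv` down to order zero removes every variable. This is what makes
`D⁻¹` single-valued. -/
lemma eq_C_of_D_eq_zero {g : Jet ι} (h : D g = 0) : g = C (constantCoeff g) := by
  have h0 : g ∈ supported ℝ (∅ : Set (ι × ℕ)) := by
    rw [mem_supported_iff_pderiv]
    rintro ⟨i, k⟩ -
    exact pderiv_antideriv (m := 0) (fun k _ => by rw [h, map_zero]) k (Nat.zero_le k)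
  rw [supported_empty, Algebra.mem_bot] at h0
  obtain ⟨r, rfl⟩ := h0
  simp [algebraMap_eq]

lemma eq_zero_of_D_eq_zero {g : Jet ι} (h : D g = 0) (h0 : constantCoeff g = 0) : g = 0 := by
  rw [eq_C_of_D_eq_zero h, h0, C_0]

lemma IsPrimitive.unique {f g g' : Jet ι} (h : IsPrimitive f g) (h' : IsPrimitive f g') :
    g = g' := by
  rw [← sub_eq_zero]
  exact eq_zero_of_D_eq_zero (by rw [map_sub, h.1, h'.1, sub_self])
    (by rw [map_sub, h.2, h'.2, sub_self])

lemma IsPrimitive.add {f g f' g' : Jet ι} (h : IsPrimitive f g) (h' : IsPrimitive f' g') :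
    IsPrimitive (f + f') (g + g') :=
  ⟨by rw [map_add, h.1, h'.1], by rw [map_add, h.2, h'.2, add_zero]⟩

lemma IsPrimitive.smul {f g : Jet ι} (c : ℝ) (h : IsPrimitive f g) :
    IsPrimitive (c • f) (c • g) :=
  ⟨by rw [Derivation.map_smul, h.1], by rw [smul_eq_C_mul, map_mul, h.2, mul_zero]⟩

lemma IsPrimitive.neg {f g : Jet ι} (h : IsPrimitive f g) : IsPrimitive (-f) (-g) :=
  ⟨by rw [map_neg, h.1], by rw [map_neg, h.2, neg_zero]⟩

lemma isPrimitive_zero : IsPrimitive (0 : Jet ι) 0 := ⟨map_zero _, map_zero _⟩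

lemma constantCoeff_D (f : Jet ι) : constantCoeff (D f) = 0 := by
  induction f using MvPolynomial.induction_on with
  | C r => rw [D_C, map_zero]
  | add f g hf hg => rw [map_add, map_add, hf, hg, add_zero]
  | mul_X f q hf => rw [Derivation.leibniz, D_X]; simp [hf]

lemma IsPrimitive.map {f g : Jet ι} (φ : Jet ι →ₐ[ℝ] Jet ι) (hD : ∀ f, φ (D f) = D (φ f))
    (h0 : ∀ f, constantCoeff (φ f) = constantCoeff f) (h : IsPrimitive f g) :
    IsPrimitive (φ f) (φ g) :=
  ⟨by rw [← hD, h.1], by rw [h0, h.2]⟩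

lemma isTotal_D (f : Jet ι) : IsTotal (D f) := ⟨f, rfl⟩

lemma IsTotal.add {f g : Jet ι} (hf : IsTotal f) (hg : IsTotal g) : IsTotal (f + g) := by
  obtain ⟨a, rfl⟩ := hf
  obtain ⟨b, rfl⟩ := hg
  exact ⟨a + b, map_add _ _ _⟩

lemma IsTotal.neg {f : Jet ι} (hf : IsTotal f) : IsTotal (-f) := by
  obtain ⟨a, rfl⟩ := hf
  exact ⟨-a, map_neg _ _⟩

lemma IsTotal.sub {f g : Jet ι} (hf : IsTotal f) (hg : IsTotal g) : IsTotal (f - g) := by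
  rw [sub_eq_add_neg]; exact hf.add hg.neg

lemma IsTotal.smul {f : Jet ι} (c : ℝ) (hf : IsTotal f) : IsTotal (c • f) := by
  obtain ⟨a, rfl⟩ := hf
  exact ⟨c • a, Derivation.map_smul _ _ _⟩

lemma IsTotal.C_mul {f : Jet ι} (c : ℝ) (hf : IsTotal f) : IsTotal (C c * f) := by
  rw [← smul_eq_C_mul]; exact hf.smul c

lemma isTotal_zero : IsTotal (0 : Jet ι) := ⟨0, map_zero _⟩

lemma isTotal_sum {α : Type} (s : Finset α) (f : α → Jet ι) (h : ∀ a ∈ s, IsTotal (f a)) :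
    IsTotal (∑ a ∈ s, f a) := by
  classical
  induction s using Finset.induction_on with
  | empty => simpa using isTotal_zero
  | insert a s ha ih =>
    rw [Finset.sum_insert ha]
    exact (h a (Finset.mem_insert_self _ _)).add
      (ih fun b hb => h b (Finset.mem_insert_of_mem hb))

/-- The du Bois-Reymond lemma. -/
lemma eq_zero_of_isTotal_mul (i : ι) {f : Jet ι} (h : ∀ g, IsTotal (f * g)) : f = 0 := by
  obtain ⟨m, hm⟩ := exists_mem_ordLT f
  -- The test function is quadratic in a derivative above the order of `f`. The antiderivative has
  -- order at most `m`, so its total derivative is affine in `u i ⁽ᵐ⁺¹⁾`; the second partial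
  -- derivative `2 f` must vanish.
  obtain ⟨g, hg⟩ := h (X (i, m + 1) ^ 2)
  have hf : ∀ k, m ≤ k → pderiv (i, k) f = 0 := mem_ordLT.1 hm i
  have h1 : D g ∈ ordLT ι (m + 1 + 1) := by
    rw [hg]
    exact mul_mem (ordLT_mono (by omega) hm) (pow_mem (X_mem_ordLT (Nat.lt_succ_self (m + 1))) 2)
  have h2 := mem_ordLT.1 (antideriv_mem_ordLT h1)
  have h3 : pderiv (i, m + 1) (pderiv (i, m + 1) (D g)) = 0 := by
    rw [pderiv_succ_D, h2 i (m + 1) le_rfl, map_zero, add_zero]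
    have hc : pderiv (i, m + 1) (pderiv (i, m) g) = pderiv (i, m) (pderiv (i, m + 1) g) := by
      classical
      have : ⁅(pderiv (i, m + 1) : Derivation ℝ (Jet ι) (Jet ι)),
          (pderiv (i, m) : Derivation ℝ (Jet ι) (Jet ι))⁆ = 0 := by
        refine derivation_ext fun q => ?_
        rw [Derivation.commutator_apply, pderiv_X, pderiv_X]
        by_cases h1 : q = (i, m) <;> by_cases h2 : q = (i, m + 1) <;> simp [h1, h2]
      have := congrArg (fun d => d g) this
      simp only [Derivation.commutator_apply, Derivation.coe_zero, Pi.zero_apply] at this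
      exact sub_eq_zero.1 this
    rw [hc, h2 i (m + 1) le_rfl, map_zero]
  rw [hg] at h3
  simp only [pow_two] at h3
  simp only [zero_mul, zero_add, one_mul, mul_one, pderiv_mul, map_add, pderiv_X_self,
    hf (m + 1) (by omega)] at h3
  have h5 : f * 2 = 0 := by rw [← h3]; ring
  exact (mul_eq_zero.1 h5).resolve_right two_ne_zero

end Basics

/-! ### Derivations commuting with the total derivative -/

section Evolutionary

variable {ι : Type}

lemma evo_D (Q : ι → Jet ι) (f : Jet ι) : evo Q (D f) = D (evo Q f) := by
  have h : ⁅evo Q, (D : Derivation ℝ (Jet ι) (Jet ι))⁆ = 0 := by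
    refine derivation_ext fun q => ?_
    rw [Derivation.commutator_apply, D_X, evo_X, evo_X, Function.iterate_succ_apply']
    simp
  have := congrArg (fun d => d f) h
  simp only [Derivation.commutator_apply, Derivation.coe_zero, Pi.zero_apply] at this
  exact sub_eq_zero.1 this

lemma iterate_D_X (i : ι) (k n : ℕ) : (D : Jet ι → Jet ι)^[n] (X (i, k)) = X (i, k + n) := by
  induction n with
  | zero => rfl
  | succ n ih => rw [Function.iterate_succ_apply', ih, D_X]; rfl

lemma iterate_D_mem_ordLT {m : ℕ} {f : Jet ι} (hf : f ∈ ordLT ι m) (n : ℕ) :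
    (D : Jet ι → Jet ι)^[n] f ∈ ordLT ι (m + n) := by
  induction n with
  | zero => exact hf
  | succ n ih => rw [Function.iterate_succ_apply']; exact D_mem_ordLT ih

lemma iterate_D_add (n : ℕ) (f g : Jet ι) :
    (D : Jet ι → Jet ι)^[n] (f + g) = (D : Jet ι → Jet ι)^[n] f + (D : Jet ι → Jet ι)^[n] g :=
  iterate_map_add (D : Derivation ℝ (Jet ι) (Jet ι)) n f g

lemma iterate_D_smul (n : ℕ) (c : ℝ) (f : Jet ι) :
    (D : Jet ι → Jet ι)^[n] (c • f) = c • (D : Jet ι → Jet ι)^[n] f := by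
  induction n generalizing f with
  | zero => rfl
  | succ n ih => rw [Function.iterate_succ_apply, Derivation.map_smul, ih, Function.iterate_succ_apply]

lemma iterate_D_zero (n : ℕ) : (D : Jet ι → Jet ι)^[n] 0 = 0 :=
  iterate_map_zero (D : Derivation ℝ (Jet ι) (Jet ι)) n

lemma derivation_sum_apply {A α : Type} [CommRing A] [Algebra ℝ A] (s : Finset α)
    (d : α → Derivation ℝ A A) (f : A) : (∑ a ∈ s, d a) f = ∑ a ∈ s, d a f := by
  have := map_sum (Derivation.coeFnAddMonoidHom (R := ℝ) (A := A) (M := A)) d s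
  exact (congrFun this f).trans (Finset.sum_apply _ _ _)

/-- The Euler operator may be computed with any large enough number of terms. -/
lemma varDeriv_eq {F : Jet ι} {i : ι} {m : ℕ} (h : ∀ k ≥ m, pderiv (i, k) F = 0) :
    varDeriv F i = ∑ k ∈ Finset.range m, (-1) ^ k * (D : Jet ι → Jet ι)^[k] (pderiv (i, k) F) := by
  have key : ∀ n n', n ≤ n' → (∀ k ≥ n, pderiv (i, k) F = 0) →
      ∑ k ∈ Finset.range n, (-1) ^ k * (D : Jet ι → Jet ι)^[k] (pderiv (i, k) F) =
      ∑ k ∈ Finset.range n', (-1) ^ k * (D : Jet ι → Jet ι)^[k] (pderiv (i, k) F) := by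
    intro n n' hn h0
    refine Finset.sum_subset (Finset.range_mono hn) fun k _ hk => ?_
    rw [h0 k (by simpa using hk), iterate_D_zero, mul_zero]
  rw [varDeriv]
  have h' : ∀ k ≥ F.vars.sup Prod.snd + 1, pderiv (i, k) F = 0 :=
    fun k hk => pderiv_eq_zero_of_sup_lt hk
  rcases le_total m (F.vars.sup Prod.snd + 1) with hm | hm
  · rw [key _ _ hm h]
  · rw [key _ _ hm h']

lemma varDeriv_sub_smul (F G : Jet ι) (r : ℝ) (i : ι) :
    varDeriv (F - r • G) i = varDeriv F i - r • varDeriv G i := by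
  obtain ⟨m, hm⟩ := exists_mem_ordLT F
  obtain ⟨n, hn⟩ := exists_mem_ordLT G
  have hF := mem_ordLT.1 (ordLT_mono (le_max_left m n) hm) i
  have hG := mem_ordLT.1 (ordLT_mono (le_max_right m n) hn) i
  rw [varDeriv_eq hF, varDeriv_eq hG,
    varDeriv_eq (m := max m n) fun k hk => by rw [map_sub, Derivation.map_smul, hF k hk, hG k hk]; simp,
    Finset.smul_sum, ← Finset.sum_sub_distrib]
  refine Finset.sum_congr rfl fun k _ => ?_
  rw [map_sub, Derivation.map_smul, sub_eq_add_neg, ← neg_smul, iterate_D_add, iterate_D_smul, mul_add,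
    mul_smul_comm, neg_smul, sub_eq_add_neg]

lemma isTotal_mul_iterate_D (f g : Jet ι) (n : ℕ) :
    IsTotal (f * (D : Jet ι → Jet ι)^[n] g - (-1) ^ n * (D : Jet ι → Jet ι)^[n] f * g) := by
  induction n generalizing f with
  | zero => simpa using isTotal_zero
  | succ n ih =>
    have h1 := ih (D f)
    have h2 := isTotal_D (f * (D : Jet ι → Jet ι)^[n] g)
    convert h2.sub h1 using 1
    rw [Function.iterate_succ_apply', Function.iterate_succ_apply, Derivation.leibniz, pow_succ]
    simp only [smul_eq_mul]
    ring

/-- The first variation formula for the variation of one function. -/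
lemma isTotal_evo_single_sub [DecidableEq ι] (F g : Jet ι) (i : ι) :
    IsTotal (evo (Pi.single i g) F - varDeriv F i * g) := by
  obtain ⟨m, hm⟩ := exists_mem_ordLT F
  -- Since `F` has order less than `m`, the evolutionary field acts on it as this finite
  -- combination, to which integration by parts applies termwise.
  let δ : Derivation ℝ (Jet ι) (Jet ι) :=
    ∑ k ∈ Finset.range m, ((D : Jet ι → Jet ι)^[k] g) • pderiv (i, k)
  have hδ : evo (Pi.single i g) F = δ F := by
    refine derivation_eqOn_supported (s := {q : ι × ℕ | q.2 < m}) ?_ hm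
    rintro ⟨j, k⟩ hk
    simp only [Set.mem_ofPred_eq] at hk
    simp only [Function.comp_apply, evo_X, δ, derivation_sum_apply,
      Derivation.coe_smul, Pi.smul_apply, pderiv_X, smul_eq_mul]
    by_cases hj : j = i
    · subst hj
      rw [Finset.sum_eq_single k]
      · simp
      · intro l _ hl
        rw [Pi.single_eq_of_ne (by simpa using hl.symm), mul_zero]
      · intro h; exact absurd (Finset.mem_range.2 hk) h
    · rw [Pi.single_eq_of_ne hj, iterate_D_zero]
      symm
      refine Finset.sum_eq_zero fun l _ => ?_
      rw [Pi.single_eq_of_ne (by simp [hj]), mul_zero]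
  rw [hδ, varDeriv_eq (mem_ordLT.1 hm i), Finset.sum_mul]
  simp only [δ, derivation_sum_apply, Derivation.coe_smul, Pi.smul_apply,
    smul_eq_mul, ← Finset.sum_sub_distrib]
  refine isTotal_sum _ _ fun k _ => ?_
  rw [mul_comm ((D : Jet ι → Jet ι)^[k] g)]
  exact isTotal_mul_iterate_D _ _ _

/-- A gradient is determined by its pairings modulo total derivatives: the first variation formula
combined with the du Bois-Reymond lemma. -/
lemma varDeriv_eq_of_isTotal [DecidableEq ι] {F f : Jet ι} {i : ι}
    (h : ∀ g, IsTotal (evo (Pi.single i g) F - f * g)) : varDeriv F i = f := by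
  rw [← sub_eq_zero]
  refine eq_zero_of_isTotal_mul i fun g => ?_
  convert (h g).sub (isTotal_evo_single_sub F g i) using 1
  ring

end Evolutionary

lemma half_mul_two (A : Type) [CommRing A] [Algebra ℝ A] : algebraMap ℝ A (1 / 2) * 2 = 1 := by
  rw [← map_ofNat (algebraMap ℝ A) 2, ← map_mul]; norm_num

/-! ### Sums over pairs and triples of indices -/

section Sums

variable {κ A : Type} [Fintype κ] [CommRing A] [Algebra ℝ A]

/-- Relabelling the indices does not change the sum, so summands need only agree after
symmetrization. The explicit antiderivatives below are thereby checked by a polynomial identity at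
fixed indices. -/
lemma sum_sum_eq_of_symm {F G : κ → κ → A}
    (h : ∀ i j, F i j + F j i = G i j + G j i) : ∑ i, ∑ j, F i j = ∑ i, ∑ j, G i j := by
  have hs : ∀ F : κ → κ → A, ∑ i, ∑ j, (F i j + F j i) = 2 * ∑ i, ∑ j, F i j := by
    intro F
    simp only [Finset.sum_add_distrib]
    rw [Finset.sum_comm (f := fun i j => F j i)]
    ring
  have h1 : 2 * ∑ i, ∑ j, F i j = 2 * ∑ i, ∑ j, G i j := by
    rw [← hs, ← hs]; simp only [h]
  have h2 := congrArg (fun a => algebraMap ℝ A (1 / 2) * a) h1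
  simpa only [← mul_assoc, half_mul_two, one_mul] using h2

lemma sum_sum_sum_eq_of_symm {F G : κ → κ → κ → A}
    (h : ∀ i j k, F i j k + F i k j + F j i k + F j k i + F k i j + F k j i =
      G i j k + G i k j + G j i k + G j k i + G k i j + G k j i) :
    ∑ i, ∑ j, ∑ k, F i j k = ∑ i, ∑ j, ∑ k, G i j k := by
  have hs : ∀ F : κ → κ → κ → A, ∑ i, ∑ j, ∑ k,
      (F i j k + F i k j + F j i k + F j k i + F k i j + F k j i) =
      6 * ∑ i, ∑ j, ∑ k, F i j k := by
    intro F
    have s1 : ∀ F : κ → κ → κ → A, ∑ i, ∑ j, ∑ k, F i k j = ∑ i, ∑ j, ∑ k, F i j k :=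
      fun F => Finset.sum_congr rfl fun i _ => Finset.sum_comm
    have s2 : ∀ F : κ → κ → κ → A, ∑ i, ∑ j, ∑ k, F j i k = ∑ i, ∑ j, ∑ k, F i j k :=
      fun F => Finset.sum_comm
    have t4 := (s2 fun i j k => F i k j).trans (s1 F)
    have t5 := (s1 fun i j k => F j i k).trans (s2 F)
    have t6 := (s2 fun i j k => F k i j).trans t5
    simp only [Finset.sum_add_distrib]
    rw [s1 F, s2 F, t4, t5, t6]
    ring
  have h1 : 6 * ∑ i, ∑ j, ∑ k, F i j k = 6 * ∑ i, ∑ j, ∑ k, G i j k := by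
    rw [← hs, ← hs]; simp only [h]
  have h6 : ∀ a b : A, 6 * a = 6 * b → a = b := by
    intro a b hab
    have h2 := congrArg (fun a => algebraMap ℝ A (1 / 6) * a) hab
    have h3 : algebraMap ℝ A (1 / 6) * 6 = 1 := by
      rw [← map_ofNat (algebraMap ℝ A) 6, ← map_mul]; norm_num
    simpa only [← mul_assoc, h3, one_mul] using h2
  exact h6 _ _ h1

end Sums

/-! ### The algebra of the operators `H` and `J` -/

section Algebra

variable {κ ι : Type} [Fintype κ]

/-- `h = H ω` with `A = D⁻¹(v ∧ ω)` (up to a constant skew matrix). -/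
structure HData (v ω h : κ → Jet ι) (A : κ → κ → Jet ι) : Prop where
  prim : ∀ i j, D (A i j) = v i * ω j - ω i * v j
  skew : ∀ i j, A i j = -A j i
  eq : ∀ j, h j = D (ω j) + ∑ i, v i * A i j

/-- `ω = J e` with `p = D⁻¹(v · e)` (up to a constant). -/
structure JData (v e ω : κ → Jet ι) (p : Jet ι) : Prop where
  prim : D p = ∑ i, v i * e i
  eq : ∀ i, ω i = D (e i) + p * v i

/-- The trilinear form `k A ω`. -/
noncomputable def tri (k : κ → Jet ι) (A : κ → κ → Jet ι) (ω : κ → Jet ι) : Jet ι :=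
  ∑ i, ∑ j, k i * A i j * ω j

lemma D_sum (f : κ → Jet ι) : D (∑ i, f i) = ∑ i, D (f i) := map_sum _ _ _

lemma D_mul (f g : Jet ι) : D (f * g) = f * D g + g * D f := Derivation.leibniz _ _ _

lemma der_mul (δ : Derivation ℝ (Jet ι) (Jet ι)) (f g : Jet ι) :
    δ (f * g) = f * δ g + g * δ f := Derivation.leibniz _ _ _

/-- `D` is skew, and the nonlocal term `v ⌟ D⁻¹(v ∧ ·)` is skew because `D⁻¹` is; the antiderivative
collects `ω · ω'` from the first and half the pairing of `A` with `A'` from the second. -/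
lemma HData.isTotal_skew {v ω h ω' h' : κ → Jet ι} {A A' : κ → κ → Jet ι}
    (H : HData v ω h A) (H' : HData v ω' h' A') : IsTotal (pair ω h' + pair ω' h) := by
  refine ⟨∑ i, ω i * ω' i + C (1 / 2) * ∑ i, ∑ j, A i j * A' i j, ?_⟩
  have hd : ∑ i, ∑ j, (C (1 / 2) * (A i j * (v i * ω' j - ω' i * v j) +
      A' i j * (v i * ω j - ω i * v j))) =
      ∑ i, ∑ j, (ω i * (v j * A' j i) + ω' i * (v j * A j i)) := by
    refine sum_sum_eq_of_symm fun i j => ?_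
    rw [H.skew j i, H'.skew j i]
    have h2 : (C (1 / 2) : Jet ι) * 2 = 1 := half_mul_two (Jet ι)
    linear_combination (v i * ω' j * A i j - ω' i * v j * A i j + v i * ω j * A' i j
      - ω i * v j * A' i j) * h2
  simp only [map_add, D_sum, D_mul, D_C, mul_zero, add_zero, H.prim, H'.prim, Finset.mul_sum,
    pair, H.eq, H'.eq, mul_add, Finset.sum_add_distrib] at hd ⊢
  linear_combination hd

lemma JData.isTotal_skew {v e ω e' ω' : κ → Jet ι} {p p' : Jet ι}
    (J : JData v e ω p) (J' : JData v e' ω' p') : IsTotal (pair ω e' + pair ω' e) := by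
  refine ⟨∑ i, e i * e' i + p * p', ?_⟩
  simp only [map_add, D_sum, D_mul, J.prim, J'.prim, Finset.mul_sum, pair, J.eq, J'.eq,
    ← Finset.sum_add_distrib]
  exact Finset.sum_congr rfl fun i _ => by ring

section Variation

variable {v k : κ → Jet ι} {δ : Derivation ℝ (Jet ι) (Jet ι)}

/-- The variation of `H`, paired with a covector field. -/
lemma HData.isTotal_variation (hδ : ∀ f, δ (D f) = D (δ f)) (hk : ∀ i, δ (v i) = k i)
    {ω₁ h₁ ω₂ h₂ : κ → Jet ι} {A₁ A₂ : κ → κ → Jet ι}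
    (H₁ : HData v ω₁ h₁ A₁) (H₂ : HData v ω₂ h₂ A₂) :
    IsTotal (∑ i, ω₂ i * δ (h₁ i) + ∑ i, h₂ i * δ (ω₁ i) - (tri k A₁ ω₂ - tri k A₂ ω₁)) := by
  -- The same integration by parts as for skew-adjointness, with `δ ω₁`, `δ A₁` in place of the
  -- first field. The terms left over are those in which `δ` falls on an explicit `v`.
  refine ⟨∑ i, ω₂ i * δ (ω₁ i) + C (1 / 2) * ∑ i, ∑ j, A₂ i j * δ (A₁ i j), ?_⟩
  have hA : ∀ i j, D (δ (A₁ i j)) =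
      v i * δ (ω₁ j) + ω₁ j * k i - (ω₁ i * k j + v j * δ (ω₁ i)) := by
    intro i j
    rw [← hδ, H₁.prim, map_sub, der_mul, der_mul, hk, hk]
  have hs : ∀ i j, δ (A₁ i j) = -δ (A₁ j i) := fun i j => by rw [H₁.skew i j, map_neg]
  have hd : ∑ i, ∑ j, (C (1 / 2) * (A₂ i j * (v i * δ (ω₁ j) + ω₁ j * k i -
      (ω₁ i * k j + v j * δ (ω₁ i))) + δ (A₁ i j) * (v i * ω₂ j - ω₂ i * v j))) =
      ∑ i, ∑ j, (ω₂ i * (v j * δ (A₁ j i) + A₁ j i * k j) + v j * A₂ j i * δ (ω₁ i) -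
        (k i * A₁ i j * ω₂ j - k i * A₂ i j * ω₁ j)) := by
    refine sum_sum_eq_of_symm fun i j => ?_
    rw [hs j i, H₁.skew j i, H₂.skew j i]
    have h2 : (C (1 / 2) : Jet ι) * 2 = 1 := half_mul_two (Jet ι)
    linear_combination (A₂ i j * (v i * δ (ω₁ j) + ω₁ j * k i -
      (ω₁ i * k j + v j * δ (ω₁ i))) + δ (A₁ i j) * (v i * ω₂ j - ω₂ i * v j)) * h2
  simp only [map_add, D_sum, D_mul, D_C, mul_zero, add_zero, H₂.prim, hA, Finset.mul_sum, hd]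
  simp only [tri, H₁.eq, H₂.eq, map_add, map_sum, der_mul, hk, hδ, mul_add, add_mul,
    Finset.sum_add_distrib, Finset.sum_sub_distrib, Finset.mul_sum, Finset.sum_mul]
  rw [Finset.sum_congr rfl fun i _ => mul_comm (D (ω₂ i)) (δ (ω₁ i))]
  ring

/-- The variation of `J`, paired with a vector field. -/
lemma JData.isTotal_variation (hδ : ∀ f, δ (D f) = D (δ f)) (hk : ∀ i, δ (v i) = k i)
    {e₂ ω₂ e₃ ω₃ : κ → Jet ι} {p₂ p₃ : Jet ι}
    (J₂ : JData v e₂ ω₂ p₂) (J₃ : JData v e₃ ω₃ p₃) :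
    IsTotal (∑ i, e₃ i * δ (ω₂ i) + ∑ i, ω₃ i * δ (e₂ i) -
      (p₂ * ∑ i, k i * e₃ i - p₃ * ∑ i, k i * e₂ i)) := by
  refine ⟨∑ i, e₃ i * δ (e₂ i) + p₃ * δ p₂, ?_⟩
  have hp : D (δ p₂) = ∑ i, (v i * δ (e₂ i) + e₂ i * k i) := by
    rw [← hδ, J₂.prim, map_sum]
    exact Finset.sum_congr rfl fun i _ => by rw [der_mul, hk]
  simp only [map_add, D_sum, J₃.prim, hp, J₂.eq, J₃.eq, der_mul, hk, hδ, Finset.mul_sum,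
    ← Finset.sum_add_distrib, ← Finset.sum_sub_distrib]
  exact Finset.sum_congr rfl fun i _ => by ring

end Variation

/-- The Schouten bracket of `H` with itself. -/
lemma HData.isTotal_schouten {v ω₁ h₁ ω₂ h₂ ω₃ h₃ : κ → Jet ι} {A₁ A₂ A₃ : κ → κ → Jet ι}
    (H₁ : HData v ω₁ h₁ A₁) (H₂ : HData v ω₂ h₂ A₂) (H₃ : HData v ω₃ h₃ A₃) :
    IsTotal ((tri h₃ A₁ ω₂ - tri h₃ A₂ ω₁) + (tri h₁ A₂ ω₃ - tri h₁ A₃ ω₂) +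
      (tri h₂ A₃ ω₁ - tri h₂ A₁ ω₃)) := by
  -- The terms of the form `D ω · A · ω` come from the cyclic sum of the forms `ω A ω`; the terms
  -- cubic in nonlocal data, `v A A ω`, come from the product of the three matrices.
  refine ⟨∑ i, ∑ j, (ω₃ i * A₁ i j * ω₂ j + ω₁ i * A₂ i j * ω₃ j + ω₂ i * A₃ i j * ω₁ j) +
    ∑ i, ∑ j, ∑ k, A₃ i k * A₁ k j * A₂ i j, ?_⟩
  have hdist : ∀ {ω h : κ → Jet ι} {A : κ → κ → Jet ι}, HData v ω h A →
      ∀ (B : κ → κ → Jet ι) (η : κ → Jet ι), tri h B η =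
      ∑ i, ∑ j, D (ω i) * B i j * η j + ∑ i, ∑ j, ∑ k, v k * A k i * B i j * η j := by
    intro ω h A H B η
    simp only [tri, H.eq, add_mul, Finset.sum_mul, Finset.sum_add_distrib]
  have hdouble : ∑ i, ∑ j, D (ω₃ i * A₁ i j * ω₂ j + ω₁ i * A₂ i j * ω₃ j + ω₂ i * A₃ i j * ω₁ j) =
      ∑ i, ∑ j, (D (ω₃ i) * A₁ i j * ω₂ j - D (ω₃ i) * A₂ i j * ω₁ j +
        (D (ω₁ i) * A₂ i j * ω₃ j - D (ω₁ i) * A₃ i j * ω₂ j) +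
        (D (ω₂ i) * A₃ i j * ω₁ j - D (ω₂ i) * A₁ i j * ω₃ j)) := by
    refine sum_sum_eq_of_symm fun i j => ?_
    simp only [map_add, D_mul, H₁.prim, H₂.prim, H₃.prim]
    rw [H₁.skew j i, H₂.skew j i, H₃.skew j i]
    ring
  have htriple : ∑ i, ∑ j, ∑ k, D (A₃ i k * A₁ k j * A₂ i j) =
      ∑ i, ∑ j, ∑ k, (v k * A₃ k i * A₁ i j * ω₂ j - v k * A₃ k i * A₂ i j * ω₁ j +
        (v k * A₁ k i * A₂ i j * ω₃ j - v k * A₁ k i * A₃ i j * ω₂ j) +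
        (v k * A₂ k i * A₃ i j * ω₁ j - v k * A₂ k i * A₁ i j * ω₃ j)) := by
    refine sum_sum_sum_eq_of_symm fun i j k => ?_
    simp only [D_mul, H₁.prim, H₂.prim, H₃.prim]
    rw [H₁.skew j i, H₂.skew j i, H₃.skew j i, H₁.skew k i, H₂.skew k i, H₃.skew k i,
      H₁.skew k j, H₂.skew k j, H₃.skew k j]
    ring
  simp only [map_add (D : Derivation ℝ (Jet ι) (Jet ι)), D_sum] at hdouble htriple ⊢
  rw [hdouble, htriple]
  simp only [hdist H₁, hdist H₂, hdist H₃, Finset.sum_add_distrib, Finset.sum_sub_distrib]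
  ring

/-- The Schouten bracket of `H` and `J⁻¹`. -/
lemma isTotal_mixed_schouten {v e₁ ω₁ h₁ e₂ ω₂ h₂ e₃ ω₃ h₃ : κ → Jet ι}
    {A₁ A₂ A₃ : κ → κ → Jet ι} {p₁ p₂ p₃ : Jet ι}
    (H₁ : HData v ω₁ h₁ A₁) (H₂ : HData v ω₂ h₂ A₂) (H₃ : HData v ω₃ h₃ A₃)
    (J₁ : JData v e₁ ω₁ p₁) (J₂ : JData v e₂ ω₂ p₂) (J₃ : JData v e₃ ω₃ p₃) :
    IsTotal ((tri e₃ A₁ ω₂ - tri e₃ A₂ ω₁ + (p₁ * ∑ i, h₃ i * e₂ i - p₂ * ∑ i, h₃ i * e₁ i)) +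
      (tri e₁ A₂ ω₃ - tri e₁ A₃ ω₂ + (p₂ * ∑ i, h₁ i * e₃ i - p₃ * ∑ i, h₁ i * e₂ i)) +
      (tri e₂ A₃ ω₁ - tri e₂ A₁ ω₃ + (p₃ * ∑ i, h₂ i * e₁ i - p₁ * ∑ i, h₂ i * e₃ i))) := by
  -- The form `e A e` plays the role of `ω A ω`, with `D e = ω - p v`; the terms `p ω · e` absorb
  -- what this substitution produces.
  refine ⟨∑ i, ∑ j, (e₃ i * A₁ i j * e₂ j + e₁ i * A₂ i j * e₃ j + e₂ i * A₃ i j * e₁ j) +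
    ((p₂ * ∑ j, ω₁ j * e₃ j - p₃ * ∑ j, ω₁ j * e₂ j) +
      (p₃ * ∑ j, ω₂ j * e₁ j - p₁ * ∑ j, ω₂ j * e₃ j) +
      (p₁ * ∑ j, ω₃ j * e₂ j - p₂ * ∑ j, ω₃ j * e₁ j)), ?_⟩
  have hdist : ∀ {ω h : κ → Jet ι} {A : κ → κ → Jet ι}, HData v ω h A →
      ∀ (p : Jet ι) (η : κ → Jet ι), p * ∑ i, h i * η i =
      ∑ i, p * (D (ω i) * η i) + ∑ i, ∑ j, p * (v j * A j i * η i) := by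
    intro ω h A H p η
    simp only [H.eq, add_mul, Finset.sum_mul, Finset.sum_add_distrib, mul_add, Finset.mul_sum]
  have hprod : ∀ {e ω : κ → Jet ι} {p : Jet ι}, JData v e ω p → ∀ η ζ : κ → Jet ι,
      D (p * ∑ j, η j * ζ j) =
        ∑ i, p * (η i * D (ζ i) + ζ i * D (η i)) + ∑ i, ∑ j, v i * e i * (η j * ζ j) := by
    intro e ω p J η ζ
    rw [D_mul, J.prim, D_sum]
    simp only [D_mul, Finset.mul_sum, Finset.sum_mul]
    congr 1
    exact Finset.sum_congr rfl fun i _ => Finset.sum_congr rfl fun j _ => by ring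
  have hD : ∀ {e ω : κ → Jet ι} {p : Jet ι}, JData v e ω p → ∀ i, D (e i) = ω i - p * v i :=
    fun J i => by rw [J.eq]; ring
  have hsingle : ∑ i, (p₂ * (ω₁ i * D (e₃ i) + e₃ i * D (ω₁ i)) -
        p₃ * (ω₁ i * D (e₂ i) + e₂ i * D (ω₁ i)) +
      (p₃ * (ω₂ i * D (e₁ i) + e₁ i * D (ω₂ i)) - p₁ * (ω₂ i * D (e₃ i) + e₃ i * D (ω₂ i))) +
      (p₁ * (ω₃ i * D (e₂ i) + e₂ i * D (ω₃ i)) - p₂ * (ω₃ i * D (e₁ i) + e₁ i * D (ω₃ i)))) =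
      ∑ i, (p₁ * (D (ω₃ i) * e₂ i) - p₂ * (D (ω₃ i) * e₁ i) +
        (p₂ * (D (ω₁ i) * e₃ i) - p₃ * (D (ω₁ i) * e₂ i)) +
        (p₃ * (D (ω₂ i) * e₁ i) - p₁ * (D (ω₂ i) * e₃ i))) := by
    refine Finset.sum_congr rfl fun i _ => ?_
    rw [hD J₁, hD J₂, hD J₃]
    ring
  have hdouble : ∑ i, ∑ j, (D (e₃ i * A₁ i j * e₂ j + e₁ i * A₂ i j * e₃ j + e₂ i * A₃ i j * e₁ j) +
      ((v i * e₂ i * (ω₁ j * e₃ j) - v i * e₃ i * (ω₁ j * e₂ j)) +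
      (v i * e₃ i * (ω₂ j * e₁ j) - v i * e₁ i * (ω₂ j * e₃ j)) +
      (v i * e₁ i * (ω₃ j * e₂ j) - v i * e₂ i * (ω₃ j * e₁ j)))) =
      ∑ i, ∑ j, ((e₃ i * A₁ i j * ω₂ j - e₃ i * A₂ i j * ω₁ j +
        (p₁ * (v j * A₃ j i * e₂ i) - p₂ * (v j * A₃ j i * e₁ i))) +
        (e₁ i * A₂ i j * ω₃ j - e₁ i * A₃ i j * ω₂ j +
        (p₂ * (v j * A₁ j i * e₃ i) - p₃ * (v j * A₁ j i * e₂ i))) +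
        (e₂ i * A₃ i j * ω₁ j - e₂ i * A₁ i j * ω₃ j +
        (p₃ * (v j * A₂ j i * e₁ i) - p₁ * (v j * A₂ j i * e₃ i)))) := by
    refine sum_sum_eq_of_symm fun i j => ?_
    simp only [map_add, D_mul, H₁.prim, H₂.prim, H₃.prim, hD J₁, hD J₂, hD J₃]
    rw [H₁.skew j i, H₂.skew j i, H₃.skew j i]
    ring
  simp only [map_add (D : Derivation ℝ (Jet ι) (Jet ι)),
    map_sub (D : Derivation ℝ (Jet ι) (Jet ι)), D_sum, hprod J₁, hprod J₂, hprod J₃,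
    hdist H₁, hdist H₂, hdist H₃, tri, Finset.sum_add_distrib, Finset.sum_sub_distrib]
    at hdouble hsingle ⊢
  linear_combination hdouble + hsingle

end Algebra

/-! ### The graphs of `H` and `J` -/

/-- If a sum of squares of real polynomials is constant, then so are the polynomials. -/
lemma eq_C_of_sum_mul_self_eq_C {σ κ : Type} [Fintype κ] {f : κ → MvPolynomial σ ℝ} {c : ℝ}
    (h : ∑ i, f i * f i = C c) (i : κ) : f i = C (constantCoeff (f i)) := by
  refine MvPolynomial.funext fun x => ?_
  -- The restriction of `f i` to the line through the origin and `x`. It is bounded because its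
  -- square is at most `c`, and a bounded real polynomial in one variable is constant.
  let q : Polynomial ℝ := aeval (fun s => Polynomial.C (x s) * Polynomial.X) (f i)
  have hq : ∀ t : ℝ, q.eval t = eval (fun s => x s * t) (f i) := by
    intro t
    have : (Polynomial.evalRingHom t).comp
        (aeval (fun s => Polynomial.C (x s) * Polynomial.X) :
          MvPolynomial σ ℝ →ₐ[ℝ] Polynomial ℝ).toRingHom = eval (fun s => x s * t) := by
      refine MvPolynomial.ringHom_ext (fun r => ?_) fun s => ?_
      · simp
      · simp
    exact congrArg (fun φ => φ (f i)) this
  have hb : ∀ t : ℝ, |q.eval t| ≤ |c| + 1 := by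
    intro t
    have h1 := congrArg (eval fun s => x s * t) h
    simp only [map_sum, map_mul, eval_C] at h1
    have h2 := Finset.single_le_sum (f := fun i => eval (fun s => x s * t) (f i) *
      eval (fun s => x s * t) (f i)) (fun j _ => mul_self_nonneg _) (Finset.mem_univ i)
    rw [h1, ← hq] at h2
    have h3 := le_abs_self c
    have h4 := abs_nonneg c
    refine abs_le_of_sq_le_sq ?_ (by linarith)
    nlinarith
  have hdeg : q.degree ≤ 0 :=
    (Polynomial.isBoundedUnder_abs_atTop_iff q).1
      (Filter.isBoundedUnder_of ⟨|c| + 1, hb⟩)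
  have hconst : q.eval 1 = q.eval 0 := by
    rw [Polynomial.eq_C_of_degree_le_zero hdeg, Polynomial.eval_C, Polynomial.eval_C]
  rw [hq, hq] at hconst
  simp only [mul_one, mul_zero] at hconst
  rw [hconst, eval_C, constantCoeff_eq, ← constantCoeff_eq, ← eval_zero]
  rfl

section Graphs

variable {κ ι : Type} {b : κ → ι}

/-- Graphs that are linear subspaces. -/
structure Op.IsLinear (L : Op κ ι) : Prop where
  zero : L 0 0
  add : ∀ {ξ h η k}, L ξ h → L η k → L (ξ + η) (h + k)
  smul : ∀ (c : ℝ) {ξ h}, L ξ h → L (c • ξ) (c • h)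

lemma Op.IsLinear.sub_smul {L : Op κ ι} (hL : L.IsLinear) (r : ℝ) {ξ h η k : κ → Jet ι}
    (h₁ : L ξ h) (h₂ : L η k) : L (ξ - r • η) (h - r • k) := by
  rw [sub_eq_add_neg, sub_eq_add_neg, ← neg_smul, ← neg_smul]
  exact hL.add h₁ (hL.smul _ h₂)

lemma Op.IsLinear.inv {L : Op κ ι} (hL : L.IsLinear) : L.inv.IsLinear :=
  ⟨hL.zero, fun h k => hL.add h k, fun c _ _ h => hL.smul c h⟩

lemma Op.IsLinear.comp {L M : Op κ ι} (hL : L.IsLinear) (hM : M.IsLinear) :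
    (L.comp M).IsLinear := by
  refine ⟨⟨0, hM.zero, hL.zero⟩, ?_, ?_⟩
  · rintro ξ h η k ⟨ζ, h1, h2⟩ ⟨ζ', h3, h4⟩
    exact ⟨ζ + ζ', hM.add h1 h3, hL.add h2 h4⟩
  · rintro c ξ h ⟨ζ, h1, h2⟩
    exact ⟨c • ζ, hM.smul c h1, hL.smul c h2⟩

lemma Op.IsLinear.lin {L M : Op κ ι} (hL : L.IsLinear) (hM : M.IsLinear) (a c : ℝ) :
    (Op.lin a c L M).IsLinear := by
  refine ⟨⟨0, 0, hL.zero, hM.zero, by simp⟩, ?_, ?_⟩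
  · rintro ξ h η k ⟨k₁, l₁, h1, h2, rfl⟩ ⟨k₂, l₂, h3, h4, rfl⟩
    exact ⟨k₁ + k₂, l₁ + l₂, hL.add h1 h3, hM.add h2 h4, by module⟩
  · rintro r ξ h ⟨k₁, l₁, h1, h2, rfl⟩
    exact ⟨r • k₁, r • l₁, hL.smul r h1, hM.smul r h2, by module⟩

variable [Fintype κ]

lemma opH_iff {ω h : κ → Jet ι} : opH b ω h ↔ ∃ A : κ → κ → Jet ι,
    (∀ i j, IsPrimitive (u (b i) * ω j - ω i * u (b j)) (A i j)) ∧
      HData (fun i => u (b i)) ω h A := by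
  constructor
  · rintro ⟨A, hA, hh⟩
    refine ⟨A, hA, fun i j => (hA i j).1, fun i j => ?_, hh⟩
    refine (hA i j).unique ?_
    convert (hA j i).neg using 1
    ring
  · rintro ⟨A, hA, H⟩
    exact ⟨A, hA, H.eq⟩

lemma opH.data {ω h : κ → Jet ι} (H : opH b ω h) :
    ∃ A, HData (fun i => u (b i)) ω h A := by
  obtain ⟨A, -, H⟩ := opH_iff.1 H
  exact ⟨A, H⟩

lemma opJ.data {e ω : κ → Jet ι} (H : opJ b e ω) :
    ∃ p, JData (fun i => u (b i)) e ω p := by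
  obtain ⟨p, hp, h⟩ := H
  exact ⟨p, hp.1, h⟩

lemma opH_isLinear : (opH b).IsLinear := by
  refine ⟨⟨0, ?_, ?_⟩, ?_, ?_⟩
  · intro i j; simpa using isPrimitive_zero
  · intro j; simp
  · rintro ξ h η k ⟨A, hA, hh⟩ ⟨B, hB, hk⟩
    refine ⟨A + B, fun i j => ?_, fun j => ?_⟩
    · convert (hA i j).add (hB i j) using 1
      · simp only [Pi.add_apply]; ring
      · rfl
    · simp only [Pi.add_apply, hh, hk, map_add, mul_add, Finset.sum_add_distrib]; ring
  · rintro c ξ h ⟨A, hA, hh⟩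
    refine ⟨c • A, fun i j => ?_, fun j => ?_⟩
    · convert (hA i j).smul c using 1
      · simp only [Pi.smul_apply, smul_eq_C_mul]; ring
      · rfl
    · simp only [Pi.smul_apply, hh, Derivation.map_smul, mul_smul_comm, smul_add,
        Finset.smul_sum]

lemma opJ_isLinear : (opJ b).IsLinear := by
  refine ⟨⟨0, ?_, ?_⟩, ?_, ?_⟩
  · simpa using isPrimitive_zero
  · intro j; simp
  · rintro ξ h η k ⟨p, hp, hh⟩ ⟨q, hq, hk⟩
    refine ⟨p + q, ?_, fun j => ?_⟩
    · convert hp.add hq using 1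
      simp only [Pi.add_apply, mul_add, Finset.sum_add_distrib]
    · simp only [Pi.add_apply, hh, hk, map_add]; ring
  · rintro c ξ h ⟨p, hp, hh⟩
    refine ⟨c • p, ?_, fun j => ?_⟩
    · convert hp.smul c using 1
      simp only [Pi.smul_apply, mul_smul_comm, Finset.smul_sum]
    · simp only [Pi.smul_apply, hh, Derivation.map_smul, smul_add, smul_mul_assoc]

lemma opH_single_valued {ω h h' : κ → Jet ι} (H : opH b ω h) (H' : opH b ω h') : h = h' := by
  obtain ⟨A, hA, hh⟩ := H
  obtain ⟨B, hB, hh'⟩ := H'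
  have : A = B := by
    ext1 i; ext1 j
    exact (hA i j).unique (hB i j)
  ext1 j
  rw [hh, hh', this]

lemma opJ_single_valued {e ω ω' : κ → Jet ι} (H : opJ b e ω) (H' : opJ b e ω') : ω = ω' := by
  obtain ⟨p, hp, h⟩ := H
  obtain ⟨q, hq, h'⟩ := H'
  ext1 j
  rw [h, h', hp.unique hq]

/-- `J` is injective: along a solution of `J e = 0` the sum `p² + |e|²` is constant. -/
lemma eq_zero_of_opJ_zero (hb : Function.Injective b) {e : κ → Jet ι} (H : opJ b e 0) : e = 0 := by
  obtain ⟨p, hp, h⟩ := H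
  have h' : ∀ i, D (e i) = -(p * u (b i)) := fun i => by
    have := h i
    rw [Pi.zero_apply] at this
    linear_combination -this
  have hconst : D (p * p + ∑ i, e i * e i) = 0 := by
    simp only [map_add, D_sum, D_mul, hp.1, h', Finset.mul_sum, ← Finset.sum_add_distrib]
    exact Finset.sum_eq_zero fun i _ => by ring
  have hc := eq_C_of_D_eq_zero hconst
  have hsum : ∑ i : Option κ, i.elim p e * i.elim p e =
      C (constantCoeff (p * p + ∑ i, e i * e i)) := by
    rw [Fintype.sum_option]
    exact hc
  have hp0 : p = 0 := by
    have := eq_C_of_sum_mul_self_eq_C hsum none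
    simpa [hp.2] using this
  have he : ∀ i, e i = C (constantCoeff (e i)) := fun i => eq_C_of_sum_mul_self_eq_C hsum (some i)
  have hve := hp.1
  rw [hp0, map_zero] at hve
  ext1 i
  -- Now `p = 0` and `v · e = 0` with constant `e`; the coefficient of `u (b i)` is `e i`.
  have h1 := congrArg (pderiv (b i, 0)) hve
  rw [map_zero, map_sum, Finset.sum_eq_single i] at h1
  · rw [he i, u, pderiv_mul, pderiv_X_self, pderiv_C, mul_zero, one_mul, add_zero] at h1
    rw [he i, ← h1, Pi.zero_apply]
  · intro j _ hj
    rw [he j, u, pderiv_mul, pderiv_X_of_ne, pderiv_C, mul_zero, zero_mul, add_zero]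
    simpa using fun h => hj (hb h)
  · simp

lemma opJ_injective (hb : Function.Injective b) {e e' ω : κ → Jet ι} (H : opJ b e ω) (H' : opJ b e' ω) : e = e' := by
  have h := opJ_isLinear.sub_smul 1 H H'
  rw [one_smul, one_smul, sub_self] at h
  exact sub_eq_zero.1 (eq_zero_of_opJ_zero hb h)

end Graphs

/-! ### Hamiltonian operators on a block of variables -/

section Block

variable {κ ι : Type} [Fintype κ] {b : κ → ι}

/-- The operator `L` on the block `b` is skew-adjoint, satisfies the Jacobi identity for all
derivations which extend its values, and has elements with leading terms `u⁽²ᵏ⁺²⁾` in its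
domain. -/
structure IsBlockHamiltonian (b : κ → ι) (L : Op κ ι) : Prop where
  linear : L.IsLinear
  single_valued : ∀ {ξ h k}, L ξ h → L ξ k → h = k
  skew : ∀ {ξ h η k}, L ξ h → L η k → IsTotal (pair ξ k + pair η h)
  -- The components may involve variables outside the block, so the derivations act on the whole
  -- algebra while only their values on the block are prescribed.
  jacobi : ∀ {ξ₁ h₁ ξ₂ h₂ ξ₃ h₃} {δ₁ δ₂ δ₃ : Derivation ℝ (Jet ι) (Jet ι)},
    (∀ f, δ₁ (D f) = D (δ₁ f)) → (∀ f, δ₂ (D f) = D (δ₂ f)) → (∀ f, δ₃ (D f) = D (δ₃ f)) →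
    (∀ i, δ₁ (u (b i)) = h₁ i) → (∀ i, δ₂ (u (b i)) = h₂ i) → (∀ i, δ₃ (u (b i)) = h₃ i) →
    L ξ₁ h₁ → L ξ₂ h₂ → L ξ₃ h₃ →
    IsTotal ((∑ i, δ₁ (ξ₂ i) * h₃ i + ∑ i, ξ₂ i * δ₃ (h₁ i)) +
      (∑ i, δ₂ (ξ₃ i) * h₁ i + ∑ i, ξ₃ i * δ₁ (h₂ i)) +
      (∑ i, δ₃ (ξ₁ i) * h₂ i + ∑ i, ξ₁ i * δ₂ (h₃ i)))
  leading : ∀ k, ∃ ξ h, L ξ h ∧ ∀ i, ξ i - X (b i, 2 * (k + 1)) ∈ ordLT ι (2 * (k + 1))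

/-- The cyclic sum in the Jacobi identity, up to total derivatives. -/
lemma isTotal_cyclic {ξ₁ h₁ ξ₂ h₂ ξ₃ h₃ : κ → Jet ι} {δ₁ δ₂ δ₃ : Derivation ℝ (Jet ι) (Jet ι)}
    {s₁ s₂ s₃ : Jet ι}
    (h1 : IsTotal (∑ i, ξ₂ i * δ₃ (h₁ i) + ∑ i, h₂ i * δ₃ (ξ₁ i) - s₃))
    (h2 : IsTotal (∑ i, ξ₃ i * δ₁ (h₂ i) + ∑ i, h₃ i * δ₁ (ξ₂ i) - s₁))
    (h3 : IsTotal (∑ i, ξ₁ i * δ₂ (h₃ i) + ∑ i, h₁ i * δ₂ (ξ₃ i) - s₂))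
    (h : IsTotal (s₃ + s₁ + s₂)) :
    IsTotal ((∑ i, δ₁ (ξ₂ i) * h₃ i + ∑ i, ξ₂ i * δ₃ (h₁ i)) +
      (∑ i, δ₂ (ξ₃ i) * h₁ i + ∑ i, ξ₃ i * δ₁ (h₂ i)) +
      (∑ i, δ₃ (ξ₁ i) * h₂ i + ∑ i, ξ₁ i * δ₂ (h₃ i))) := by
  convert ((h1.add h2).add h3).add h using 1
  simp only [mul_comm (h₁ _), mul_comm (h₂ _), mul_comm (h₃ _)]
  ring

lemma tri_lin (a c : ℝ) (h e : κ → Jet ι) (A : κ → κ → Jet ι) (ω : κ → Jet ι) :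
    tri (a • h + c • e) A ω = C a * tri h A ω + C c * tri e A ω := by
  simp only [tri, Finset.mul_sum, ← Finset.sum_add_distrib]
  refine Finset.sum_congr rfl fun i _ => Finset.sum_congr rfl fun j _ => ?_
  simp only [Pi.add_apply, Pi.smul_apply, smul_eq_C_mul]
  ring

lemma sum_lin (a c : ℝ) (h e k : κ → Jet ι) :
    ∑ i, (a • h + c • e) i * k i = C a * ∑ i, h i * k i + C c * ∑ i, e i * k i := by
  simp only [Finset.mul_sum, ← Finset.sum_add_distrib]
  refine Finset.sum_congr rfl fun i _ => ?_
  simp only [Pi.add_apply, Pi.smul_apply, smul_eq_C_mul]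
  ring

lemma pair_lin (a c : ℝ) (h e k : κ → Jet ι) :
    pair k (a • h + c • e) = C a * pair k h + C c * pair k e := by
  simp only [pair, mul_comm (k _)]
  exact sum_lin a c h e k

lemma isBlockHamiltonian_opH
    (hlead : ∀ k, ∃ ξ h, opH b ξ h ∧ ∀ i, ξ i - X (b i, 2 * (k + 1)) ∈ ordLT ι (2 * (k + 1))) :
    IsBlockHamiltonian b (opH b) where
  linear := opH_isLinear
  single_valued := opH_single_valued
  skew h k := by
    obtain ⟨A, H⟩ := opH.data h
    obtain ⟨B, H'⟩ := opH.data k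
    exact H.isTotal_skew H'
  jacobi hD₁ hD₂ hD₃ hv₁ hv₂ hv₃ L₁ L₂ L₃ := by
    obtain ⟨A₁, H₁⟩ := opH.data L₁
    obtain ⟨A₂, H₂⟩ := opH.data L₂
    obtain ⟨A₃, H₃⟩ := opH.data L₃
    exact isTotal_cyclic (H₁.isTotal_variation hD₃ hv₃ H₂) (H₂.isTotal_variation hD₁ hv₁ H₃)
      (H₃.isTotal_variation hD₂ hv₂ H₁) (H₁.isTotal_schouten H₂ H₃)
  leading := hlead

lemma isBlockHamiltonian_opJ_inv (hb : Function.Injective b)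
    (hlead : ∀ k, ∃ ξ h, (opJ b).inv ξ h ∧ ∀ i, ξ i - X (b i, 2 * (k + 1)) ∈ ordLT ι (2 * (k + 1))) :
    IsBlockHamiltonian b (opJ b).inv where
  linear := opJ_isLinear.inv
  single_valued h k := opJ_injective hb h k
  skew h k := by
    obtain ⟨p, J⟩ := opJ.data h
    obtain ⟨q, J'⟩ := opJ.data k
    exact J.isTotal_skew J'
  jacobi {ξ₁ h₁ ξ₂ h₂ ξ₃ h₃ δ₁ δ₂ δ₃} hD₁ hD₂ hD₃ hv₁ hv₂ hv₃ L₁ L₂ L₃ := by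
    obtain ⟨p₁, J₁⟩ := opJ.data L₁
    obtain ⟨p₂, J₂⟩ := opJ.data L₂
    obtain ⟨p₃, J₃⟩ := opJ.data L₃
    refine isTotal_cyclic
      (s₃ := p₁ * ∑ i, h₃ i * h₂ i - p₂ * ∑ i, h₃ i * h₁ i)
      (s₁ := p₂ * ∑ i, h₁ i * h₃ i - p₃ * ∑ i, h₁ i * h₂ i)
      (s₂ := p₃ * ∑ i, h₂ i * h₁ i - p₁ * ∑ i, h₂ i * h₃ i) ?_ ?_ ?_ ?_
    · convert J₁.isTotal_variation hD₃ hv₃ J₂ using 2; ring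
    · convert J₂.isTotal_variation hD₁ hv₁ J₃ using 2; ring
    · convert J₃.isTotal_variation hD₂ hv₂ J₁ using 2; ring
    -- The Schouten bracket of `J⁻¹` vanishes by cyclic cancellation, without any total derivative.
    · convert isTotal_zero using 1
      simp only [mul_comm (h₂ _) (h₁ _), mul_comm (h₃ _) (h₁ _), mul_comm (h₃ _) (h₂ _)]
      ring
  leading := hlead

lemma isBlockHamiltonian_lin (hb : Function.Injective b)
    (hlead : ∀ k, ∃ ξ h e, opH b ξ h ∧ (opJ b).inv ξ e ∧
      ∀ i, ξ i - X (b i, 2 * (k + 1)) ∈ ordLT ι (2 * (k + 1))) (a c : ℝ) :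
    IsBlockHamiltonian b (Op.lin a c (opH b) (opJ b).inv) where
  linear := opH_isLinear.lin opJ_isLinear.inv a c
  single_valued := by
    rintro ξ h k ⟨h₁, e₁, H₁, J₁, rfl⟩ ⟨h₂, e₂, H₂, J₂, rfl⟩
    rw [opH_single_valued H₁ H₂, opJ_injective hb J₁ J₂]
  skew := by
    rintro ξ h η k ⟨h₁, e₁, H₁, J₁, rfl⟩ ⟨h₂, e₂, H₂, J₂, rfl⟩
    obtain ⟨A₁, H₁⟩ := opH.data H₁
    obtain ⟨p₁, J₁⟩ := opJ.data J₁
    obtain ⟨A₂, H₂⟩ := opH.data H₂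
    obtain ⟨p₂, J₂⟩ := opJ.data J₂
    rw [pair_lin, pair_lin]
    convert ((H₁.isTotal_skew H₂).C_mul a).add ((J₁.isTotal_skew J₂).C_mul c) using 1
    ring
  jacobi {ξ₁ k₁ ξ₂ k₂ ξ₃ k₃ δ₁ δ₂ δ₃} hD₁ hD₂ hD₃ hv₁ hv₂ hv₃ L₁ L₂ L₃ := by
    obtain ⟨h₁, e₁, H₁, J₁, rfl⟩ := L₁
    obtain ⟨h₂, e₂, H₂, J₂, rfl⟩ := L₂
    obtain ⟨h₃, e₃, H₃, J₃, rfl⟩ := L₃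
    obtain ⟨A₁, H₁⟩ := opH.data H₁
    obtain ⟨p₁, J₁⟩ := opJ.data J₁
    obtain ⟨A₂, H₂⟩ := opH.data H₂
    obtain ⟨p₂, J₂⟩ := opJ.data J₂
    obtain ⟨A₃, H₃⟩ := opH.data H₃
    obtain ⟨p₃, J₃⟩ := opJ.data J₃
    have hvar : ∀ {k : κ → Jet ι} {δ : Derivation ℝ (Jet ι) (Jet ι)}
        (_ : ∀ f, δ (D f) = D (δ f)) (_ : ∀ i, δ (u (b i)) = k i)
        {ξ h e ξ' h' e' : κ → Jet ι} {A A' : κ → κ → Jet ι} {p p' : Jet ι}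
        (_ : HData (fun i => u (b i)) ξ h A) (_ : HData (fun i => u (b i)) ξ' h' A')
        (_ : JData (fun i => u (b i)) e ξ p) (_ : JData (fun i => u (b i)) e' ξ' p'),
        IsTotal (∑ i, ξ' i * δ ((a • h + c • e) i) + ∑ i, (a • h' + c • e') i * δ (ξ i) -
          (C a * (tri k A ξ' - tri k A' ξ) +
            C c * (p * ∑ i, k i * e' i - p' * ∑ i, k i * e i))) := by
      intro k δ hδ hk ξ h e ξ' h' e' A A' p p' H H' J J'
      convert ((H.isTotal_variation hδ hk H').C_mul a).add
        ((J.isTotal_variation hδ hk J').C_mul c) using 1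
      rw [sum_lin]
      simp only [mul_comm (ξ' _), Pi.add_apply, Pi.smul_apply, map_add, Derivation.map_smul]
      rw [show (∑ i, (a • δ (h i) + c • δ (e i)) * ξ' i) =
        C a * ∑ i, δ (h i) * ξ' i + C c * ∑ i, δ (e i) * ξ' i from
          sum_lin a c (fun i => δ (h i)) (fun i => δ (e i)) ξ']
      ring
    refine isTotal_cyclic (hvar hD₃ hv₃ H₁ H₂ J₁ J₂) (hvar hD₁ hv₁ H₂ H₃ J₂ J₃)
      (hvar hD₂ hv₂ H₃ H₁ J₃ J₁) ?_
    -- The bracket is quadratic in the operator: `a²` multiplies the bracket of `H`, `a c` the mixed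
    -- one, and the `c²` part cancels identically.
    convert ((H₁.isTotal_schouten H₂ H₃).C_mul (a * a)).add
      ((isTotal_mixed_schouten H₁ H₂ H₃ J₁ J₂ J₃).C_mul (a * c)) using 1
    simp only [tri_lin, sum_lin, C_mul]
    rw [Finset.sum_congr rfl fun i _ => mul_comm (e₂ i) (e₁ i),
      Finset.sum_congr rfl fun i _ => mul_comm (e₃ i) (e₁ i),
      Finset.sum_congr rfl fun i _ => mul_comm (e₃ i) (e₂ i)]
    ring
  leading k := by
    obtain ⟨ξ, h, e, H, J, hξ⟩ := hlead k
    exact ⟨ξ, _, ⟨h, e, H, J, rfl⟩, hξ⟩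

/-- Write `h = H ω`, `η = J h`, `g = H η`. Moving `H` and `J` across the pairing expresses the
bracket of `H J H` at the `ω`'s through brackets of `H` at triples containing two `η`'s and one `ω`,
minus the mixed bracket of `H` and `J⁻¹` at the `η`'s. Both are already known to vanish. -/
lemma isBlockHamiltonian_HJH
    (hlead : ∀ k, ∃ ξ h, (((opH b).comp (opJ b)).comp (opH b)) ξ h ∧
      ∀ i, ξ i - X (b i, 2 * (k + 1)) ∈ ordLT ι (2 * (k + 1))) :
    IsBlockHamiltonian b (((opH b).comp (opJ b)).comp (opH b)) where
  linear := (opH_isLinear.comp opJ_isLinear).comp opH_isLinear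
  single_valued := by
    rintro ξ h k ⟨ζ, h1, η, h2, h3⟩ ⟨ζ', h1', η', h2', h3'⟩
    obtain rfl := opH_single_valued h1 h1'
    obtain rfl := opJ_single_valued h2 h2'
    exact opH_single_valued h3 h3'
  skew := by
    rintro ω₁ g₁ ω₂ g₂ ⟨h₁, H₁, η₁, J₁, G₁⟩ ⟨h₂, H₂, η₂, J₂, G₂⟩
    obtain ⟨A₁, H₁⟩ := opH.data H₁
    obtain ⟨p₁, J₁⟩ := opJ.data J₁
    obtain ⟨B₁, G₁⟩ := opH.data G₁
    obtain ⟨A₂, H₂⟩ := opH.data H₂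
    obtain ⟨p₂, J₂⟩ := opJ.data J₂
    obtain ⟨B₂, G₂⟩ := opH.data G₂
    -- `ω₁ · g₂` is moved to `-h₁ · η₂` and `ω₂ · g₁` to `-h₂ · η₁`, and these two cancel by
    -- skewness of `J`.
    convert ((H₁.isTotal_skew G₂).add (H₂.isTotal_skew G₁)).sub (J₁.isTotal_skew J₂) using 1
    ring
  jacobi {ω₁ g₁ ω₂ g₂ ω₃ g₃ δ₁ δ₂ δ₃} hD₁ hD₂ hD₃ hv₁ hv₂ hv₃ L₁ L₂ L₃ := by
    obtain ⟨h₁, H₁, η₁, J₁, G₁⟩ := L₁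
    obtain ⟨h₂, H₂, η₂, J₂, G₂⟩ := L₂
    obtain ⟨h₃, H₃, η₃, J₃, G₃⟩ := L₃
    obtain ⟨A₁, H₁⟩ := opH.data H₁
    obtain ⟨p₁, J₁⟩ := opJ.data J₁
    obtain ⟨B₁, G₁⟩ := opH.data G₁
    obtain ⟨A₂, H₂⟩ := opH.data H₂
    obtain ⟨p₂, J₂⟩ := opJ.data J₂
    obtain ⟨B₂, G₂⟩ := opH.data G₂
    obtain ⟨A₃, H₃⟩ := opH.data H₃
    obtain ⟨p₃, J₃⟩ := opJ.data J₃
    obtain ⟨B₃, G₃⟩ := opH.data G₃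
    have hvar : ∀ {k : κ → Jet ι} {δ : Derivation ℝ (Jet ι) (Jet ι)}
        (_ : ∀ f, δ (D f) = D (δ f)) (_ : ∀ i, δ (u (b i)) = k i)
        {ω h η g ω' h' η' g' : κ → Jet ι} {A B A' B' : κ → κ → Jet ι} {p p' : Jet ι}
        (_ : HData (fun i => u (b i)) ω h A) (_ : JData (fun i => u (b i)) h η p)
        (_ : HData (fun i => u (b i)) η g B)
        (_ : HData (fun i => u (b i)) ω' h' A') (_ : JData (fun i => u (b i)) h' η' p')
        (_ : HData (fun i => u (b i)) η' g' B'),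
        IsTotal (∑ i, ω' i * δ (g i) + ∑ i, g' i * δ (ω i) -
          ((tri k B ω' - tri k A' η) + (tri k A η' - tri k B' ω) -
            (p * ∑ i, k i * h' i - p' * ∑ i, k i * h i))) := by
      intro k δ hδ hk ω h η g ω' h' η' g' A B A' B' p p' H J G H' J' G'
      convert ((G.isTotal_variation hδ hk H').add (H.isTotal_variation hδ hk G')).sub
        (J.isTotal_variation hδ hk J') using 1
      ring
    refine isTotal_cyclic (hvar hD₃ hv₃ H₁ J₁ G₁ H₂ J₂ G₂) (hvar hD₁ hv₁ H₂ J₂ G₂ H₃ J₃ G₃)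
      (hvar hD₂ hv₂ H₃ J₃ G₃ H₁ J₁ G₁) ?_
    convert (((G₁.isTotal_schouten H₂ G₃).add (G₂.isTotal_schouten H₃ G₁)).add
      (G₃.isTotal_schouten H₁ G₂)).sub (isTotal_mixed_schouten G₁ G₂ G₃ J₁ J₂ J₃) using 1
    ring
  leading := hlead

end Block

/-! ### Operators on pairs of blocks -/

section Pairs

variable {N M : ℕ}

lemma pair_sum (ξ h : Ix N M → Jet (Ix N M)) :
    pair ξ h = pair (ξ ∘ Sum.inl) (h ∘ Sum.inl) + pair (ξ ∘ Sum.inr) (h ∘ Sum.inr) :=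
  Fintype.sum_sum_type _

/-- A nonzero differential operator does not vanish on a covector field with independent leading
terms of high order. -/
lemma exists_large {ι : Type} {c : ι × ℕ →₀ Jet ι} (hc : c ≠ 0) :
    ∃ K, ∀ k ≥ K, ∀ ξ : ι → Jet ι, (∀ i, ξ i - X (i, k) ∈ ordLT ι k) →
      (c.sum fun p a => a * (D : Jet ι → Jet ι)^[p.2] (ξ p.1)) ≠ 0 := by
  classical
  have hne : c.support.Nonempty := Finsupp.support_nonempty_iff.2 hc
  obtain ⟨q, hq, hmax⟩ := c.support.exists_max_image Prod.snd hne
  choose m hm using fun p => exists_mem_ordLT (c p)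
  -- Above this order no coefficient depends on the variable `(q.1, k + q.2)`. As `q` has maximal
  -- order of differentiation, that variable enters the sum only through the leading term at `q`,
  -- with coefficient `c q`.
  refine ⟨c.support.sup m, fun k hk ξ hξ h0 => ?_⟩
  have h1 := congrArg (pderiv (q.1, k + q.2)) h0
  rw [Finsupp.sum, map_sum, map_zero, Finset.sum_eq_single q] at h1
  · refine Finsupp.mem_support_iff.1 hq ?_
    have hcq : pderiv (q.1, k + q.2) (c q) = 0 :=
      mem_ordLT.1 (hm q) _ _ (((Finset.le_sup hq).trans hk).trans (Nat.le_add_right _ _))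
    have hξq := mem_ordLT.1 (iterate_D_mem_ordLT (hξ q.1) q.2) q.1 (k + q.2) le_rfl
    have hs : (D : Jet ι → Jet ι)^[q.2] (ξ q.1) =
        (D : Jet ι → Jet ι)^[q.2] (ξ q.1 - X (q.1, k)) + X (q.1, k + q.2) := by
      rw [← iterate_D_X, ← iterate_D_add, sub_add_cancel]
    rw [pderiv_mul, hcq, zero_mul, zero_add, hs, map_add, hξq, pderiv_X_self, zero_add,
      mul_one] at h1
    exact h1
  · intro p hp hpq
    have hcp : pderiv (q.1, k + q.2) (c p) = 0 :=
      mem_ordLT.1 (hm p) _ _ (((Finset.le_sup hp).trans hk).trans (Nat.le_add_right _ _))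
    have hle : p.2 ≤ q.2 := hmax p hp
    have hξp := mem_ordLT.1 (iterate_D_mem_ordLT (hξ p.1) p.2) q.1 (k + q.2) (by omega)
    have hs : (D : Jet ι → Jet ι)^[p.2] (ξ p.1) =
        (D : Jet ι → Jet ι)^[p.2] (ξ p.1 - X (p.1, k)) + X (p.1, k + p.2) := by
      rw [← iterate_D_X, ← iterate_D_add, sub_add_cancel]
    have hX : pderiv (q.1, k + q.2) (X (p.1, k + p.2) : Jet ι) = 0 := by
      refine pderiv_X_of_ne fun h => hpq ?_
      simp only [Prod.mk.injEq, add_right_inj] at h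
      exact Prod.ext h.1 h.2
    rw [pderiv_mul, hcp, zero_mul, zero_add, hs, map_add, hξp, hX, zero_add, mul_zero]
  · exact fun h => absurd hq h

/-- A pair of Hamiltonian operators on the two blocks is a Hamiltonian operator. -/
lemma isHamiltonianOp_dOp {S : HOp N M} {T : VOp N M}
    (hS : IsBlockHamiltonian Sum.inl S) (hT : IsBlockHamiltonian Sum.inr T) :
    IsHamiltonianOp (dOp S T) where
  zero := ⟨hS.linear.zero, hT.linear.zero⟩
  add h k := ⟨hS.linear.add h.1 k.1, hT.linear.add h.2 k.2⟩
  smul c _ _ h := ⟨hS.linear.smul c h.1, hT.linear.smul c h.2⟩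
  single_valued {ξ h k} h1 h2 := by
    have e1 := hS.single_valued h1.1 h2.1
    have e2 := hT.single_valued h1.2 h2.2
    ext1 i
    rcases i with i | i
    · exact congrFun e1 i
    · exact congrFun e2 i
  skew h k := by
    rw [pair_sum, pair_sum]
    convert (hS.skew h.1 k.1).add (hT.skew h.2 k.2) using 1
    ring
  jacobi {ξ₁ h₁ ξ₂ h₂ ξ₃ h₃} L₁ L₂ L₃ := by
    have j1 := hS.jacobi (evo_D h₁) (evo_D h₂) (evo_D h₃) (fun i => evo_u h₁ _)
      (fun i => evo_u h₂ _) (fun i => evo_u h₃ _) L₁.1 L₂.1 L₃.1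
    have j2 := hT.jacobi (evo_D h₁) (evo_D h₂) (evo_D h₃) (fun i => evo_u h₁ _)
      (fun i => evo_u h₂ _) (fun i => evo_u h₃ _) L₁.2 L₂.2 L₃.2
    convert j1.add j2 using 1
    simp only [lieDer, pair, Fintype.sum_sum_type, Function.comp_apply]
    ring
  domain_large c hc := by
    obtain ⟨K, hK⟩ := exists_large hc
    obtain ⟨ξ, h, L, hξ⟩ := hS.leading K
    obtain ⟨ξ', h', L', hξ'⟩ := hT.leading K
    refine ⟨Sum.elim ξ ξ', Sum.elim h h', ⟨L, L'⟩, hK (2 * (K + 1)) (by omega) _ ?_⟩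
    rintro (i | i)
    · exact hξ i
    · exact hξ' i

lemma dOp_inv (S : HOp N M) (T : VOp N M) : (dOp S T).inv = dOp S.inv T.inv := rfl

lemma dOp_comp (S S' : HOp N M) (T T' : VOp N M) :
    (dOp S T).comp (dOp S' T') = dOp (S.comp S') (T.comp T') := by
  ext ξ h
  constructor
  · rintro ⟨η, h1, h2⟩
    exact ⟨⟨_, h1.1, h2.1⟩, ⟨_, h1.2, h2.2⟩⟩
  · rintro ⟨⟨η, h1, h2⟩, ⟨η', h1', h2'⟩⟩
    exact ⟨Sum.elim η η', ⟨h1, h1'⟩, ⟨h2, h2'⟩⟩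

lemma dOp_lin (a c : ℝ) (S S' : HOp N M) (T T' : VOp N M) :
    Op.lin a c (dOp S T) (dOp S' T') = dOp (Op.lin a c S S') (Op.lin a c T T') := by
  ext ξ h
  constructor
  · rintro ⟨k, l, h1, h2, rfl⟩
    exact ⟨⟨_, _, h1.1, h2.1, rfl⟩, ⟨_, _, h1.2, h2.2, rfl⟩⟩
  · rintro ⟨⟨k, l, h1, h2, hk⟩, ⟨k', l', h1', h2', hk'⟩⟩
    refine ⟨Sum.elim k k', Sum.elim l l', ⟨h1, h1'⟩, ⟨h2, h2'⟩, ?_⟩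
    ext1 i
    rcases i with i | i
    · exact congrFun hk i
    · exact congrFun hk' i

lemma Op.comp_assoc {κ ι : Type} (S T U : Op κ ι) : (S.comp T).comp U = S.comp (T.comp U) := by
  ext ξ h
  constructor
  · rintro ⟨η, h1, ζ, h2, h3⟩
    exact ⟨ζ, ⟨η, h1, h2⟩, h3⟩
  · rintro ⟨ζ, ⟨η, h1, h2⟩, h3⟩
    exact ⟨η, h1, ζ, h2, h3⟩

lemma isNAdaptedOp_dOp {S : HOp N M} {T : VOp N M} (hS : S 0 0) (hT : T 0 0)
    (hS' : ∀ {ξ h}, S ξ h → (∀ i, ξ i ∈ hFun N M) → ∀ i, h i ∈ hFun N M)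
    (hT' : ∀ {ξ h}, T ξ h → (∀ i, ξ i ∈ vFun N M) → ∀ i, h i ∈ vFun N M) :
    IsNAdaptedOp (dOp S T) where
  split ξ h := by
    constructor
    · exact fun ⟨h1, h2⟩ => ⟨⟨h1, hT⟩, ⟨hS, h2⟩⟩
    · exact fun ⟨h1, h2⟩ => ⟨h1.1, h2.2⟩
  adapted h hξ := ⟨hS' h.1 hξ.1, hT' h.2 hξ.2⟩

end Pairs

/-! ### Operators and supports -/

section Support

variable {κ ι : Type} [Fintype κ] {b : κ → ι} {s : Set ι}

lemma opH.mem_supported (hb : ∀ i, b i ∈ s) {ω h : κ → Jet ι} (H : opH b ω h)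
    (hω : ∀ i, ω i ∈ supported ℝ {q : ι × ℕ | q.1 ∈ s}) (i : κ) :
    h i ∈ supported ℝ {q : ι × ℕ | q.1 ∈ s} := by
  have hu : ∀ i, u (b i) ∈ supported ℝ {q : ι × ℕ | q.1 ∈ s} := fun i => X_mem_supported.2 (hb i)
  obtain ⟨A, hA, hh⟩ := H
  rw [hh]
  refine add_mem (D_mem_supported (hω i)) (sum_mem fun j _ => mul_mem (hu j) ?_)
  refine antideriv_mem_supported ?_
  rw [(hA j i).1]
  exact sub_mem (mul_mem (hu j) (hω i)) (mul_mem (hω j) (hu i))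

lemma opJ.mem_supported (hb : ∀ i, b i ∈ s) {e ω : κ → Jet ι} (H : opJ b e ω)
    (he : ∀ i, e i ∈ supported ℝ {q : ι × ℕ | q.1 ∈ s}) (i : κ) :
    ω i ∈ supported ℝ {q : ι × ℕ | q.1 ∈ s} := by
  have hu : ∀ i, u (b i) ∈ supported ℝ {q : ι × ℕ | q.1 ∈ s} := fun i => X_mem_supported.2 (hb i)
  obtain ⟨p, hp, hh⟩ := H
  rw [hh]
  refine add_mem (D_mem_supported (he i)) (mul_mem (antideriv_mem_supported ?_) (hu i))
  rw [hp.1]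
  exact sum_mem fun j _ => mul_mem (hu j) (he j)

end Support

/-! ### N-adaptedness of the two d-operators -/

section Adapted

variable (N M : ℕ)

lemma isNAdaptedOp_dH : IsNAdaptedOp (dH N M) :=
  isNAdaptedOp_dOp opH_isLinear.zero opH_isLinear.zero
    (fun h hξ i => opH.mem_supported (s := {j : Ix N M | j.isLeft}) (fun _ => rfl) h hξ i)
    (fun h hξ i => opH.mem_supported (s := {j : Ix N M | j.isRight}) (fun _ => rfl) h hξ i)

lemma isNAdaptedOp_dJ : IsNAdaptedOp (dJ N M) :=
  isNAdaptedOp_dOp opJ_isLinear.zero opJ_isLinear.zero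
    (fun h hξ i => opJ.mem_supported (s := {j : Ix N M | j.isLeft}) (fun _ => rfl) h hξ i)
    (fun h hξ i => opJ.mem_supported (s := {j : Ix N M | j.isRight}) (fun _ => rfl) h hξ i)

end Adapted

/-! ### Skew matrices of rank two for a diagonal metric -/

section RankTwo

open Matrix

variable {n R : Type} [Fintype n] [CommRing R] [Algebra ℝ R]

/-- Matrices in the orthogonal Lie algebra of the diagonal metric `g`. -/
def IsSkewFor (g : n → R) (Y : Matrix n n R) : Prop := ∀ a b, g a * Y a b = -(g b * Y b a)

/-- Skew matrices of rank two with normalized length. -/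
structure IsSimpleBivector (g : n → R) (M : Matrix n n R) : Prop where
  metric : ∀ a, g a * g a = 1
  skew : IsSkewFor g M
  plucker : ∀ a b c d, g a * M a b * (g c * M c d) - g a * M a c * (g b * M b d) +
    g a * M a d * (g b * M b c) = 0
  norm : trace (M * M) = 2

/-- Tangent vectors to the orbit of `M`. -/
structure IsTangentTo (g : n → R) (M E : Matrix n n R) : Prop where
  skew : IsSkewFor g E
  sandwich : M * E * M = 0
  sq : M * M * E + E * (M * M) = E

variable {g : n → R} {M E F B : Matrix n n R}

omit [Fintype n] in
lemma two_smul_cancel {Y Z : Matrix n n R} (h : (2 : R) • Y = (2 : R) • Z) : Y = Z := by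
  ext a b
  have h1 := congrArg (fun W : Matrix n n R => algebraMap ℝ R (1 / 2) * W a b) h
  simpa only [Matrix.smul_apply, smul_eq_mul, ← mul_assoc, half_mul_two, one_mul] using h1

omit [Fintype n] [Algebra ℝ R] in
lemma IsSkewFor.swap (hg : ∀ a, g a * g a = 1) (hB : IsSkewFor g B) (a b : n) :
    B a b = -(g a * g b * B b a) := by
  linear_combination g a * hB a b - B a b * hg a

/-- Contraction of the Plücker relation with `B`: for a decomposable bivector, `M B M` can only be a
multiple of `M`. Taking `B = M` and the normalization gives `M³ = M`. -/
lemma IsSimpleBivector.two_smul_sandwich (h : IsSimpleBivector g M) (hB : IsSkewFor g B) :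
    (2 : R) • (M * B * M) = trace (M * B) • M := by
  ext a d
  have key : ∑ c, ∑ b, 2 * (M a b * B b c * M c d) = ∑ c, ∑ b, M c b * B b c * M a d := by
    refine sum_sum_eq_of_symm fun c b => ?_
    rw [hB.swap h.metric c b, h.skew.swap h.metric c b]
    linear_combination 2 * B b c * g a * g c * h.plucker a b c d -
      2 * B b c * (M a b * M c d - g b * g c * M a c * M b d + g b * g c * M a d * M b c) *
        (h.metric a) - 2 * B b c * M a b * M c d * g a * g a * h.metric c
  simp only [Matrix.smul_apply, smul_eq_mul, mul_apply, trace, diag_apply, Finset.sum_mul,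
    Finset.mul_sum]
  exact key

lemma IsSimpleBivector.cube (h : IsSimpleBivector g M) : M * M * M = M :=
  two_smul_cancel (by rw [h.two_smul_sandwich h.skew, h.norm])

omit [Algebra ℝ R] in
lemma IsSkewFor.commutator (hB : IsSkewFor g B) (hM : IsSkewFor g M) :
    IsSkewFor g (B * M - M * B) := by
  intro a d
  simp only [Matrix.sub_apply, mul_apply, mul_sub, Finset.mul_sum, neg_sub]
  congr 1
  · refine Finset.sum_congr rfl fun c _ => ?_
    linear_combination M c d * hB a c - B c a * hM c d
  · refine Finset.sum_congr rfl fun c _ => ?_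
    linear_combination B c d * hM a c - M c a * hB c d

/-- `M B M` is up to a factor a scalar multiple of `M`, hence commutes with `M`; what remains
follows from `M³ = M`. -/
lemma IsSimpleBivector.isTangentTo_commutator (h : IsSimpleBivector g M) (hB : IsSkewFor g B) :
    IsTangentTo g M (B * M - M * B) where
  skew := hB.commutator h.skew
  sandwich := by
    have h1 := h.two_smul_sandwich hB
    refine two_smul_cancel ?_
    have h2 : (2 : R) • (M * (B * M - M * B) * M) =
        ((2 : R) • (M * B * M)) * M - M * ((2 : R) • (M * B * M)) := by
      rw [Matrix.smul_mul, Matrix.mul_smul, ← smul_sub]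
      congr 1
      noncomm_ring
    rw [h2, h1, Matrix.smul_mul, Matrix.mul_smul, sub_self, smul_zero]
  sq := by
    have h1 := h.two_smul_sandwich hB
    have h3 := h.cube
    refine two_smul_cancel ?_
    have h2 : (2 : R) • (M * M * (B * M - M * B) + (B * M - M * B) * (M * M)) =
        (2 : R) • (B * (M * M * M) - (M * M * M) * B) +
        (M * ((2 : R) • (M * B * M)) - ((2 : R) • (M * B * M)) * M) := by
      rw [Matrix.smul_mul, Matrix.mul_smul, ← smul_sub, ← smul_add]
      congr 1
      noncomm_ring
    rw [h2, h1, Matrix.smul_mul, Matrix.mul_smul, sub_self, add_zero, h3]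

lemma map_der_mul (δ : Derivation ℝ R R) (Y Z : Matrix n n R) :
    (Y * Z).map δ = Y.map δ * Z + Y * Z.map δ := by
  ext a b
  simp only [map_apply, Matrix.add_apply, mul_apply, map_sum, ← Finset.sum_add_distrib,
    Derivation.leibniz, smul_eq_mul]
  exact Finset.sum_congr rfl fun c _ => by ring

omit [Fintype n] in
lemma map_der_add (δ : Derivation ℝ R R) (Y Z : Matrix n n R) :
    (Y + Z).map δ = Y.map δ + Z.map δ := by
  ext a b; simp

omit [Fintype n] in
lemma map_der_sub (δ : Derivation ℝ R R) (Y Z : Matrix n n R) :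
    (Y - Z).map δ = Y.map δ - Z.map δ := by
  ext a b; simp

omit [Fintype n] in
lemma map_der_smul (δ : Derivation ℝ R R) {r : R} (hr : δ r = 0) (Y : Matrix n n R) :
    (r • Y).map δ = r • Y.map δ := by
  ext a b; simp [hr]

lemma der_trace (δ : Derivation ℝ R R) (Y : Matrix n n R) :
    δ (trace Y) = trace (Y.map δ) := by
  simp [trace]

omit [Fintype n] in
lemma IsSkewFor.map_der {δ : Derivation ℝ R R} (hδ : ∀ a, δ (g a) = 0) (hB : IsSkewFor g B) :
    IsSkewFor g (B.map δ) := by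
  intro a b
  have := congrArg δ (hB a b)
  simpa [Derivation.leibniz, hδ] using this

/-- Differentiating the norm gives `tr (M δM) = 0`, hence `M δM M = 0`; differentiating `M³ = M`
then gives the last condition. -/
lemma IsSimpleBivector.isTangentTo_map_der (h : IsSimpleBivector g M) {δ : Derivation ℝ R R}
    (hδ : ∀ a, δ (g a) = 0) : IsTangentTo g M (M.map δ) := by
  have hsk := h.skew.map_der hδ
  have htr : trace (M * M.map δ) = 0 := by
    have h1 := congrArg δ h.norm
    rw [der_trace, map_der_mul, trace_add, trace_mul_comm (M.map δ), ← map_ofNat (algebraMap ℝ R) 2,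
      Derivation.map_algebraMap] at h1
    have h2 := congrArg (fun r => algebraMap ℝ R (1 / 2) * r) h1
    simpa only [← two_mul, ← mul_assoc, half_mul_two, one_mul, mul_zero] using h2
  have hs : M * M.map δ * M = 0 :=
    two_smul_cancel (by rw [h.two_smul_sandwich hsk, htr, zero_smul, smul_zero])
  refine ⟨hsk, hs, ?_⟩
  have h1 := congrArg (fun Y => Y.map δ) h.cube
  simp only [map_der_mul, add_mul] at h1
  rw [hs, add_zero] at h1
  rw [add_comm, ← Matrix.mul_assoc (M.map δ)]
  exact h1

omit [Algebra ℝ R] in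
lemma IsTangentTo.add (hE : IsTangentTo g M E) (hF : IsTangentTo g M F) :
    IsTangentTo g M (E + F) where
  skew a b := by
    simp only [Matrix.add_apply]
    linear_combination hE.skew a b + hF.skew a b
  sandwich := by rw [Matrix.mul_add, Matrix.add_mul, hE.sandwich, hF.sandwich, add_zero]
  sq := by
    rw [Matrix.mul_add, Matrix.add_mul, add_add_add_comm, hE.sq, hF.sq]

omit [Algebra ℝ R] in
lemma IsTangentTo.smul (r : R) (hE : IsTangentTo g M E) : IsTangentTo g M (r • E) where
  skew a b := by
    simp only [Matrix.smul_apply, smul_eq_mul]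
    linear_combination r * hE.skew a b
  sandwich := by rw [Matrix.mul_smul, Matrix.smul_mul, hE.sandwich, smul_zero]
  sq := by rw [Matrix.mul_smul, Matrix.smul_mul, ← smul_add, hE.sq]

omit [Algebra ℝ R] in
lemma IsTangentTo.sub (hE : IsTangentTo g M E) (hF : IsTangentTo g M F) :
    IsTangentTo g M (E - F) := by
  have := hE.add (hF.smul (-1))
  rwa [neg_smul, one_smul, ← sub_eq_add_neg] at this

/-- The trace identity: the variation of one component of `M` is, up to a total derivative, given
by another component. -/
lemma trace_identity {P Q L S W : Matrix n n R} (δ : Derivation ℝ R R)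
    (hP : IsTangentTo g M P) (hQ : IsTangentTo g M Q)
    (hM : M.map δ = L * M - M * L)
    (hδP : P.map δ = (L * P - P * L) - (S * M - M * S))
    (hδQ : Q.map δ = (L * Q - Q * L) + (W * M - M * W)) :
    δ (trace (M * (P * Q - Q * P))) = trace (S * Q) + trace (W * P) := by
  -- The left side is the derivative of the invariant symplectic form of the orbit. The terms in `L`
  -- form a commutator, of trace zero. In the others, the products containing `M P M` or `M Q M`
  -- drop out, and `M² E + E M² = E` reassembles the rest into `tr (S Q) + tr (W P)`.
  have h1 : M.map δ * (P * Q - Q * P) + M * ((P.map δ * Q + P * Q.map δ) -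
      (Q.map δ * P + Q * P.map δ)) =
      (L * (M * (P * Q - Q * P)) - M * (P * Q - Q * P) * L) +
      ((M * M * (S * Q) - M * (S * M * Q)) + (M * (Q * S) * M - M * (Q * (M * S)))) +
      ((M * (P * W) * M - M * (P * (M * W))) + (M * M * (W * P) - M * (W * M * P))) := by
    rw [hM, hδP, hδQ]
    noncomm_ring
  have t1 : trace (M * (S * M * Q)) = 0 := by
    rw [show M * (S * M * Q) = M * S * (M * Q) by noncomm_ring, trace_mul_comm,
      show M * Q * (M * S) = M * Q * M * S by noncomm_ring, hQ.sandwich, Matrix.zero_mul,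
      trace_zero]
  have t2 : trace (M * (Q * (M * S))) = 0 := by
    rw [show M * (Q * (M * S)) = M * Q * M * S by noncomm_ring, hQ.sandwich, Matrix.zero_mul,
      trace_zero]
  have t3 : trace (M * (P * (M * W))) = 0 := by
    rw [show M * (P * (M * W)) = M * P * M * W by noncomm_ring, hP.sandwich, Matrix.zero_mul,
      trace_zero]
  have t4 : trace (M * (W * M * P)) = 0 := by
    rw [show M * (W * M * P) = M * W * (M * P) by noncomm_ring, trace_mul_comm,
      show M * P * (M * W) = M * P * M * W by noncomm_ring, hP.sandwich, Matrix.zero_mul,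
      trace_zero]
  have t5 : trace (M * M * (S * Q)) + trace (M * (Q * S) * M) = trace (S * Q) := by
    conv_rhs => rw [← hQ.sq]
    rw [Matrix.mul_add, trace_add, trace_mul_comm (M * M),
      show S * Q * (M * M) = S * (Q * (M * M)) by noncomm_ring, add_comm,
      trace_mul_comm (M * (Q * S)), show M * (M * (Q * S)) = (M * M * Q) * S by noncomm_ring,
      trace_mul_comm (M * M * Q)]
  have t6 : trace (M * (P * W) * M) + trace (M * M * (W * P)) = trace (W * P) := by
    conv_rhs => rw [← hP.sq]
    rw [Matrix.mul_add, trace_add, trace_mul_comm (M * M),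
      show W * P * (M * M) = W * (P * (M * M)) by noncomm_ring,
      trace_mul_comm (M * (P * W)), show M * (M * (P * W)) = (M * M * P) * W by noncomm_ring,
      trace_mul_comm (M * M * P)]
  rw [der_trace, map_der_mul, map_der_sub, map_der_mul, map_der_mul, h1]
  simp only [trace_add, trace_sub, t1, t2, t3, t4]
  rw [trace_mul_comm L]
  linear_combination t5 + t6

end RankTwo

/-! ### Power series with differential polynomials as coefficients -/

section Series

variable {A : Type} [CommRing A] [Algebra ℝ A]

/-- The coefficientwise extension of a derivation to power series. -/
noncomputable def liftDer (δ : Derivation ℝ A A) :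
    Derivation ℝ (PowerSeries A) (PowerSeries A) :=
  Derivation.mk'
    { toFun := fun f => PowerSeries.mk fun n => δ (PowerSeries.coeff n f)
      map_add' := fun f g => by ext n; simp
      map_smul' := fun c f => by ext n; simp }
    fun f g => by
      ext n
      simp only [LinearMap.coe_mk, AddHom.coe_mk, PowerSeries.coeff_mk, map_add, smul_eq_mul,
        PowerSeries.coeff_mul, map_sum, Derivation.leibniz, Finset.sum_add_distrib]
      congr 1
      rw [← Finset.Nat.sum_antidiagonal_swap]
      rfl

lemma coeff_liftDer (δ : Derivation ℝ A A) (f : PowerSeries A) (n : ℕ) :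
    PowerSeries.coeff n (liftDer δ f) = δ (PowerSeries.coeff n f) := by
  change PowerSeries.coeff n (PowerSeries.mk fun n => δ (PowerSeries.coeff n f)) = _
  rw [PowerSeries.coeff_mk]

lemma liftDer_C (δ : Derivation ℝ A A) (a : A) :
    liftDer δ (PowerSeries.C a) = PowerSeries.C (δ a) := by
  ext n
  rw [coeff_liftDer, PowerSeries.coeff_C, PowerSeries.coeff_C]
  split <;> simp

lemma liftDer_X (δ : Derivation ℝ A A) : liftDer δ (PowerSeries.X : PowerSeries A) = 0 := by
  ext n
  rw [coeff_liftDer, PowerSeries.coeff_X]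
  split <;> simp

lemma liftDer_X_mul (δ : Derivation ℝ A A) (f : PowerSeries A) :
    liftDer δ (PowerSeries.X * f) = PowerSeries.X * liftDer δ f := by
  rw [Derivation.leibniz, liftDer_X, smul_zero, add_zero, smul_eq_mul]

lemma X_pow_dvd_liftDer (δ : Derivation ℝ A A) {f : PowerSeries A} {n : ℕ}
    (h : PowerSeries.X ^ n ∣ f) : PowerSeries.X ^ n ∣ liftDer δ f := by
  rw [PowerSeries.X_pow_dvd_iff] at *
  intro m hm
  rw [coeff_liftDer, h m hm, map_zero]

/-- The Euler derivation of power series. -/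
noncomputable def euler (A : Type) [CommRing A] [Algebra ℝ A] :
    Derivation ℝ (PowerSeries A) (PowerSeries A) :=
  (PowerSeries.X : PowerSeries A) • (PowerSeries.derivative A).restrictScalars ℝ

lemma euler_apply (f : PowerSeries A) :
    euler A f = PowerSeries.X * PowerSeries.derivative A f := rfl

lemma coeff_euler (f : PowerSeries A) (n : ℕ) :
    PowerSeries.coeff n (euler A f) = n * PowerSeries.coeff n f := by
  rw [euler_apply]
  cases n with
  | zero => simp
  | succ n =>
    rw [PowerSeries.coeff_succ_X_mul, PowerSeries.coeff_derivative]
    push_cast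
    ring

lemma euler_X_mul (f : PowerSeries A) :
    euler A (PowerSeries.X * f) = PowerSeries.X * f + PowerSeries.X * euler A f := by
  rw [Derivation.leibniz]
  have : euler A PowerSeries.X = PowerSeries.X := by
    rw [euler_apply]; simp
  rw [this, smul_eq_mul, smul_eq_mul]
  ring

lemma euler_liftDer (δ : Derivation ℝ A A) (f : PowerSeries A) :
    euler A (liftDer δ f) = liftDer δ (euler A f) := by
  ext n
  rw [coeff_euler, coeff_liftDer, coeff_liftDer, coeff_euler, ← nsmul_eq_mul, ← nsmul_eq_mul,
    map_nsmul]

lemma liftDer_comm {δ ε : Derivation ℝ A A} (h : ∀ f, δ (ε f) = ε (δ f)) (f : PowerSeries A) :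
    liftDer δ (liftDer ε f) = liftDer ε (liftDer δ f) := by
  ext n
  simp only [coeff_liftDer, h]

omit [Algebra ℝ A] in
lemma eq_of_forall_X_pow_dvd {f g : PowerSeries A} (h : ∀ n, PowerSeries.X ^ n ∣ f - g) :
    f = g := by
  ext n
  have := PowerSeries.X_pow_dvd_iff.1 (h (n + 1)) n (Nat.lt_succ_self n)
  rwa [map_sub, sub_eq_zero] at this

omit [Algebra ℝ A] in
/-- Contractions for the `X`-adic topology have fixed points. -/
lemma exists_fixed_point {τ : Type} (Φ : (τ → PowerSeries A) → τ → PowerSeries A)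
    (hΦ : ∀ n F G, (∀ t, PowerSeries.X ^ n ∣ F t - G t) →
      ∀ t, PowerSeries.X ^ (n + 1) ∣ Φ F t - Φ G t) : ∃ F, Φ F = F := by
  let s : ℕ → τ → PowerSeries A := fun n => Φ^[n] 0
  have hs : ∀ n, s (n + 1) = Φ (s n) := fun n => Function.iterate_succ_apply' _ _ _
  have h1 : ∀ n t, PowerSeries.X ^ n ∣ s (n + 1) t - s n t := by
    intro n
    induction n with
    | zero => intro t; rw [pow_zero]; exact one_dvd _
    | succ n ih =>
      have := hΦ n _ _ ih
      rwa [← hs, ← hs] at this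
  have h2 : ∀ n k t, PowerSeries.X ^ n ∣ s (n + k) t - s n t := by
    intro n k t
    induction k with
    | zero => simp
    | succ k ih =>
      have := (dvd_trans (pow_dvd_pow _ (Nat.le_add_right n k)) (h1 (n + k) t)).add ih
      rwa [sub_add_sub_cancel] at this
  -- The coefficient of `X ^ n` is stable from the iterate `n + 1` on.
  let F : τ → PowerSeries A := fun t => PowerSeries.mk fun n => PowerSeries.coeff n (s (n + 1) t)
  have h3 : ∀ n t, PowerSeries.X ^ n ∣ F t - s n t := by
    intro n t
    rw [PowerSeries.X_pow_dvd_iff]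
    intro m hm
    rw [map_sub, PowerSeries.coeff_mk]
    obtain ⟨k, rfl⟩ : ∃ k, n = m + 1 + k := ⟨n - (m + 1), by omega⟩
    have := PowerSeries.X_pow_dvd_iff.1 (h2 (m + 1) k t) m (Nat.lt_succ_self m)
    rw [map_sub] at this
    linear_combination -this
  refine ⟨F, funext fun t => eq_of_forall_X_pow_dvd fun n => ?_⟩
  have h4 := (hΦ n _ _ (h3 n) t).sub (h3 (n + 1) t)
  rw [hs, sub_sub_sub_cancel_right] at h4
  exact dvd_trans (pow_dvd_pow _ (Nat.le_succ n)) h4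

lemma dvd_mul_sub_mul {R : Type} [CommRing R] {d a a' b b' : R} (ha : d ∣ a - a')
    (hb : d ∣ b - b') : d ∣ a * b - a' * b' := by
  rw [show a * b - a' * b' = a * (b - b') + (a - a') * b' by ring]
  exact (hb.mul_left a).add (ha.mul_right b')

lemma dvd_sum_sub_sum {R α : Type} [CommRing R] [Fintype α] {d : R} {f g : α → R}
    (h : ∀ i, d ∣ f i - g i) : d ∣ ∑ i, f i - ∑ i, g i := by
  rw [← Finset.sum_sub_distrib]
  exact Finset.dvd_sum fun i _ => h i

end Series

/-! ### The resolvent -/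

section Resolvent

variable {κ ι : Type} [Fintype κ]

/-- The components of a solution `M` of `M' = [λ a + U, M]` which is a normalized simple bivector,
as power series in `1/λ`. -/
structure IsResolvent (v : κ → Jet ι) (p : PowerSeries (Jet ι)) (x y : κ → PowerSeries (Jet ι))
    (A : κ → κ → PowerSeries (Jet ι)) : Prop where
  const : PowerSeries.constantCoeff p = 1
  dvd_x : ∀ i, PowerSeries.X ∣ x i
  dvd_y : ∀ i, PowerSeries.X ∣ y i
  dvd_A : ∀ i j, PowerSeries.X ∣ A i j
  x_eq : ∀ i, x i = PowerSeries.X * (liftDer D (y i) + ∑ k, PowerSeries.C (v k) * A k i)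
  y_eq : ∀ i, y i = PowerSeries.X * (liftDer D (x i) + p * PowerSeries.C (v i))
  plucker : ∀ i j, p * A i j = -(x i * y j - x j * y i)
  norm : 2 * (p * p) + 2 * ∑ i, x i * x i - 2 * ∑ i, y i * y i - ∑ i, ∑ j, A i j * A i j = 2

/-- The fixed point equation for the divided components of the resolvent. -/
noncomputable def resolventStep (v : κ → Jet ι)
    (F : Unit ⊕ κ ⊕ κ ⊕ (κ × κ) → PowerSeries (Jet ι)) :
    Unit ⊕ κ ⊕ κ ⊕ (κ × κ) → PowerSeries (Jet ι)
  | .inl _ => PowerSeries.X * (PowerSeries.C (C (1 / 2)) *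
      (∑ i, F (.inr (.inr (.inl i))) * F (.inr (.inr (.inl i))) -
        F (.inl ()) * F (.inl ()) - ∑ i, F (.inr (.inl i)) * F (.inr (.inl i)) +
        PowerSeries.C (C (1 / 2)) *
          ∑ i, ∑ j, F (.inr (.inr (.inr (i, j)))) * F (.inr (.inr (.inr (i, j))))))
  | .inr (.inl i) => PowerSeries.X * (liftDer D (F (.inr (.inr (.inl i)))) +
      ∑ k, PowerSeries.C (v k) * F (.inr (.inr (.inr (k, i)))))
  | .inr (.inr (.inl i)) => PowerSeries.X * (liftDer D (F (.inr (.inl i))) +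
      F (.inl ()) * PowerSeries.C (v i)) + PowerSeries.C (v i)
  | .inr (.inr (.inr q)) => PowerSeries.X * (F (.inr (.inl q.2)) * F (.inr (.inr (.inl q.1))) -
      F (.inr (.inl q.1)) * F (.inr (.inr (.inl q.2))) - F (.inl ()) * F (.inr (.inr (.inr q))))

lemma X_pow_dvd_X_mul_sub {f g : PowerSeries (Jet ι)} {n : ℕ} (h : PowerSeries.X ^ n ∣ f - g) :
    PowerSeries.X ^ (n + 1) ∣ PowerSeries.X * f - PowerSeries.X * g := by
  rw [← mul_sub, pow_succ']
  exact mul_dvd_mul_left _ h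

lemma dvd_add_sub_add {R : Type} [CommRing R] {d a a' b b' : R} (ha : d ∣ a - a')
    (hb : d ∣ b - b') : d ∣ a + b - (a' + b') := by
  rw [add_sub_add_comm]; exact ha.add hb

lemma dvd_sub_sub_sub {R : Type} [CommRing R] {d a a' b b' : R} (ha : d ∣ a - a')
    (hb : d ∣ b - b') : d ∣ a - b - (a' - b') := by
  rw [sub_sub_sub_comm]; exact ha.sub hb

lemma dvd_liftDer_sub {f g : PowerSeries (Jet ι)} {n : ℕ} (h : PowerSeries.X ^ n ∣ f - g) :
    PowerSeries.X ^ n ∣ liftDer D f - liftDer D g := by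
  rw [← map_sub]; exact X_pow_dvd_liftDer _ h

lemma resolventStep_contract (v : κ → Jet ι) (n : ℕ)
    (F G : Unit ⊕ κ ⊕ κ ⊕ (κ × κ) → PowerSeries (Jet ι))
    (h : ∀ t, PowerSeries.X ^ n ∣ F t - G t) (t : Unit ⊕ κ ⊕ κ ⊕ (κ × κ)) :
    PowerSeries.X ^ (n + 1) ∣ resolventStep v F t - resolventStep v G t := by
  have hc : ∀ c : PowerSeries (Jet ι), PowerSeries.X ^ n ∣ c - c := fun c => by simp
  rcases t with _ | i | i | q
  · refine X_pow_dvd_X_mul_sub (dvd_mul_sub_mul (hc _) (dvd_add_sub_add (dvd_sub_sub_sub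
      (dvd_sub_sub_sub ?_ ?_) ?_) (dvd_mul_sub_mul (hc _) ?_)))
    · exact dvd_sum_sub_sum fun i => dvd_mul_sub_mul (h _) (h _)
    · exact dvd_mul_sub_mul (h _) (h _)
    · exact dvd_sum_sub_sum fun i => dvd_mul_sub_mul (h _) (h _)
    · exact dvd_sum_sub_sum fun i => dvd_sum_sub_sum fun j => dvd_mul_sub_mul (h _) (h _)
  · exact X_pow_dvd_X_mul_sub (dvd_add_sub_add (dvd_liftDer_sub (h _))
      (dvd_sum_sub_sum fun k => dvd_mul_sub_mul (hc _) (h _)))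
  · rw [resolventStep, resolventStep, add_sub_add_right_eq_sub]
    exact X_pow_dvd_X_mul_sub (dvd_add_sub_add (dvd_liftDer_sub (h _))
      (dvd_mul_sub_mul (h _) (hc _)))
  · exact X_pow_dvd_X_mul_sub (dvd_sub_sub_sub (dvd_sub_sub_sub
      (dvd_mul_sub_mul (h _) (h _)) (dvd_mul_sub_mul (h _) (h _)))
      (dvd_mul_sub_mul (h _) (h _)))

/-- Put `p = 1 + X P` and divide `x`, `y`, `A` by `X`. The normalization is then solved for `P`
after division by `4 X`, and the Plücker relation for `A`. Every unknown equals `X` times an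
expression in the unknowns, plus a fixed term, so the system is a contraction. The nonlocal `p` and
`A` are obtained algebraically instead of by integration. -/
theorem exists_resolvent (v : κ → Jet ι) : ∃ p x y A, IsResolvent v p x y A := by
  obtain ⟨F, hF⟩ := exists_fixed_point (resolventStep v) (resolventStep_contract v)
  have hp := congrFun hF (.inl ())
  have hx := fun i => congrFun hF (.inr (.inl i))
  have hy := fun i => congrFun hF (.inr (.inr (.inl i)))
  have hA := fun i j => congrFun hF (.inr (.inr (.inr (i, j))))
  simp only [resolventStep] at hp hx hy hA
  have h2 : (PowerSeries.C (C (1 / 2)) : PowerSeries (Jet ι)) * 2 = 1 := by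
    rw [← map_ofNat (PowerSeries.C : Jet ι →+* PowerSeries (Jet ι)) 2,
      ← map_ofNat (C : ℝ →+* Jet ι) 2, ← map_mul, ← map_mul]
    norm_num
  refine ⟨1 + PowerSeries.X * F (.inl ()), fun i => PowerSeries.X * F (.inr (.inl i)),
    fun i => PowerSeries.X * F (.inr (.inr (.inl i))),
    fun i j => PowerSeries.X * F (.inr (.inr (.inr (i, j)))), ?_, fun i => dvd_mul_right _ _,
    fun i => dvd_mul_right _ _, fun i j => dvd_mul_right _ _, fun i => ?_, fun i => ?_,
    fun i j => ?_, ?_⟩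
  · simp
  · rw [liftDer_X_mul, ← hx]
    rw [show ∑ k, PowerSeries.C (v k) * (PowerSeries.X * F (.inr (.inr (.inr (k, i))))) =
      PowerSeries.X * ∑ k, PowerSeries.C (v k) * F (.inr (.inr (.inr (k, i)))) by
        rw [Finset.mul_sum]
        exact Finset.sum_congr rfl fun k _ => by ring]
    ring
  · rw [liftDer_X_mul, ← hy]
    ring
  · linear_combination -PowerSeries.X * hA i j
  · simp only [mul_mul_mul_comm PowerSeries.X _ PowerSeries.X, ← Finset.mul_sum]
    linear_combination -4 * PowerSeries.X * hp + 2 * PowerSeries.X ^ 2 *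
      (∑ i, F (.inr (.inr (.inl i))) * F (.inr (.inr (.inl i))) -
        F (.inl ()) * F (.inl ()) - ∑ i, F (.inr (.inl i)) * F (.inr (.inl i)) +
        PowerSeries.C (C (1 / 2)) *
          ∑ i, ∑ j, F (.inr (.inr (.inr (i, j)))) * F (.inr (.inr (.inr (i, j))))) * h2 +
      PowerSeries.X ^ 2 *
          (∑ i, ∑ j, F (.inr (.inr (.inr (i, j)))) * F (.inr (.inr (.inr (i, j))))) * h2

end Resolvent

/-! ### The orthogonal Lie algebra in components -/

section Components

open Matrix

variable {κ R : Type} [CommRing R]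

/-- The metric `-1, 1, 1, …`. -/
def soMetric (κ R : Type) [CommRing R] : Fin 2 ⊕ κ → R := Sum.elim ![-1, 1] fun _ => 1

/-- The element of the orthogonal Lie algebra with the given components. -/
def soMat (p : R) (x y : κ → R) (A : κ → κ → R) : Matrix (Fin 2 ⊕ κ) (Fin 2 ⊕ κ) R :=
  fromBlocks !![0, p; p, 0] (of ![x, y]) (of fun i => ![x i, -y i]) (of fun i j => -A i j)

variable (p q : R) (x y s t : κ → R) (A B : κ → κ → R)

@[simp] lemma soMat_inl_inl (a c : Fin 2) :
    soMat p x y A (.inl a) (.inl c) = !![0, p; p, 0] a c := rfl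
@[simp] lemma soMat_inl_inr (a : Fin 2) (i : κ) :
    soMat p x y A (.inl a) (.inr i) = ![x i, y i] a := by fin_cases a <;> rfl
@[simp] lemma soMat_inr_inl (a : Fin 2) (i : κ) :
    soMat p x y A (.inr i) (.inl a) = ![x i, -y i] a := rfl
@[simp] lemma soMat_inr_inr (i j : κ) : soMat p x y A (.inr i) (.inr j) = -A i j := rfl

lemma isSkewFor_soMat {A : κ → κ → R} (hA : ∀ i j, A i j = -A j i) :
    IsSkewFor (soMetric κ R) (soMat p x y A) := by
  rintro (a | i) (c | j)
  · fin_cases a <;> fin_cases c <;> simp [soMetric]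
  · fin_cases a <;> simp [soMetric]
  · fin_cases c <;> simp [soMetric]
  · simp [soMetric, hA i j]

lemma soMetric_mul_self (a : Fin 2 ⊕ κ) : soMetric κ R a * soMetric κ R a = 1 := by
  rcases a with a | i
  · fin_cases a <;> simp [soMetric]
  · simp [soMetric]

/-- `p` times the bivector is the wedge product of the first two rows of the matrix: the block
relation assumed for `A` already makes the whole matrix decomposable where `p` is invertible. -/
lemma soMat_plucker {p : R} {x y : κ → R} {A : κ → κ → R}
    (h : ∀ i j, p * A i j = -(x i * y j - x j * y i)) (a c : Fin 2 ⊕ κ) :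
    p * (soMetric κ R a * soMat p x y A a c) =
      soMat p x y A (.inl 0) a * soMat p x y A (.inl 1) c -
        soMat p x y A (.inl 0) c * soMat p x y A (.inl 1) a := by
  rcases a with a | i <;> rcases c with c | j
  · fin_cases a <;> fin_cases c <;> simp [soMetric]
  · fin_cases a <;> simp [soMetric, mul_comm]
  · fin_cases c <;> simp [soMetric, mul_comm]
  · simp only [soMetric, soMat_inr_inr, soMat_inl_inr, Sum.elim_inr, cons_val_zero, cons_val_one]
    linear_combination -h i j

variable [Fintype κ]

lemma trace_soMat_mul_soMat : trace (soMat p x y A * soMat q s t B) =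
    2 * (p * q) + 2 * ∑ i, x i * s i - 2 * ∑ i, y i * t i + ∑ i, ∑ j, A i j * B j i := by
  simp only [trace, diag_apply, mul_apply, Fintype.sum_sum_type, Fin.sum_univ_two,
    soMat_inl_inl, soMat_inl_inr, soMat_inr_inl, soMat_inr_inr, of_apply, cons_val_zero,
    cons_val_one, Finset.sum_add_distrib, cons_val', cons_val_fin_one, mul_neg,
    neg_mul, Finset.sum_neg_distrib]
  ring

lemma commutator_soMat_zero_one :
    (soMat q s t B * soMat p x y A - soMat p x y A * soMat q s t B) (.inl 0) (.inl 1) =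
      ∑ k, t k * x k - ∑ k, s k * y k := by
  simp only [Matrix.sub_apply, mul_apply, Fintype.sum_sum_type, Fin.sum_univ_two,
    soMat_inl_inl, soMat_inl_inr, soMat_inr_inl, of_apply, cons_val_zero,
    cons_val_one, cons_val', cons_val_fin_one, mul_neg, Finset.sum_neg_distrib]
  simp only [mul_comm (x _)]
  ring

lemma commutator_soMat_zero_inr (i : κ) :
    (soMat q s t B * soMat p x y A - soMat p x y A * soMat q s t B) (.inl 0) (.inr i) =
      q * y i - p * t i - ∑ k, s k * A k i + ∑ k, x k * B k i := by
  simp only [Matrix.sub_apply, mul_apply, Fintype.sum_sum_type, Fin.sum_univ_two,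
    soMat_inl_inl, soMat_inl_inr, soMat_inr_inr, of_apply, cons_val_zero,
    cons_val_one, cons_val', cons_val_fin_one, mul_neg, Finset.sum_neg_distrib]
  ring

lemma commutator_soMat_one_inr (i : κ) :
    (soMat q s t B * soMat p x y A - soMat p x y A * soMat q s t B) (.inl 1) (.inr i) =
      q * x i - p * s i - ∑ k, t k * A k i + ∑ k, y k * B k i := by
  simp only [Matrix.sub_apply, mul_apply, Fintype.sum_sum_type, Fin.sum_univ_two,
    soMat_inl_inl, soMat_inl_inr, soMat_inr_inr, of_apply, cons_val_zero,
    cons_val_one, cons_val', cons_val_fin_one, mul_neg, Finset.sum_neg_distrib]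
  ring

lemma commutator_soMat_inr_inr (i j : κ) :
    (soMat q s t B * soMat p x y A - soMat p x y A * soMat q s t B) (.inr i) (.inr j) =
      s i * x j - x i * s j - (t i * y j - y i * t j) +
        (∑ k, B i k * A k j - ∑ k, A i k * B k j) := by
  simp only [Matrix.sub_apply, mul_apply, Fintype.sum_sum_type, Fin.sum_univ_two,
    soMat_inr_inl, soMat_inl_inr, soMat_inr_inr, cons_val_zero,
    cons_val_one, neg_mul, mul_neg, neg_neg]
  ring

end Components

/-! ### The resolvent solves the Lax equation -/

section Lax

open Matrix

variable {κ ι : Type} [Fintype κ] {v : κ → Jet ι} {p : PowerSeries (Jet ι)}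
  {x y : κ → PowerSeries (Jet ι)} {A : κ → κ → PowerSeries (Jet ι)}

lemma IsResolvent.p_ne_zero (h : IsResolvent v p x y A) : p ≠ 0 := by
  intro h0
  have := h.const
  rw [h0, map_zero] at this
  exact zero_ne_one this

lemma IsResolvent.skew (h : IsResolvent v p x y A) (i j : κ) : A i j = -A j i := by
  refine mul_left_cancel₀ h.p_ne_zero ?_
  linear_combination h.plucker i j + h.plucker j i

lemma IsResolvent.isSimpleBivector (h : IsResolvent v p x y A) :
    IsSimpleBivector (soMetric κ _) (soMat p x y A) where
  metric := soMetric_mul_self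
  skew := isSkewFor_soMat _ _ _ h.skew
  plucker a b c d := by
    have key := soMat_plucker h.plucker
    -- After multiplication by `p²` all entries are two-by-two minors of the first two rows, for
    -- which the Plücker relation is an identity; power series over differential polynomials form a
    -- domain.
    refine (mul_eq_zero.1 ?_).resolve_left (mul_ne_zero h.p_ne_zero h.p_ne_zero)
    generalize soMetric κ (PowerSeries (Jet ι)) = g at *
    generalize soMat p x y A = N at *
    linear_combination p * (g c * N c d) * key a b - p * (g b * N b d) * key a c +
      p * (g b * N b c) * key a d +
      (N (.inl 0) a * N (.inl 1) b - N (.inl 0) b * N (.inl 1) a) * key c d -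
      (N (.inl 0) a * N (.inl 1) c - N (.inl 0) c * N (.inl 1) a) * key b d +
      (N (.inl 0) a * N (.inl 1) d - N (.inl 0) d * N (.inl 1) a) * key b c
  norm := by
    have : ∑ i, ∑ j, A i j * A j i = -∑ i, ∑ j, A i j * A i j := by
      rw [← Finset.sum_neg_distrib]
      refine Finset.sum_congr rfl fun i _ => ?_
      rw [← Finset.sum_neg_distrib]
      exact Finset.sum_congr rfl fun j _ => by rw [h.skew j i]; ring
    rw [trace_soMat_mul_soMat, this]
    linear_combination h.norm

omit [Fintype κ] in
lemma soMetric_der {R : Type} [CommRing R] [Algebra ℝ R] (δ : Derivation ℝ R R)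
    (a : Fin 2 ⊕ κ) : δ (soMetric κ R a) = 0 := by
  rcases a with a | i
  · fin_cases a <;> simp [soMetric]
  · simp [soMetric]

/-- The entries of the resolvent, except for the two leading ones, are divisible by `X`. -/
lemma IsResolvent.dvd (h : IsResolvent v p x y A) {a c : Fin 2 ⊕ κ}
    (hac : a.isRight ∨ c.isRight ∨ a = c) : PowerSeries.X ∣ soMat p x y A a c := by
  rcases a with a | i <;> rcases c with c | j
  · obtain rfl : a = c := by simpa using hac
    fin_cases a <;> simp
  · fin_cases a
    · exact h.dvd_x j
    · exact h.dvd_y j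
  · fin_cases c
    · exact h.dvd_x i
    · exact (dvd_neg.2 (h.dvd_y i))
  · exact dvd_neg.2 (h.dvd_A i j)

lemma IsResolvent.dvd_sq (h : IsResolvent v p x y A) {a c : Fin 2 ⊕ κ}
    (hac : a.isRight ∨ c.isRight) : PowerSeries.X ∣ (soMat p x y A * soMat p x y A) a c := by
  rw [mul_apply]
  refine Finset.dvd_sum fun b _ => ?_
  rcases hac with ha | hc
  · exact (h.dvd (.inl ha)).mul_right _
  · exact (h.dvd (.inr (.inl hc))).mul_left _

lemma IsResolvent.dvd_sq_diag (h : IsResolvent v p x y A) (a : Fin 2) :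
    PowerSeries.X ∣ (soMat p x y A * soMat p x y A) (.inl a) (.inl a) - 1 := by
  have hp : PowerSeries.X ∣ p * p - 1 := by
    rw [PowerSeries.X_dvd_iff]
    simp [h.const]
  rw [mul_apply, Fintype.sum_sum_type, Fin.sum_univ_two, add_sub_right_comm]
  refine dvd_add ?_ (Finset.dvd_sum fun b _ => (h.dvd (.inr (.inl rfl))).mul_right _)
  fin_cases a <;> simpa using hp

/-- A tangent field all of whose `x`- and `y`-components gain a factor `X` vanishes. -/
lemma IsResolvent.tangent_eq_zero (h : IsResolvent v p x y A)
    {E : Matrix (Fin 2 ⊕ κ) (Fin 2 ⊕ κ) (PowerSeries (Jet ι))}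
    (hE : IsTangentTo (soMetric κ _) (soMat p x y A) E)
    (hstep : ∀ n, (∀ a c, PowerSeries.X ^ n ∣ E a c) → ∀ (a : Fin 2) (i : κ),
      PowerSeries.X ^ (n + 1) ∣ E (.inl a) (.inr i)) : E = 0 := by
  have hsw := fun a c => hE.skew.swap soMetric_mul_self a c
  have hdvd : ∀ n a c, PowerSeries.X ^ n ∣ E a c := by
    intro n
    induction n with
    | zero => intro a c; rw [pow_zero]; exact one_dvd _
    | succ n ih =>
      have hx := hstep n ih
      have hmul : ∀ {f : PowerSeries (Jet ι)}, PowerSeries.X ∣ f → ∀ a c,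
          PowerSeries.X ^ (n + 1) ∣ f * E a c := fun hf a c => by
        rw [pow_succ']; exact mul_dvd_mul hf (ih a c)
      have hmul' : ∀ {f : PowerSeries (Jet ι)}, PowerSeries.X ∣ f → ∀ a c,
          PowerSeries.X ^ (n + 1) ∣ E a c * f := fun hf a c => by
        rw [mul_comm]; exact hmul hf a c
      have hdiag : ∀ a, E a a = 0 := by
        intro a
        have h1 : (2 : PowerSeries (Jet ι)) * E a a = 0 := by
          linear_combination hsw a a - E a a * soMetric_mul_self (R := PowerSeries (Jet ι)) a
        linear_combination algebraMap ℝ (PowerSeries (Jet ι)) (1 / 2) * h1 -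
          E a a * half_mul_two (PowerSeries (Jet ι))
      -- Modulo `X` the square of the resolvent is the projection onto the first two coordinates. At
      -- the next order `M² E + E M² = E` therefore reads `2 E₀₁ = E₀₁` in the corner and `0 = E i
      -- j` in the last block, so those entries gain a factor `X` as well.
      set Q := soMat p x y A * soMat p x y A with hQ
      have hsq := fun a c => congrFun (congrFun hE.sq a) c
      simp only [Matrix.add_apply, ← hQ] at hsq
      simp only [mul_apply, Fintype.sum_sum_type, Fin.sum_univ_two] at hsq
      have h01 : PowerSeries.X ^ (n + 1) ∣ E (.inl 0) (.inl 1) := by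
        have h1 := hsq (.inl 0) (.inl 1)
        rw [hdiag, hdiag] at h1
        have h2 : E (.inl 0) (.inl 1) =
            -((Q (.inl 0) (.inl 0) - 1) * E (.inl 0) (.inl 1) +
              (Q (.inl 1) (.inl 1) - 1) * E (.inl 0) (.inl 1) +
              ∑ i, Q (.inl 0) (.inr i) * E (.inr i) (.inl 1) +
              ∑ i, E (.inl 0) (.inr i) * Q (.inr i) (.inl 1)) := by
          linear_combination h1
        rw [h2, dvd_neg]
        exact (((hmul (h.dvd_sq_diag 0) _ _).add (hmul (h.dvd_sq_diag 1) _ _)).add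
          (Finset.dvd_sum fun i _ => hmul (h.dvd_sq (.inr rfl)) _ _)).add
          (Finset.dvd_sum fun i _ => hmul' (h.dvd_sq (.inl rfl)) _ _)
      rintro (a | i) (c | j)
      · by_cases hac : a = c
        · rw [hac, hdiag]; exact dvd_zero _
        · fin_cases a <;> fin_cases c
          · exact absurd rfl hac
          · exact h01
          · rw [hsw, dvd_neg]
            exact h01.mul_left _
          · exact absurd rfl hac
      · exact hx a j
      · rw [hsw, dvd_neg]
        exact (hx c i).mul_left _
      · rw [← hsq]
        refine ((((?_ : _ ∣ _).add ?_).add ?_).add (((?_ : _ ∣ _).add ?_).add ?_))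
        · exact hmul (h.dvd_sq (.inl rfl)) _ _
        · exact hmul (h.dvd_sq (.inl rfl)) _ _
        · exact Finset.dvd_sum fun k _ => hmul (h.dvd_sq (.inl rfl)) _ _
        · exact hmul' (h.dvd_sq (.inr rfl)) _ _
        · exact hmul' (h.dvd_sq (.inr rfl)) _ _
        · exact Finset.dvd_sum fun k _ => hmul' (h.dvd_sq (.inr rfl)) _ _
  refine Matrix.ext fun a c => ?_
  exact eq_of_forall_X_pow_dvd fun n => by simpa using hdvd n a c

/-- The derivation `X D` of power series. -/
noncomputable def XD (ι : Type) : Derivation ℝ (PowerSeries (Jet ι)) (PowerSeries (Jet ι)) :=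
  (PowerSeries.X : PowerSeries (Jet ι)) • liftDer D

lemma XD_apply (f : PowerSeries (Jet ι)) : XD ι f = PowerSeries.X * liftDer D f := rfl

/-- The potential `a + X U` of the Lax equation. -/
noncomputable def laxMat (v : κ → Jet ι) :
    Matrix (Fin 2 ⊕ κ) (Fin 2 ⊕ κ) (PowerSeries (Jet ι)) :=
  soMat 1 0 (fun i => PowerSeries.X * PowerSeries.C (v i)) 0

/-- The defect of the Lax equation is tangent to the orbit, being the difference of a derivative of
`M` and a commutator with `M`. Its `x`- and `y`-components vanish by the defining equations, so
rigidity kills the others. -/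
lemma IsResolvent.lax (h : IsResolvent v p x y A) :
    (soMat p x y A).map (XD ι) =
      laxMat v * soMat p x y A - soMat p x y A * laxMat v := by
  rw [← sub_eq_zero]
  refine h.tangent_eq_zero ((h.isSimpleBivector.isTangentTo_map_der (soMetric_der _)).sub
    (h.isSimpleBivector.isTangentTo_commutator (isSkewFor_soMat _ _ _ fun i j => by simp)))
    fun n _ a i => ?_
  have h0 : ((soMat p x y A).map (XD ι) - (laxMat v * soMat p x y A - soMat p x y A * laxMat v))
      (.inl a) (.inr i) = 0 := by
    rw [Matrix.sub_apply, map_apply]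
    fin_cases a
    · rw [Fin.zero_eta, laxMat, commutator_soMat_zero_inr]
      simp only [soMat_inl_inr, cons_val_zero, XD_apply, Pi.zero_apply, zero_mul, mul_zero,
        Finset.sum_const_zero]
      linear_combination -h.y_eq i
    · rw [Fin.mk_one, laxMat, commutator_soMat_one_inr]
      simp only [soMat_inl_inr, cons_val_one, cons_val_fin_one, XD_apply, Pi.zero_apply, mul_zero,
        Finset.sum_const_zero, mul_assoc, ← Finset.mul_sum]
      linear_combination -h.x_eq i
  rw [h0]
  exact dvd_zero _

/-- The locality statement: `v · x` has the antiderivative `p` among the series of differential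
polynomials. `D_A` does the same for `v ∧ y`. -/
lemma IsResolvent.D_p (h : IsResolvent v p x y A) :
    liftDer D p = ∑ i, PowerSeries.C (v i) * x i := by
  have h1 := congrFun (congrFun h.lax (.inl 0)) (.inl 1)
  rw [laxMat, commutator_soMat_zero_one] at h1
  simp only [map_apply, soMat_inl_inl, of_apply, cons_val_zero, cons_val_one, cons_val',
    cons_val_fin_one, XD_apply, Pi.zero_apply, zero_mul, Finset.sum_const_zero, sub_zero,
    mul_assoc, ← Finset.mul_sum] at h1
  exact mul_left_cancel₀ PowerSeries.X_ne_zero h1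

lemma IsResolvent.D_A (h : IsResolvent v p x y A) (i j : κ) :
    liftDer D (A i j) = PowerSeries.C (v i) * y j - y i * PowerSeries.C (v j) := by
  have h1 := congrFun (congrFun h.lax (.inr i)) (.inr j)
  rw [laxMat, commutator_soMat_inr_inr] at h1
  simp only [map_apply, soMat_inr_inr, XD_apply, Pi.zero_apply, zero_mul, mul_zero,
    Finset.sum_const_zero, sub_zero, map_neg] at h1
  refine mul_left_cancel₀ PowerSeries.X_ne_zero ?_
  linear_combination -h1

end Lax

/-! ### The linearized Lax equation and the variations of the resolvent -/

section Flows

open Matrix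

variable {κ ι : Type}

lemma soMat_map {R : Type} [CommRing R] [Algebra ℝ R] (δ : Derivation ℝ R R) (p : R)
    (x y : κ → R) (A : κ → κ → R) :
    (soMat p x y A).map δ = soMat (δ p) (fun i => δ (x i)) (fun i => δ (y i))
      (fun i j => δ (A i j)) := by
  refine Matrix.ext fun a c => ?_
  rcases a with a | i <;> rcases c with c | j
  · fin_cases a <;> fin_cases c <;> simp
  · fin_cases a <;> simp
  · fin_cases c <;> simp
  · simp

lemma soMat_sub {R : Type} [CommRing R] (p q : R) (x y s t : κ → R) (A B : κ → κ → R) :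
    soMat p x y A - soMat q s t B = soMat (p - q) (x - s) (y - t) (A - B) := by
  refine Matrix.ext fun a c => ?_
  rcases a with a | i <;> rcases c with c | j
  · fin_cases a <;> fin_cases c <;> simp
  · fin_cases a <;> simp
  · fin_cases c <;> simp
    ring
  · simp only [Matrix.sub_apply, soMat_inr_inr, Pi.sub_apply]
    ring

lemma soMat_smul {R : Type} [CommRing R] (r p : R) (x y : κ → R) (A : κ → κ → R) :
    r • soMat p x y A = soMat (r * p) (fun i => r * x i) (fun i => r * y i)
      (fun i j => r * A i j) := by
  refine Matrix.ext fun a c => ?_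
  rcases a with a | i <;> rcases c with c | j
  · fin_cases a <;> fin_cases c <;> simp
  · fin_cases a <;> simp
  · fin_cases c <;> simp
  · simp

lemma IsSkewFor.eq_soMat {R : Type} [CommRing R] [Algebra ℝ R]
    {E : Matrix (Fin 2 ⊕ κ) (Fin 2 ⊕ κ) R} (hE : IsSkewFor (soMetric κ R) E) :
    E = soMat (E (.inl 0) (.inl 1)) (fun i => E (.inl 0) (.inr i)) (fun i => E (.inl 1) (.inr i))
      (fun i j => -E (.inr i) (.inr j)) := by
  have hsw := fun a c => hE.swap soMetric_mul_self a c
  have hdiag : ∀ a, E a a = 0 := by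
    intro a
    have h1 : (2 : R) * E a a = 0 := by
      linear_combination hsw a a - E a a * soMetric_mul_self (R := R) a
    linear_combination algebraMap ℝ R (1 / 2) * h1 - E a a * half_mul_two R
  refine Matrix.ext fun a c => ?_
  rcases a with a | i <;> rcases c with c | j
  · fin_cases a <;> fin_cases c <;> simp [hdiag]
    rw [hsw]
    simp [soMetric]
  · fin_cases a <;> simp
  · rw [hsw]
    fin_cases c <;> simp [soMetric]
  · simp

variable [Fintype κ] {v : κ → Jet ι} {p : PowerSeries (Jet ι)}
  {x y : κ → PowerSeries (Jet ι)} {A : κ → κ → PowerSeries (Jet ι)}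

lemma XD_liftDer {δ : Derivation ℝ (Jet ι) (Jet ι)} (hδ : ∀ f, δ (D f) = D (δ f))
    (f : PowerSeries (Jet ι)) : XD ι (liftDer δ f) = liftDer δ (XD ι f) := by
  rw [XD_apply, XD_apply, liftDer_X_mul, liftDer_comm hδ]

lemma XD_euler (f : PowerSeries (Jet ι)) :
    XD ι (euler (Jet ι) f) = euler (Jet ι) (XD ι f) - XD ι f := by
  rw [XD_apply, XD_apply, euler_X_mul, euler_liftDer]
  ring

omit [Fintype κ] in
lemma laxMat_map (δ : Derivation ℝ (Jet ι) (Jet ι)) :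
    (laxMat v).map (liftDer δ) =
      soMat 0 0 (fun i => PowerSeries.X * PowerSeries.C (δ (v i))) 0 := by
  rw [laxMat, soMat_map, Derivation.map_one_eq_zero]
  congr 1
  · funext i; exact map_zero _
  · funext i; rw [liftDer_X_mul, liftDer_C]
  · funext i j; exact map_zero _

/-- A tangent solution of the linearized Lax equation vanishes. -/
lemma IsResolvent.eq_zero_of_lax (h : IsResolvent v p x y A)
    {E : Matrix (Fin 2 ⊕ κ) (Fin 2 ⊕ κ) (PowerSeries (Jet ι))}
    (hE : IsTangentTo (soMetric κ _) (soMat p x y A) E)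
    (hlax : E.map (XD ι) = laxMat v * E - E * laxMat v) : E = 0 := by
  refine h.tangent_eq_zero hE fun n hn => ?_
  have hX : ∀ {f : PowerSeries (Jet ι)}, PowerSeries.X ^ n ∣ f →
      PowerSeries.X ^ (n + 1) ∣ PowerSeries.X * f := fun hf => by
    rw [pow_succ']; exact mul_dvd_mul_left _ hf
  -- The commutator with the constant matrix `a` interchanges the `x`- and `y`-components, all other
  -- terms carrying a factor `X`; each of the two is thus `X` times entries of `E` and their
  -- derivatives.
  have h0 : ∀ i, PowerSeries.X * liftDer D (E (.inl 0) (.inr i)) =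
      E (.inl 1) (.inr i) - PowerSeries.X * (E (.inl 0) (.inl 1) * PowerSeries.C (v i)) := by
    intro i
    have h1 := congrFun (congrFun hlax (.inl 0)) (.inr i)
    rw [hE.skew.eq_soMat, laxMat, commutator_soMat_zero_inr] at h1
    simp only [map_apply, soMat_inl_inr, cons_val_zero, XD_apply, Pi.zero_apply, zero_mul,
      mul_zero, Finset.sum_const_zero] at h1
    linear_combination h1
  have h1 : ∀ i, PowerSeries.X * liftDer D (E (.inl 1) (.inr i)) =
      E (.inl 0) (.inr i) + PowerSeries.X * ∑ k, PowerSeries.C (v k) * E (.inr k) (.inr i) := by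
    intro i
    have h1 := congrFun (congrFun hlax (.inl 1)) (.inr i)
    rw [hE.skew.eq_soMat, laxMat, commutator_soMat_one_inr] at h1
    simp only [map_apply, soMat_inl_inr, cons_val_one, cons_val_fin_one, XD_apply, Pi.zero_apply,
      mul_zero, Finset.sum_const_zero, mul_assoc, ← Finset.mul_sum, mul_neg,
      Finset.sum_neg_distrib] at h1
    linear_combination h1
  intro a i
  fin_cases a
  · have h2 : E (.inl 0) (.inr i) = PowerSeries.X * (liftDer D (E (.inl 1) (.inr i)) -
        ∑ k, PowerSeries.C (v k) * E (.inr k) (.inr i)) := by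
      linear_combination -h1 i
    exact h2 ▸ hX ((X_pow_dvd_liftDer _ (hn _ _)).sub
      (Finset.dvd_sum fun k _ => (hn _ _).mul_left _))
  · have h2 : E (.inl 1) (.inr i) = PowerSeries.X * (liftDer D (E (.inl 0) (.inr i)) +
        E (.inl 0) (.inl 1) * PowerSeries.C (v i)) := by
      linear_combination -h0 i
    exact h2 ▸ hX ((X_pow_dvd_liftDer _ (hn _ _)).add ((hn _ _).mul_right _))

/-! ### Coefficients of the resolvent, their flows and gradients -/

section Coefficients

lemma IsResolvent.coeff_x (h : IsResolvent v p x y A) (n : ℕ) (i : κ) :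
    PowerSeries.coeff (n + 1) (x i) = D (PowerSeries.coeff n (y i)) + ∑ k, v k * PowerSeries.coeff n (A k i) := by
  rw [h.x_eq i, PowerSeries.coeff_succ_X_mul, map_add, coeff_liftDer, map_sum]
  simp only [PowerSeries.coeff_C_mul]

lemma IsResolvent.coeff_y (h : IsResolvent v p x y A) (n : ℕ) (i : κ) :
    PowerSeries.coeff (n + 1) (y i) = D (PowerSeries.coeff n (x i)) + PowerSeries.coeff n p * v i := by
  rw [h.y_eq i, PowerSeries.coeff_succ_X_mul, map_add, coeff_liftDer, PowerSeries.coeff_mul_C]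

lemma IsResolvent.D_coeff_p (h : IsResolvent v p x y A) (n : ℕ) :
    D (PowerSeries.coeff n p) = ∑ i, v i * PowerSeries.coeff n (x i) := by
  rw [← coeff_liftDer, h.D_p, map_sum]
  simp only [PowerSeries.coeff_C_mul]

lemma IsResolvent.D_coeff_A (h : IsResolvent v p x y A) (n : ℕ) (i j : κ) :
    D (PowerSeries.coeff n (A i j)) = v i * PowerSeries.coeff n (y j) - PowerSeries.coeff n (y i) * v j := by
  rw [← coeff_liftDer, h.D_A, map_sub, PowerSeries.coeff_C_mul, PowerSeries.coeff_mul_C]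

lemma IsResolvent.coeff_zero_x (h : IsResolvent v p x y A) (i : κ) : PowerSeries.coeff 0 (x i) = 0 := by
  simpa using PowerSeries.X_dvd_iff.1 (h.dvd_x i)

/-- The gauge field of the flow of the coefficient `s` of the resolvent. -/
noncomputable def flowMat (p : PowerSeries (Jet ι)) (x y : κ → PowerSeries (Jet ι))
    (A : κ → κ → PowerSeries (Jet ι)) (s : ℕ) :
    Matrix (Fin 2 ⊕ κ) (Fin 2 ⊕ κ) (PowerSeries (Jet ι)) :=
  soMat (PowerSeries.X * PowerSeries.C (PowerSeries.coeff s p))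
    (fun i => PowerSeries.X * PowerSeries.C (PowerSeries.coeff s (x i)))
    (fun i => PowerSeries.X ^ 2 * PowerSeries.C (PowerSeries.coeff (s + 1) (y i)))
    (fun i j => PowerSeries.X ^ 2 * PowerSeries.C (PowerSeries.coeff (s + 1) (A i j)))

lemma IsResolvent.isSkewFor_flowMat (h : IsResolvent v p x y A) (s : ℕ) :
    IsSkewFor (soMetric κ _) (flowMat p x y A s) :=
  isSkewFor_soMat _ _ _ fun i j => by rw [h.skew i j]; simp

omit [Fintype κ] in
lemma soMat_congr {R : Type} [CommRing R] {p q : R} {x y s t : κ → R} {A B : κ → κ → R}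
    (hp : p = q) (hx : ∀ i, x i = s i) (hy : ∀ i, y i = t i) (hA : ∀ i j, A i j = B i j) :
    soMat p x y A = soMat q s t B := by
  obtain rfl := hp
  obtain rfl : x = s := funext hx
  obtain rfl : y = t := funext hy
  obtain rfl : A = B := funext fun i => funext (hA i)
  rfl

/-- A zero curvature equation comparing the flows `s` and `s + 2`. The recursion links `x` and `p`
at index `s` to `y` and `A` at `s + 1`, and these to `x` at `s + 2`; so a gauge field with two
powers of `X` closes up. -/
lemma IsResolvent.flowMat_lax (h : IsResolvent v p x y A) (s : ℕ)
    {δ δ' : Derivation ℝ (Jet ι) (Jet ι)} (hv : ∀ i, δ (v i) = PowerSeries.coeff s (x i))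
    (hv' : ∀ i, δ' (v i) = PowerSeries.coeff (s + 2) (x i)) :
    (flowMat p x y A s).map (XD ι) =
      (laxMat v * flowMat p x y A s - flowMat p x y A s * laxMat v) -
        ((laxMat v).map (liftDer δ) -
          (PowerSeries.X ^ 2 : PowerSeries (Jet ι)) • (laxMat v).map (liftDer δ')) := by
  have hXD : ∀ f, XD ι (PowerSeries.C f) = PowerSeries.X * PowerSeries.C (D f) := fun f => by
    rw [XD_apply, liftDer_C]
  have hXD0 : XD ι (PowerSeries.X) = 0 := by rw [XD_apply, liftDer_X, mul_zero]
  have hXD2 : ∀ f, XD ι (PowerSeries.X ^ 2 * f) = PowerSeries.X ^ 2 * XD ι f := fun f => by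
    rw [Derivation.leibniz, Derivation.leibniz_pow, hXD0]; simp
  have hXD1 : ∀ f, XD ι (PowerSeries.X * f) = PowerSeries.X * XD ι f := fun f => by
    rw [Derivation.leibniz, hXD0]; simp
  have hcomm : IsSkewFor (soMetric κ _)
      (laxMat v * flowMat p x y A s - flowMat p x y A s * laxMat v) :=
    IsSkewFor.commutator (isSkewFor_soMat _ _ _ fun i j => by simp) (h.isSkewFor_flowMat s)
  rw [hcomm.eq_soMat, laxMat_map, laxMat_map, soMat_smul, soMat_sub, soMat_sub]
  rw [flowMat, laxMat, soMat_map]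
  refine soMat_congr ?_ (fun i => ?_) (fun i => ?_) (fun i j => ?_)
  · rw [commutator_soMat_zero_one, hXD1, hXD, h.D_coeff_p, map_sum]
    simp only [map_mul, Finset.mul_sum, Pi.zero_apply, zero_mul, Finset.sum_const_zero]
    rw [mul_zero, sub_zero, sub_zero, sub_zero]
    exact Finset.sum_congr rfl fun i _ => by ring
  · rw [Pi.sub_apply, commutator_soMat_zero_inr, hXD1, hXD]
    have h1 := congrArg PowerSeries.C (h.coeff_y s i)
    rw [map_add, map_mul] at h1
    simp only [Pi.sub_apply, Pi.zero_apply, zero_mul, mul_zero, Finset.sum_const_zero]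
    linear_combination -PowerSeries.X ^ 2 * h1
  · rw [Pi.sub_apply, commutator_soMat_one_inr, hXD2, hXD]
    have h1 := congrArg PowerSeries.C (h.coeff_x (s + 1) i)
    rw [map_add, map_sum] at h1
    simp only [map_mul] at h1
    have h2 : ∑ k, PowerSeries.X * PowerSeries.C (v k) * (PowerSeries.X ^ 2 *
        PowerSeries.C (PowerSeries.coeff (s + 1) (A k i))) = PowerSeries.X ^ 3 *
        ∑ k, PowerSeries.C (v k) * PowerSeries.C (PowerSeries.coeff (s + 1) (A k i)) := by
      rw [Finset.mul_sum]
      exact Finset.sum_congr rfl fun k _ => by ring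
    simp only [Pi.sub_apply, Pi.zero_apply, mul_zero, Finset.sum_const_zero, h2, hv, hv']
    linear_combination -PowerSeries.X ^ 3 * h1
  · rw [Pi.sub_apply, Pi.sub_apply, commutator_soMat_inr_inr, hXD2, hXD, h.D_coeff_A]
    simp only [map_sub, map_mul, Pi.sub_apply, Pi.zero_apply, zero_mul, mul_zero,
      Finset.sum_const_zero]
    ring

/-- The variation of the resolvent along two of its flows. -/
lemma IsResolvent.variation (h : IsResolvent v p x y A) (s : ℕ)
    {δ δ' : Derivation ℝ (Jet ι) (Jet ι)} (hδ : ∀ f, δ (D f) = D (δ f))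
    (hδ' : ∀ f, δ' (D f) = D (δ' f)) (hv : ∀ i, δ (v i) = PowerSeries.coeff s (x i))
    (hv' : ∀ i, δ' (v i) = PowerSeries.coeff (s + 2) (x i)) (t : ℕ) (i : κ) :
    δ (PowerSeries.coeff (t + 2) (x i)) - δ' (PowerSeries.coeff t (x i)) =
      PowerSeries.coeff t p * PowerSeries.coeff (s + 1) (y i) -
        PowerSeries.coeff s p * PowerSeries.coeff (t + 1) (y i) +
        ∑ k, PowerSeries.coeff s (x k) * PowerSeries.coeff (t + 1) (A k i) -
        ∑ k, PowerSeries.coeff t (x k) * PowerSeries.coeff (s + 1) (A k i) := by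
  have hM := h.isSimpleBivector
  have hlax := h.lax
  obtain ⟨M, hMdef⟩ : ∃ M, M = soMat p x y A := ⟨_, rfl⟩
  rw [← hMdef] at hM hlax
  have hX2 : XD ι (PowerSeries.X ^ 2) = 0 := by
    rw [Derivation.leibniz_pow, XD_apply, liftDer_X]; simp
  have hδM : ∀ {ε : Derivation ℝ (Jet ι) (Jet ι)}, (∀ f, ε (D f) = D (ε f)) →
      (M.map (liftDer ε)).map (XD ι) = ((laxMat v).map (liftDer ε) * M -
        M * (laxMat v).map (liftDer ε)) +
        (laxMat v * M.map (liftDer ε) - M.map (liftDer ε) * laxMat v) := by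
    intro ε hε
    have h1 : (M.map (liftDer ε)).map (XD ι) = (M.map (XD ι)).map (liftDer ε) :=
      Matrix.ext fun a c => XD_liftDer hε _
    rw [h1, hlax, map_der_sub, map_der_mul, map_der_mul]
    abel
  -- This combination is tangent to the orbit and, by the zero curvature equation, solves the
  -- linearized Lax equation; hence it vanishes.
  have hE : M.map (liftDer δ) - (PowerSeries.X ^ 2 : PowerSeries (Jet ι)) • M.map (liftDer δ') +
      (flowMat p x y A s * M - M * flowMat p x y A s) = 0 := by
    refine h.eq_zero_of_lax (hMdef ▸ ((hM.isTangentTo_map_der (soMetric_der _)).sub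
      ((hM.isTangentTo_map_der (soMetric_der _)).smul _)).add (hM.isTangentTo_commutator (h.isSkewFor_flowMat s))) ?_
    rw [map_der_add, map_der_sub, map_der_smul _ hX2, map_der_sub, map_der_mul, map_der_mul,
      hδM hδ, hδM hδ', h.flowMat_lax s hv hv', hlax]
    simp only [smul_add, smul_sub, mul_add, mul_sub, add_mul, sub_mul, Matrix.mul_smul,
      Matrix.smul_mul]
    noncomm_ring
  have h0 := congrFun (congrFun hE (.inl 0)) (.inr i)
  rw [Matrix.add_apply, hMdef, flowMat, commutator_soMat_zero_inr] at h0
  -- The factors `X` and `X ^ 2` in the gauge field shift the index so that the resulting right side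
  -- is antisymmetric under exchange of `s` and `t`.
  have h1 := congrArg (PowerSeries.coeff (t + 2)) h0
  have e1 : PowerSeries.coeff (t + 2) (PowerSeries.X * PowerSeries.C (PowerSeries.coeff s p) * y i)
      = PowerSeries.coeff s p * PowerSeries.coeff (t + 1) (y i) := by
    rw [mul_assoc, PowerSeries.coeff_succ_X_mul, PowerSeries.coeff_C_mul]
  have e2 : PowerSeries.coeff (t + 2) (p * (PowerSeries.X ^ 2 *
      PowerSeries.C (PowerSeries.coeff (s + 1) (y i)))) =
      PowerSeries.coeff t p * PowerSeries.coeff (s + 1) (y i) := by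
    rw [mul_left_comm, PowerSeries.coeff_X_pow_mul, PowerSeries.coeff_mul_C]
  have e3 : ∀ k, PowerSeries.coeff (t + 2) (PowerSeries.X *
      PowerSeries.C (PowerSeries.coeff s (x k)) * A k i) =
      PowerSeries.coeff s (x k) * PowerSeries.coeff (t + 1) (A k i) := fun k => by
    rw [mul_assoc, PowerSeries.coeff_succ_X_mul, PowerSeries.coeff_C_mul]
  have e4 : ∀ k, PowerSeries.coeff (t + 2) (x k * (PowerSeries.X ^ 2 *
      PowerSeries.C (PowerSeries.coeff (s + 1) (A k i)))) =
      PowerSeries.coeff t (x k) * PowerSeries.coeff (s + 1) (A k i) := fun k => by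
    rw [mul_left_comm, PowerSeries.coeff_X_pow_mul, PowerSeries.coeff_mul_C]
  simp only [Matrix.sub_apply, Matrix.smul_apply, map_apply, Matrix.zero_apply, map_add, map_sub,
    map_sum, map_zero, e1, e2, e3, e4, smul_eq_mul, PowerSeries.coeff_X_pow_mul, coeff_liftDer,
    soMat_inl_inr, cons_val_zero] at h1
  linear_combination h1

/-- The variation of the `p`-component of the resolvent is given by the `y`-component. -/
lemma IsResolvent.gradient (h : IsResolvent v p x y A) {δ : Derivation ℝ (Jet ι) (Jet ι)}
    (hδ : ∀ f, δ (D f) = D (δ f)) (n : ℕ) :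
    IsTotal (2 * δ (PowerSeries.coeff (n + 1) p) -
      2 * ((n : Jet ι) * ∑ i, PowerSeries.coeff n (y i) * δ (v i))) := by
  have hM := h.isSimpleBivector
  have hlax := h.lax
  have hconv : ∀ ε : Derivation ℝ (PowerSeries (Jet ι)) (PowerSeries (Jet ι)),
      (∀ f, XD ι (ε f) = ε (XD ι f)) → ((soMat p x y A).map ε).map (XD ι) =
        (laxMat v * (soMat p x y A).map ε - (soMat p x y A).map ε * laxMat v) +
        ((laxMat v).map ε * soMat p x y A - soMat p x y A * (laxMat v).map ε) := by
    intro ε hε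
    have h1 : ((soMat p x y A).map ε).map (XD ι) = ((soMat p x y A).map (XD ι)).map ε :=
      Matrix.ext fun a c => hε _
    rw [h1, hlax, map_der_sub, map_der_mul, map_der_mul]
    abel
  have heul : ((soMat p x y A).map (euler (Jet ι))).map (XD ι) =
      (laxMat v * (soMat p x y A).map (euler (Jet ι)) -
        (soMat p x y A).map (euler (Jet ι)) * laxMat v) -
        (soMat 1 0 0 0 * soMat p x y A - soMat p x y A * soMat 1 0 0 0) := by
    have h1 : ((soMat p x y A).map (euler (Jet ι))).map (XD ι) =
        ((soMat p x y A).map (XD ι)).map (euler (Jet ι)) - (soMat p x y A).map (XD ι) :=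
      Matrix.ext fun a c => XD_euler _
    have h2 : (laxMat v).map (euler (Jet ι)) = laxMat v - soMat 1 0 0 0 := by
      have hC : ∀ f : Jet ι, euler (Jet ι) (PowerSeries.C f) = 0 := fun f => by
        rw [euler_apply, PowerSeries.derivative_C, mul_zero]
      rw [laxMat, soMat_map, soMat_sub, Derivation.map_one_eq_zero, sub_self]
      congr 1
      · funext i; simp
      · funext i; rw [euler_X_mul, hC]; simp
      · funext i j; simp
    rw [h1, hlax, map_der_sub, map_der_mul, map_der_mul, h2]
    noncomm_ring
  -- The trace against `a` picks out `2 δp`; the trace against `δ` of the potential gives the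
  -- pairing of `δ v` with the Euler derivative of `y`, whence the factor `n`.
  have key := trace_identity (XD ι) (hM.isTangentTo_map_der (soMetric_der (euler (Jet ι))))
    (hM.isTangentTo_map_der (soMetric_der (liftDer δ))) hlax heul
    (hconv _ fun f => XD_liftDer hδ f)
  rw [laxMat_map, soMat_map, soMat_map, trace_soMat_mul_soMat, trace_soMat_mul_soMat] at key
  simp only [Pi.zero_apply, zero_mul, Finset.sum_const_zero, one_mul, mul_zero, add_zero,
    zero_sub, sub_zero] at key
  have key' := congrArg (PowerSeries.coeff (n + 1)) key
  rw [XD_apply, PowerSeries.coeff_succ_X_mul, coeff_liftDer] at key'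
  have e1 : PowerSeries.coeff (n + 1) (∑ i, PowerSeries.X * PowerSeries.C (δ (v i)) *
      euler (Jet ι) (y i)) = (n : Jet ι) * ∑ i, PowerSeries.coeff n (y i) * δ (v i) := by
    rw [map_sum, Finset.mul_sum]
    refine Finset.sum_congr rfl fun i _ => ?_
    rw [mul_assoc, PowerSeries.coeff_succ_X_mul, PowerSeries.coeff_C_mul, coeff_euler]
    ring
  have e2 : ∀ (m : ℕ) (f : PowerSeries (Jet ι)),
      PowerSeries.coeff m (2 * f) = 2 * PowerSeries.coeff m f := fun m f => by
    rw [two_mul, map_add, two_mul]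

  refine ⟨_, key'.trans ?_⟩
  simp only [map_add, map_neg, e2, e1, coeff_liftDer]
  ring

end Coefficients

end Flows

/-! ### The hierarchy on a block of variables -/

section Hierarchy

variable {κ ι : Type} [Fintype κ] {b : κ → ι} {p : PowerSeries (Jet ι)}
  {x y : κ → PowerSeries (Jet ι)} {A : κ → κ → PowerSeries (Jet ι)}

/-- The constant terms of the coefficients of the resolvent vanish. -/
lemma IsResolvent.constantCoeff_eq (h : IsResolvent (fun i => u (b i)) p x y A) :
    (∀ n i j, constantCoeff (PowerSeries.coeff n (A i j)) = 0) ∧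
      ∀ n, constantCoeff (PowerSeries.coeff (n + 1) p) = 0 := by
  -- Evaluation at the zero field. Total derivatives and `v` vanish there, so the resolvent reduces
  -- to the constant matrix `a`; the sign in `p² = 1` is fixed by the leading coefficient.
  let φ : PowerSeries (Jet ι) →+* PowerSeries ℝ := PowerSeries.map constantCoeff
  have hφD : ∀ f, φ (liftDer D f) = 0 := by
    intro f
    ext n
    rw [PowerSeries.coeff_map, coeff_liftDer, constantCoeff_D, map_zero]
  have hφv : ∀ i, φ (PowerSeries.C (u (b i))) = 0 := by
    intro i
    rw [PowerSeries.map_C, u, constantCoeff_X, map_zero]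
  have hx : ∀ i, φ (x i) = 0 := by
    intro i
    rw [h.x_eq, map_mul, map_add, hφD, map_sum]
    simp only [map_mul, hφv, zero_mul, Finset.sum_const_zero, add_zero, mul_zero]
  have hy : ∀ i, φ (y i) = 0 := by
    intro i
    rw [h.y_eq, map_mul, map_add, hφD, map_mul, hφv]
    simp
  have hp1 : PowerSeries.constantCoeff (φ p) = 1 := by
    rw [← PowerSeries.coeff_zero_eq_constantCoeff_apply, PowerSeries.coeff_map,
      PowerSeries.coeff_zero_eq_constantCoeff_apply, h.const, map_one]
  have hp0 : φ p ≠ 0 := fun h0 => by rw [h0, map_zero] at hp1; exact zero_ne_one hp1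
  have hA : ∀ i j, φ (A i j) = 0 := by
    intro i j
    have h1 := congrArg φ (h.plucker i j)
    simp only [map_mul, map_neg, map_sub, hx, zero_mul, sub_zero, neg_zero] at h1
    exact (mul_eq_zero.1 h1).resolve_left hp0
  have hp : φ p = 1 := by
    have h1 := congrArg φ h.norm
    simp only [map_sub, map_add, map_mul, map_sum, map_ofNat, hx, hy, hA, mul_zero,
      Finset.sum_const_zero, add_zero, sub_zero] at h1
    have h2 : (φ p - 1) * (φ p + 1) * 2 = 0 := by linear_combination h1
    have h3 : φ p + 1 ≠ 0 := fun h0 => by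
      have := congrArg PowerSeries.constantCoeff h0
      rw [map_add, hp1, map_one, map_zero] at this
      norm_num at this
    have h4 : (2 : PowerSeries ℝ) ≠ 0 := fun h0 => by
      have := congrArg PowerSeries.constantCoeff h0
      rw [map_ofNat, map_zero] at this
      norm_num at this
    exact sub_eq_zero.1 ((mul_eq_zero.1 ((mul_eq_zero.1 h2).resolve_right h4)).resolve_right h3)
  constructor
  · intro n i j
    have := congrArg (PowerSeries.coeff n) (hA i j)
    rwa [PowerSeries.coeff_map, map_zero] at this
  · intro n
    have := congrArg (PowerSeries.coeff (n + 1)) hp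
    rwa [PowerSeries.coeff_map, PowerSeries.coeff_one, if_neg (Nat.succ_ne_zero n)] at this

lemma IsResolvent.opH (h : IsResolvent (fun i => u (b i)) p x y A) (n : ℕ) :
    opH b (fun i => PowerSeries.coeff n (y i)) (fun i => PowerSeries.coeff (n + 1) (x i)) :=
  ⟨fun i j => PowerSeries.coeff n (A i j),
    fun i j => ⟨h.D_coeff_A n i j, h.constantCoeff_eq.1 n i j⟩, fun j => h.coeff_x n j⟩

lemma IsResolvent.opJ (h : IsResolvent (fun i => u (b i)) p x y A) (n : ℕ) :
    opJ b (fun i => PowerSeries.coeff (n + 1) (x i))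
      (fun i => PowerSeries.coeff (n + 2) (y i)) :=
  ⟨PowerSeries.coeff (n + 1) p, ⟨h.D_coeff_p (n + 1), h.constantCoeff_eq.2 n⟩,
    fun j => h.coeff_y (n + 1) j⟩

lemma IsResolvent.coeff_one_y {v : κ → Jet ι} (h : IsResolvent v p x y A) (i : κ) :
    PowerSeries.coeff 1 (y i) = v i := by
  rw [h.coeff_y 0 i, h.coeff_zero_x, map_zero, zero_add,
    PowerSeries.coeff_zero_eq_constantCoeff_apply, h.const, one_mul]

lemma IsResolvent.coeff_one_A (h : IsResolvent (fun i => u (b i)) p x y A) (i j : κ) :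
    PowerSeries.coeff 1 (A i j) = 0 := by
  refine eq_zero_of_D_eq_zero ?_ (h.constantCoeff_eq.1 1 i j)
  rw [h.D_coeff_A, h.coeff_one_y, h.coeff_one_y, sub_self]

lemma IsResolvent.coeff_two_x (h : IsResolvent (fun i => u (b i)) p x y A) (i : κ) :
    PowerSeries.coeff 2 (x i) = D (u (b i)) := by
  rw [h.coeff_x 1 i, h.coeff_one_y]
  simp only [h.coeff_one_A, mul_zero, Finset.sum_const_zero, add_zero]

lemma IsResolvent.coeff_two_p (h : IsResolvent (fun i => u (b i)) p x y A) :
    PowerSeries.coeff 2 p = (1 / 2 : ℝ) • ∑ i, u (b i) ^ 2 := by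
  refine IsPrimitive.unique ⟨h.D_coeff_p 2, h.constantCoeff_eq.2 1⟩ ⟨?_, ?_⟩
  · rw [Derivation.map_smul, D_sum, Finset.smul_sum]
    refine Finset.sum_congr rfl fun i _ => ?_
    rw [h.coeff_two_x, pow_two, D_mul, ← two_mul, smul_eq_C_mul, ← mul_assoc,
      show (C (1 / 2 : ℝ) : Jet ι) * 2 = 1 from half_mul_two _, one_mul]
  · rw [smul_eq_C_mul, map_mul, map_sum]
    simp [u]

/-- The flows of the even coefficients of the resolvent commute. -/
lemma IsResolvent.commute {v : κ → Jet ι} (h : IsResolvent v p x y A)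
    {δ : ℕ → Derivation ℝ (Jet ι) (Jet ι)} (hδ : ∀ n f, δ n (D f) = D (δ n f))
    (hv : ∀ n i, δ n (v i) = PowerSeries.coeff (2 * n) (x i)) (h0 : δ 0 = 0) (k l : ℕ) (i : κ) :
    δ k (PowerSeries.coeff (2 * l) (x i)) = δ l (PowerSeries.coeff (2 * k) (x i)) := by
  -- With `c(k, l)` the bracket of the flows `k` and `l`, antisymmetry of the variation formula says
  -- `c(k, l + 1) = c(k + 1, l)`, which leads down to the trivial flow with index `0`.
  have hstep : ∀ k l, δ k (PowerSeries.coeff (2 * (l + 1)) (x i)) -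
      δ (l + 1) (PowerSeries.coeff (2 * k) (x i)) =
      δ (k + 1) (PowerSeries.coeff (2 * l) (x i)) -
        δ l (PowerSeries.coeff (2 * (k + 1)) (x i)) := by
    intro k l
    have h1 := h.variation (2 * k) (hδ k) (hδ (k + 1)) (hv k) (hv (k + 1)) (2 * l) i
    have h2 := h.variation (2 * l) (hδ l) (hδ (l + 1)) (hv l) (hv (l + 1)) (2 * k) i
    rw [show 2 * l + 2 = 2 * (l + 1) by ring] at h1
    rw [show 2 * k + 2 = 2 * (k + 1) by ring] at h2
    linear_combination h1 + h2
  have hzero : ∀ l k, δ k (PowerSeries.coeff (2 * l) (x i)) -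
      δ l (PowerSeries.coeff (2 * k) (x i)) = 0 := by
    intro l
    induction l with
    | zero => intro k; simp [h0, h.coeff_zero_x]
    | succ l ih => intro k; rw [hstep]; exact ih (k + 1)
  exact sub_eq_zero.1 (hzero l k)

/-- The hierarchy of vector fields `e`, covector fields `ω` and Hamiltonians `F` on the block
`b`. -/
structure IsHierarchy (b : κ → ι) (e ω : ℕ → κ → Jet ι) (F : ℕ → Jet ι) : Prop where
  e_zero : e 0 = fun i => D (u (b i))
  ω_zero : ω 0 = fun i => u (b i)
  F_zero : F 0 = (1 / 2 : ℝ) • ∑ i, u (b i) ^ 2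
  opH : ∀ k, opH b (ω k) (e k)
  opJ : ∀ k, opJ b (e k) (ω (k + 1))
  D_F : ∀ k, ∃ c : ℝ, D (F k) = c • ∑ i, u (b i) * e k i
  gradient : ∀ k {δ : Derivation ℝ (Jet ι) (Jet ι)}, (∀ f, δ (D f) = D (δ f)) →
    IsTotal (δ (F k) - ∑ i, ω k i * δ (u (b i)))
  commute : ∀ {δ : ℕ → Derivation ℝ (Jet ι) (Jet ι)}, (∀ n f, δ n (D f) = D (δ n f)) →
    (∀ n i, δ n (u (b i)) = e n i) → ∀ k l i, δ k (e l i) = δ l (e k i)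
  leading : ∀ k i, ω k i - X (b i, 2 * k) ∈ ordLT ι (2 * k)

/-- Each of `H` and `J` raises the order by one through `D`, while the nonlocal terms stay below the
leading one because an antiderivative loses one order. -/
lemma leading_step {ω ω' e : κ → Jet ι} {k : ℕ} (hH : CurveFlow.opH b ω e)
    (hJ : CurveFlow.opJ b e ω')
    (hω : ∀ i, ω i - X (b i, 2 * k) ∈ ordLT ι (2 * k)) (i : κ) :
    ω' i - X (b i, 2 * (k + 1)) ∈ ordLT ι (2 * (k + 1)) := by
  have hu : ∀ i {m : ℕ}, u (b i) ∈ ordLT ι (m + 1) := fun i m => X_mem_ordLT (Nat.succ_pos m)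
  have hω' : ∀ i, ω i ∈ ordLT ι (2 * k + 1) := fun i => by
    have := add_mem (ordLT_mono (Nat.le_succ _) (hω i))
      (X_mem_ordLT (ι := ι) (q := (b i, 2 * k)) (Nat.lt_succ_self (2 * k)))
    rwa [sub_add_cancel] at this
  obtain ⟨B, hB, he⟩ := hH
  obtain ⟨q, hq, hω''⟩ := hJ
  have hBm : ∀ i j, B i j ∈ ordLT ι (2 * k) := fun i j => by
    refine antideriv_mem_ordLT ?_
    rw [(hB i j).1]
    exact sub_mem (mul_mem (hu i) (hω' j)) (mul_mem (hω' i) (hu j))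
  have hem : ∀ i, e i - X (b i, 2 * k + 1) ∈ ordLT ι (2 * k + 1) := fun i => by
    have : e i - X (b i, 2 * k + 1) = D (ω i - X (b i, 2 * k)) + ∑ j, u (b j) * B j i := by
      rw [he, map_sub, D_X]; ring
    rw [this]
    exact add_mem (D_mem_ordLT (hω i))
      (sum_mem fun j _ => mul_mem (hu j) (ordLT_mono (Nat.le_succ _) (hBm j i)))
  have hem' : ∀ i, e i ∈ ordLT ι (2 * k + 2) := fun i => by
    have := add_mem (ordLT_mono (Nat.le_succ _) (hem i))
      (X_mem_ordLT (ι := ι) (q := (b i, 2 * k + 1)) (Nat.lt_succ_self (2 * k + 1)))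
    rwa [sub_add_cancel] at this
  have hqm : q ∈ ordLT ι (2 * k + 1) := by
    refine antideriv_mem_ordLT ?_
    rw [hq.1]
    exact sum_mem fun j _ => mul_mem (hu j) (hem' j)
  have : ω' i - X (b i, 2 * (k + 1)) = D (e i - X (b i, 2 * k + 1)) + q * u (b i) := by
    rw [hω'', map_sub, D_X, show 2 * k + 1 + 1 = 2 * (k + 1) by ring]; ring
  rw [this]
  exact add_mem (D_mem_ordLT (hem i)) (mul_mem (ordLT_mono (Nat.le_succ _) hqm) (hu i))

theorem exists_hierarchy (b : κ → ι) : ∃ e ω F, IsHierarchy b e ω F := by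
  obtain ⟨p, x, y, A, h⟩ := exists_resolvent fun i => u (b i)
  have hH : ∀ k, CurveFlow.opH b (fun i => PowerSeries.coeff (2 * k + 1) (y i))
      (fun i => PowerSeries.coeff (2 * k + 2) (x i)) := fun k => h.opH (2 * k + 1)
  have hJ : ∀ k, CurveFlow.opJ b (fun i => PowerSeries.coeff (2 * k + 2) (x i))
      (fun i => PowerSeries.coeff (2 * (k + 1) + 1) (y i)) := fun k => h.opJ (2 * k + 1)
  -- The recursion alternates between even coefficients of `x` and odd ones of `y`. The factor in
  -- the Hamiltonian cancels the `n = 2 k + 1` of the gradient formula.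
  refine ⟨fun k i => PowerSeries.coeff (2 * k + 2) (x i),
    fun k i => PowerSeries.coeff (2 * k + 1) (y i),
    fun k => (1 / (2 * k + 1) : ℝ) • PowerSeries.coeff (2 * k + 2) p,
    funext fun i => h.coeff_two_x i, funext fun i => h.coeff_one_y i, ?_, hH, hJ,
    fun k => ⟨1 / (2 * k + 1), ?_⟩, fun k δ hδ => ?_, fun {δ} hδ hv k l i => ?_, fun k => ?_⟩
  · simpa using h.coeff_two_p
  · rw [Derivation.map_smul, h.D_coeff_p]
  · have h1 := (h.gradient hδ (2 * k + 1)).C_mul (1 / 2 * (1 / (2 * k + 1)))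
    convert h1 using 1
    have hk : (2 * k + 1 : ℝ) ≠ 0 := by positivity
    have h2 : (C (1 / 2 * (1 / (2 * k + 1)) : ℝ) : Jet ι) * 2 * ((2 * k + 1 : ℕ) : Jet ι) = 1 := by
      rw [← map_ofNat (C : ℝ →+* Jet ι) 2, ← map_natCast (C : ℝ →+* Jet ι), ← map_mul, ← map_mul,
        ← map_one (C : ℝ →+* Jet ι)]
      congr 1
      push_cast
      field_simp
    have h3 : (C (1 / 2 * (1 / (2 * k + 1)) : ℝ) : Jet ι) * 2 = (C (1 / (2 * k + 1) : ℝ) : Jet ι) := by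
      rw [← map_ofNat (C : ℝ →+* Jet ι) 2, ← map_mul]
      congr 1
      field_simp
    rw [Derivation.map_smul, smul_eq_C_mul]
    linear_combination (-δ (PowerSeries.coeff (2 * k + 1 + 1) p)) * h3 +
      (∑ i, PowerSeries.coeff (2 * k + 1) (y i) * δ (u (b i))) * h2
  -- The coefficient of `x` at index `0` vanishes, so the zero derivation is prefixed and all
  -- indices move by one.
  · have h1 := h.commute (δ := fun n => n.casesOn 0 δ)
      (fun n f => by cases n with
        | zero => simp
        | succ n => exact hδ n f)
      (fun n i => by cases n with
        | zero => simp [h.coeff_zero_x]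
        | succ n => exact hv n i) rfl (k + 1) (l + 1) i
    exact h1
  · induction k with
    | zero =>
      intro i
      simp only [mul_zero, zero_add]
      rw [h.coeff_one_y, u, sub_self]
      exact zero_mem _
    | succ k ih => exact leading_step (hH k) (hJ k) ih

end Hierarchy

/-! ### Orthogonal equivariance of the operators -/

section Equivariance

open Matrix

variable {κ ι : Type} [Fintype κ] {b : κ → ι} {φ : Jet ι →ₐ[ℝ] Jet ι} {Γ : Matrix κ κ (Jet ι)}

lemma D_mulVec (hΓ : ∀ i j, D (Γ i j) = 0) (w : κ → Jet ι) :
    (fun i => D ((Γ *ᵥ w) i)) = Γ *ᵥ fun j => D (w j) := by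
  funext i
  simp only [mulVec, dotProduct, D_sum, D_mul, hΓ, mul_zero, add_zero]

variable [DecidableEq κ]

/-- `φ` respects `D` and constant terms, so uniqueness of the primitive forces `D⁻¹(v ∧ ω)` to
transform by conjugation with `Γ`. -/
lemma opH.equivariant (hD : ∀ f, φ (D f) = D (φ f))
    (h0 : ∀ f, constantCoeff (φ f) = constantCoeff f) (hΓ : ∀ i j, D (Γ i j) = 0)
    (hΓ' : Γᵀ * Γ = 1) (hv : (fun i => φ (u (b i))) = Γ *ᵥ fun i => u (b i)) {ω h : κ → Jet ι}
    (H : opH b ω h) (hω : (fun i => φ (ω i)) = Γ *ᵥ ω) : (fun i => φ (h i)) = Γ *ᵥ h := by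
  obtain ⟨A, hA, hh⟩ := H
  let B : Matrix κ κ (Jet ι) := A
  let v : κ → Jet ι := fun i => u (b i)
  have hDB : B.map D = vecMulVec v ω - vecMulVec ω v := Matrix.ext fun i j => (hA i j).1
  have hh' : h = (fun j => D (ω j)) + v ᵥ* B := funext hh
  have hB : B.map φ = Γ * B * Γᵀ := by
    refine Matrix.ext fun i j => ((hA i j).map φ hD h0).unique ⟨?_, ?_⟩
    · have h1 : (Γ * B * Γᵀ).map D = Γ * B.map D * Γᵀ := by
        refine Matrix.ext fun i j => ?_
        simp only [map_apply, mul_apply, D_sum, D_mul, transpose_apply, hΓ, mul_zero, add_zero,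
          zero_add]
        exact Finset.sum_congr rfl fun _ _ => mul_comm _ _
      have h2 := congrFun (congrFun h1 i) j
      rw [map_apply] at h2
      rw [h2, hDB, mul_sub, sub_mul, mul_vecMulVec, mul_vecMulVec, vecMulVec_mul, vecMulVec_mul,
        vecMul_transpose, vecMul_transpose, ← hv, ← hω]
      simp [vecMulVec_apply]
    · have hB0 : ∀ k l, constantCoeff (B k l) = 0 := fun k l => (hA k l).2
      simp only [mul_apply, map_sum, map_mul, hB0, mul_zero, zero_mul, Finset.sum_const_zero]
  have h3 : (fun j => φ ((v ᵥ* B) j)) = (Γ *ᵥ v) ᵥ* B.map φ := by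
    rw [← hv]
    funext j
    simp only [vecMul, dotProduct, map_sum, map_mul, map_apply, v]
  have h4 : (Γ *ᵥ v) ᵥ* (Γ * B * Γᵀ) = Γ *ᵥ (v ᵥ* B) := by
    rw [← vecMul_transpose, vecMul_vecMul, ← mul_assoc, ← mul_assoc, hΓ', one_mul,
      ← vecMul_vecMul, vecMul_transpose]
  rw [hh', mulVec_add, ← D_mulVec hΓ, ← hω, ← h4, ← hB, ← h3]
  funext j
  simp only [Pi.add_apply, map_add, hD]

/-- Orthogonality makes `v · e` invariant, hence also its normalized primitive `p`. -/
lemma opJ.equivariant (hD : ∀ f, φ (D f) = D (φ f))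
    (h0 : ∀ f, constantCoeff (φ f) = constantCoeff f) (hΓ : ∀ i j, D (Γ i j) = 0)
    (hΓ' : Γᵀ * Γ = 1) (hv : (fun i => φ (u (b i))) = Γ *ᵥ fun i => u (b i)) {e ω : κ → Jet ι}
    (H : opJ b e ω) (he : (fun i => φ (e i)) = Γ *ᵥ e) : (fun i => φ (ω i)) = Γ *ᵥ ω := by
  obtain ⟨p, hp, hω⟩ := H
  have hω' : ω = (fun i => D (e i)) + p • fun i => u (b i) := funext hω
  have hφp : φ p = p := by
    refine (hp.map φ hD h0).unique ⟨?_, hp.2⟩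
    have h1 : φ (∑ i, u (b i) * e i) = (Γ *ᵥ fun i => u (b i)) ⬝ᵥ (Γ *ᵥ e) := by
      rw [← hv, ← he]
      simp only [dotProduct, map_sum, map_mul]
    rw [hp.1, h1, dotProduct_mulVec, ← vecMul_transpose, vecMul_vecMul, hΓ', vecMul_one]
    rfl
  rw [hω', mulVec_add, ← D_mulVec hΓ, ← he, mulVec_smul, ← hv]
  funext i
  simp only [Pi.add_apply, Pi.smul_apply, smul_eq_mul, map_add, map_mul, hφp, hD]

lemma IsHierarchy.equivariant {e ω : ℕ → κ → Jet ι} {F : ℕ → Jet ι} (h : IsHierarchy b e ω F)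
    (hD : ∀ f, φ (D f) = D (φ f))
    (h0 : ∀ f, constantCoeff (φ f) = constantCoeff f) (hΓ : ∀ i j, D (Γ i j) = 0)
    (hΓ' : Γᵀ * Γ = 1) (hv : (fun i => φ (u (b i))) = Γ *ᵥ fun i => u (b i)) (k : ℕ) :
    (fun i => φ (e k i)) = Γ *ᵥ e k := by
  suffices hω : (fun i => φ (ω k i)) = Γ *ᵥ ω k from
    (h.opH k).equivariant hD h0 hΓ hΓ' hv hω
  induction k with
  | zero => rw [h.ω_zero, hv]
  | succ k ih =>
    exact (h.opJ k).equivariant hD h0 hΓ hΓ' hv ((h.opH k).equivariant hD h0 hΓ hΓ' hv ih)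

end Equivariance

/-! ### Linear substitutions respect `D` and constant terms -/

section Subst

variable {ι : Type} [Fintype ι] (G : Matrix ι ι ℝ)

lemma subst_X (q : ι × ℕ) : subst G (X q) = ∑ j, C (G q.1 j) * (X (j, q.2) : Jet ι) :=
  aeval_X _ _

lemma subst_D (f : Jet ι) : subst G (D f) = D (subst G f) := by
  induction f using MvPolynomial.induction_on with
  | C r => rw [D_C, map_zero, ← algebraMap_eq, AlgHom.commutes, algebraMap_eq, D_C]
  | add f g hf hg => rw [map_add, map_add, hf, hg, map_add, map_add]
  | mul_X f q hf =>
    have hq : subst G (D (X q)) = D (subst G (X q)) := by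
      rw [D_X, subst_X, subst_X, D_sum]
      refine Finset.sum_congr rfl fun j _ => ?_
      rw [D_mul, D_C, D_X, mul_zero, add_zero]
    rw [D_mul, map_add, map_mul, map_mul, map_mul, D_mul, hf, hq]

lemma constantCoeff_subst (f : Jet ι) : constantCoeff (subst G f) = constantCoeff f := by
  induction f using MvPolynomial.induction_on with
  | C r => rw [← algebraMap_eq, AlgHom.commutes]
  | add f g hf hg => rw [map_add, map_add, map_add, hf, hg]
  | mul_X f q hf => simp [subst_X]

end Subst

/-! ### Variational, commuting and adapted hierarchies -/

section Hierarchy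

variable {κ ι : Type} [Fintype κ] {b : κ → ι} {e ω : ℕ → κ → Jet ι} {F : ℕ → Jet ι}

lemma IsHierarchy.varDeriv_eq (h : IsHierarchy b e ω F) (hb : Function.Injective b) (k : ℕ)
    (i : κ) : varDeriv (F k) (b i) = ω k i := by
  classical
  refine varDeriv_eq_of_isTotal fun g => ?_
  convert h.gradient k (evo_D (Pi.single (b i) g)) using 2
  rw [Finset.sum_eq_single i]
  · rw [evo_u, Pi.single_eq_same]
  · intro j _ hj
    rw [evo_u, Pi.single_eq_of_ne (hb.ne hj), mul_zero]
  · exact fun hi => absurd (Finset.mem_univ i) hi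

lemma IsHierarchy.mem_supported (h : IsHierarchy b e ω F) {s : Set ι} (hb : ∀ i, b i ∈ s)
    (k : ℕ) : (∀ i, ω k i ∈ supported ℝ {q : ι × ℕ | q.1 ∈ s}) ∧
      (∀ i, e k i ∈ supported ℝ {q : ι × ℕ | q.1 ∈ s}) ∧
        F k ∈ supported ℝ {q : ι × ℕ | q.1 ∈ s} := by
  have hu : ∀ i, u (b i) ∈ supported ℝ {q : ι × ℕ | q.1 ∈ s} := fun i => X_mem_supported.2 (hb i)
  have hω : ∀ i, ω k i ∈ supported ℝ {q : ι × ℕ | q.1 ∈ s} := by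
    induction k with
    | zero => rw [h.ω_zero]; exact hu
    | succ k ih => exact (h.opJ k).mem_supported hb ((h.opH k).mem_supported hb ih)
  have he := (h.opH k).mem_supported hb hω
  -- The Hamiltonian is, up to a factor, the potential of `v · e`, and antiderivatives introduce no
  -- new variables.
  refine ⟨hω, he, antideriv_mem_supported ?_⟩
  obtain ⟨c, hc⟩ := h.D_F k
  rw [hc]
  exact Subalgebra.smul_mem _ (sum_mem fun i _ => mul_mem (hu i) (he i)) c

/-- Two derivations commuting with `D` agree as soon as they agree on the variables `u i`. -/
lemma eq_of_mem_supported {δ ε : Derivation ℝ (Jet ι) (Jet ι)} (hδ : ∀ f, δ (D f) = D (δ f))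
    (hε : ∀ f, ε (D f) = D (ε f)) {s : Set ι} (h : ∀ i ∈ s, δ (u i) = ε (u i)) {f : Jet ι}
    (hf : f ∈ supported ℝ {q : ι × ℕ | q.1 ∈ s}) : δ f = ε f := by
  refine derivation_eqOn_supported (s := {q : ι × ℕ | q.1 ∈ s}) ?_ hf
  rintro ⟨i, n⟩ hi
  induction n with
  | zero => exact h i hi
  | succ n ih =>
    have := congrArg D (ih hi)
    simpa only [Function.comp_apply, ← hδ, ← hε, D_X] using this

/-- The fields of the hierarchy involve only block variables, so the components of `P` and `Q` off
the block are irrelevant and may be replaced by zero. -/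
lemma IsHierarchy.evo_comm (h : IsHierarchy b e ω F) (hb : Function.Injective b)
    {P Q : ι → Jet ι} {k l : ℕ} (hP : ∀ i, P (b i) = e k i) (hQ : ∀ i, Q (b i) = e l i) (i : κ) :
    evo P (e l i) = evo Q (e k i) := by
  have hE : ∀ n i, evo (Function.extend b (e n) 0) (u (b i)) = e n i := fun n i => by
    rw [evo_u, hb.extend_apply]
  have hP' : ∀ {R : ι → Jet ι} {m : ℕ}, (∀ i, R (b i) = e m i) → ∀ n,
      evo R (e n i) = evo (Function.extend b (e m) 0) (e n i) := by
    intro R m hR n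
    refine eq_of_mem_supported (evo_D _) (evo_D _) ?_
      ((h.mem_supported Set.mem_range_self n).2.1 i)
    rintro _ ⟨j, rfl⟩
    rw [hE, evo_u, hR]
  rw [hP' hP, hP' hQ]
  exact h.commute (δ := fun n => evo (Function.extend b (e n) 0)) (fun n => evo_D _) hE k l i

lemma IsHierarchy.evo_shifted_comm (h : IsHierarchy b e ω F) (hb : Function.Injective b)
    {P Q : ι → Jet ι} {r : ℝ} {k l : ℕ} (hP : ∀ i, P (b i) = shifted e r k i)
    (hQ : ∀ i, Q (b i) = shifted e r l i) (i : κ) :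
    evo P (shifted e r l i) = evo Q (shifted e r k i) := by
  let E : ℕ → ι → Jet ι := fun n => Function.extend b (e n) 0
  have hE : ∀ n i, E n (b i) = e n i := fun n i => hb.extend_apply _ _ _
  -- On block variables a shifted flow acts as the same combination of two flows of the hierarchy;
  -- bilinearity then reduces the claim to `evo_comm`.
  have hP' : ∀ {R : ι → Jet ι} {m : ℕ}, (∀ i, R (b i) = shifted e r m i) → ∀ n,
      evo R (e n i) = evo (E (m + 1)) (e n i) - r • evo (E m) (e n i) := by
    intro R m hR n
    refine eq_of_mem_supported (ε := evo (E (m + 1)) - r • evo (E m)) (evo_D _) (fun f => ?_) ?_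
      ((h.mem_supported Set.mem_range_self n).2.1 i)
    · simp only [Derivation.sub_apply, Derivation.smul_apply, evo_D, map_sub, Derivation.map_smul]
    · rintro _ ⟨j, rfl⟩
      simp only [Derivation.sub_apply, Derivation.smul_apply, evo_u, hE, hR]
      rfl
  have hs : ∀ {R : ι → Jet ι} {m : ℕ}, evo R (shifted e r m i) =
      evo R (e (m + 1) i) - r • evo R (e m i) := fun {R m} => by
    rw [← Derivation.map_smul, ← map_sub]; rfl
  rw [hs, hs, hP' hP, hP' hP, hP' hQ, hP' hQ, h.evo_comm hb (hE (k + 1)) (hE (l + 1)),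
    h.evo_comm hb (hE k) (hE (l + 1)), h.evo_comm hb (hE (k + 1)) (hE l),
    h.evo_comm hb (hE k) (hE l)]
  simp only [smul_sub]
  abel

/-- Both Hamiltonian forms of the shifted flows. -/
lemma IsHierarchy.opH_shifted (h : IsHierarchy b e ω F) (hb : Function.Injective b) (r : ℝ)
    (k : ℕ) : CurveFlow.opH b (fun i => varDeriv (shifted F r k) (b i)) (shifted e r k) := by
  have h1 : (fun i => varDeriv (shifted F r k) (b i)) = ω (k + 1) - r • ω k := by
    funext i
    rw [shifted, varDeriv_sub_smul, h.varDeriv_eq hb, h.varDeriv_eq hb]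
    rfl
  rw [h1]
  exact opH_isLinear.sub_smul r (h.opH (k + 1)) (h.opH k)

lemma IsHierarchy.opJ_inv_shifted (h : IsHierarchy b e ω F) (hb : Function.Injective b) (r : ℝ)
    (k : ℕ) : (CurveFlow.opJ b).inv (fun i => varDeriv (shifted F r (k + 1)) (b i))
      (shifted e r k) := by
  have h1 : (fun i => varDeriv (shifted F r (k + 1)) (b i)) = ω (k + 2) - r • ω (k + 1) := by
    funext i
    rw [shifted, varDeriv_sub_smul, h.varDeriv_eq hb, h.varDeriv_eq hb]
    rfl
  rw [h1]
  exact opJ_isLinear.inv.sub_smul r (h.opJ (k + 1)) (h.opJ k)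

end Hierarchy

/-! ### Pairs of hierarchies -/

section Pairs

variable {N M : ℕ} {he hω : ℕ → Fin N → Jet (Ix N M)} {ve vω : ℕ → Fin M → Jet (Ix N M)}
  {hF vF : ℕ → Jet (Ix N M)}

lemma isInvariant_dFlow (hh : IsHierarchy Sum.inl he hω hF) (hv : IsHierarchy Sum.inr ve vω vF)
    (r s : ℝ) (k j : ℕ) : IsInvariant (dFlow he ve r s k j) := by
  intro A hA B hB
  have hmap : ∀ {κ : Type} [Fintype κ] [DecidableEq κ] {G : Matrix κ κ ℝ},
      G ∈ Matrix.orthogonalGroup κ ℝ →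
      (G.map (C : ℝ → Jet (Ix N M))).transpose * G.map (C : ℝ → Jet (Ix N M)) = 1 := by
    intro κ _ _ G hG
    have h1 : G.transpose * G = 1 := (Matrix.mem_orthogonalGroup_iff' κ ℝ).1 hG
    have h2 := congrArg (fun m => m.map (C : ℝ →+* Jet (Ix N M))) h1
    simpa only [Matrix.map_mul, Matrix.transpose_map, Matrix.map_one _ (map_zero _) (map_one _)]
      using h2
  have h1 := fun k => hh.equivariant (Γ := A.map C) (subst_D _)
    (constantCoeff_subst (Matrix.fromBlocks A 0 0 B)) (fun _ _ => D_C _) (hmap hA)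
    (by funext i; simp [u, subst_X, Matrix.mulVec, dotProduct]) k
  have h2 := fun k => hv.equivariant (Γ := B.map C) (subst_D _)
    (constantCoeff_subst (Matrix.fromBlocks A 0 0 B)) (fun _ _ => D_C _) (hmap hB)
    (by funext i; simp [u, subst_X, Matrix.mulVec, dotProduct]) k
  rintro (i | i)
  · have e1 := congrFun (h1 (k + 1)) i
    have e2 := congrFun (h1 k) i
    simp only [Matrix.mulVec, dotProduct, Matrix.map_apply] at e1 e2
    simp [dFlow, shifted, e1, e2, mul_sub, Finset.smul_sum, Finset.sum_sub_distrib]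
  · have e1 := congrFun (h2 (j + 1)) i
    have e2 := congrFun (h2 j) i
    simp only [Matrix.mulVec, dotProduct, Matrix.map_apply] at e1 e2
    simp [dFlow, shifted, e1, e2, mul_sub, Finset.smul_sum, Finset.sum_sub_distrib]

lemma commutingFlows_elim (hh : IsHierarchy Sum.inl he hω hF)
    (hv : IsHierarchy Sum.inr ve vω vF) (k j k' j' : ℕ) :
    CommutingFlows (Sum.elim (he k) (ve j)) (Sum.elim (he k') (ve j')) := by
  rintro (i | i)
  · exact sub_eq_zero.2 (hh.evo_comm Sum.inl_injective (fun _ => rfl) (fun _ => rfl) i)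
  · exact sub_eq_zero.2 (hv.evo_comm Sum.inr_injective (fun _ => rfl) (fun _ => rfl) i)

lemma commutingFlows_dFlow (hh : IsHierarchy Sum.inl he hω hF)
    (hv : IsHierarchy Sum.inr ve vω vF) (r s : ℝ) (k j k' j' : ℕ) :
    CommutingFlows (dFlow he ve r s k j) (dFlow he ve r s k' j') := by
  rintro (i | i)
  · exact sub_eq_zero.2 (hh.evo_shifted_comm Sum.inl_injective (fun _ => rfl) (fun _ => rfl) i)
  · exact sub_eq_zero.2 (hv.evo_shifted_comm Sum.inr_injective (fun _ => rfl) (fun _ => rfl) i)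

end Pairs

end CurveFlow
open CurveFlow in
theorem corollaryc2 (n m : ℕ) (hn : 2 ≤ n) (hm : 2 ≤ m) :
    -- the d-operators are N-adapted, cosymplectic and symplectic, and mutually compatible
    (IsNAdaptedOp (dH (n - 1) (m - 1)) ∧ IsNAdaptedOp (dJ (n - 1) (m - 1)) ∧
      IsHamiltonianOp (dH (n - 1) (m - 1)) ∧ IsSymplecticOp (dJ (n - 1) (m - 1)) ∧
      AreCompatible (dH (n - 1) (m - 1)) (dJ (n - 1) (m - 1))) ∧
    -- the alternative Hamiltonian d-operator
    ((dH (n - 1) (m - 1)).comp ((dJ (n - 1) (m - 1)).comp (dH (n - 1) (m - 1))) =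
        (dR (n - 1) (m - 1)).comp (dH (n - 1) (m - 1)) ∧
      IsHamiltonianOp ((dR (n - 1) (m - 1)).comp (dH (n - 1) (m - 1)))) ∧
    -- the hierarchies
    ∃ (he hϖ : ℕ → Fin (n - 1) → Jet (Ix (n - 1) (m - 1)))
      (ve vϖ : ℕ → Fin (m - 1) → Jet (Ix (n - 1) (m - 1)))
      (hHam vHam : ℕ → Jet (Ix (n - 1) (m - 1))),
      -- starting fields and starting Hamiltonians
      (he 0 = fun i => D (u (Sum.inl i))) ∧ (ve 0 = fun a => D (u (Sum.inr a))) ∧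
      (hϖ 0 = fun i => u (Sum.inl i)) ∧ (vϖ 0 = fun a => u (Sum.inr a)) ∧
      (hHam 0 = (1 / 2 : ℝ) • ∑ i, u (Sum.inl i) ^ 2) ∧
      (vHam 0 = (1 / 2 : ℝ) • ∑ a, u (Sum.inr a) ^ 2) ∧
      -- the fields are generated by the recursion d-operator and its adjoint
      (∀ k, dR (n - 1) (m - 1) (Sum.elim (he k) (ve k)) (Sum.elim (he (k + 1)) (ve (k + 1)))) ∧
      (∀ k, dRadj (n - 1) (m - 1) (Sum.elim (hϖ k) (vϖ k))
        (Sum.elim (hϖ (k + 1)) (vϖ (k + 1)))) ∧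
      (∀ k, dH (n - 1) (m - 1) (Sum.elim (hϖ k) (vϖ k)) (Sum.elim (he k) (ve k))) ∧
      (∀ k, dJ (n - 1) (m - 1) (Sum.elim (he k) (ve k))
        (Sum.elim (hϖ (k + 1)) (vϖ (k + 1)))) ∧
      -- they are N-adapted, and the covector fields are the variational derivatives of
      -- horizontal and vertical Hamiltonians
      (∀ k, IsNAdapted (Sum.elim (he k) (ve k)) ∧ IsNAdapted (Sum.elim (hϖ k) (vϖ k)) ∧
        hHam k ∈ hFun (n - 1) (m - 1) ∧ vHam k ∈ vFun (n - 1) (m - 1)) ∧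
      (∀ k, (∀ i, hϖ k i = varDeriv (hHam k) (Sum.inl i)) ∧
        ∀ a, vϖ k a = varDeriv (vHam k) (Sum.inr a)) ∧
      -- the vector fields of the hierarchies commute
      (∀ k j k' j', CommutingFlows (Sum.elim (he k) (ve j)) (Sum.elim (he k') (ve j'))) ∧
      -- the bi-Hamiltonian flows, for all values of the constant curvatures
      ∀ R S : ℝ,
        (∀ k j, IsNAdapted (dFlow he ve R S k j) ∧ IsInvariant (dFlow he ve R S k j)) ∧
        (∀ k j k' j', CommutingFlows (dFlow he ve R S k j) (dFlow he ve R S k' j')) ∧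
        (∀ k, hH (n - 1) (m - 1) (fun i => varDeriv (shifted hHam R k) (Sum.inl i))
            (shifted he R k) ∧
          (hJ (n - 1) (m - 1)).inv (fun i => varDeriv (shifted hHam R (k + 1)) (Sum.inl i))
            (shifted he R k)) ∧
        (∀ k, vH (n - 1) (m - 1) (fun a => varDeriv (shifted vHam S k) (Sum.inr a))
            (shifted ve S k) ∧
          (vJ (n - 1) (m - 1)).inv (fun a => varDeriv (shifted vHam S (k + 1)) (Sum.inr a))
            (shifted ve S k)) := by
  generalize n - 1 = N
  generalize m - 1 = M
  obtain ⟨he, hω, hF, hh⟩ := exists_hierarchy (Sum.inl : Fin N → Ix N M)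
  obtain ⟨ve, vω, vF, hv⟩ := exists_hierarchy (Sum.inr : Fin M → Ix N M)
  have hinl : Function.Injective (Sum.inl : Fin N → Ix N M) := Sum.inl_injective
  have hinr : Function.Injective (Sum.inr : Fin M → Ix N M) := Sum.inr_injective
  have hadapt := fun k => hh.mem_supported (s := {i | i.isLeft}) (fun _ => rfl) k
  have vadapt := fun k => hv.mem_supported (s := {i | i.isRight}) (fun _ => rfl) k
  refine ⟨⟨isNAdaptedOp_dH N M, isNAdaptedOp_dJ N M, ?_, ?_, fun a c => ?_⟩, ⟨?_, ?_⟩,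
    he, hω, ve, vω, hF, vF, hh.e_zero, hv.e_zero, hh.ω_zero, hv.ω_zero, hh.F_zero, hv.F_zero,
    fun k => ⟨⟨_, hh.opJ k, hh.opH (k + 1)⟩, ⟨_, hv.opJ k, hv.opH (k + 1)⟩⟩,
    fun k => ⟨⟨_, hh.opH k, hh.opJ k⟩, ⟨_, hv.opH k, hv.opJ k⟩⟩,
    fun k => ⟨hh.opH k, hv.opH k⟩, fun k => ⟨hh.opJ k, hv.opJ k⟩,
    fun k => ⟨⟨(hadapt k).2.1, (vadapt k).2.1⟩, ⟨(hadapt k).1, (vadapt k).1⟩, (hadapt k).2.2,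
      (vadapt k).2.2⟩,
    fun k => ⟨fun i => (hh.varDeriv_eq hinl k i).symm, fun i => (hv.varDeriv_eq hinr k i).symm⟩,
    commutingFlows_elim hh hv, fun R S => ⟨fun k j => ⟨⟨fun i => ?_, fun i => ?_⟩,
      isInvariant_dFlow hh hv R S k j⟩, commutingFlows_dFlow hh hv R S,
      fun k => ⟨hh.opH_shifted hinl R k, hh.opJ_inv_shifted hinl R k⟩,
      fun k => ⟨hv.opH_shifted hinr S k, hv.opJ_inv_shifted hinr S k⟩⟩⟩
  · exact isHamiltonianOp_dOp
      -- The covector field with index `k + 1` has leading order `2 (k + 1)`. It is `J` of the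
      -- vector field with index `k`, so the same elements also serve for `J⁻¹` and for the
      -- intersection of the domains below.
      (isBlockHamiltonian_opH fun k => ⟨_, _, hh.opH (k + 1), hh.leading (k + 1)⟩)
      (isBlockHamiltonian_opH fun k => ⟨_, _, hv.opH (k + 1), hv.leading (k + 1)⟩)
  · exact isHamiltonianOp_dOp
      (isBlockHamiltonian_opJ_inv hinl fun k => ⟨_, _, hh.opJ k, hh.leading (k + 1)⟩)
      (isBlockHamiltonian_opJ_inv hinr fun k => ⟨_, _, hv.opJ k, hv.leading (k + 1)⟩)
  · rw [dH, dJ, dOp_inv, dOp_lin]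
    exact isHamiltonianOp_dOp
      (isBlockHamiltonian_lin hinl
        (fun k => ⟨_, _, _, hh.opH (k + 1), hh.opJ k, hh.leading (k + 1)⟩) a c)
      (isBlockHamiltonian_lin hinr
        (fun k => ⟨_, _, _, hv.opH (k + 1), hv.opJ k, hv.leading (k + 1)⟩) a c)
  · rw [dH, dJ, dR, dOp_comp, dOp_comp, dOp_comp, Op.comp_assoc, Op.comp_assoc]
  · rw [dH, dR, dOp_comp]
    exact isHamiltonianOp_dOp
      (isBlockHamiltonian_HJH fun k => ⟨_, _,
        ⟨_, hh.opH (k + 1), _, hh.opJ (k + 1), hh.opH (k + 2)⟩, hh.leading (k + 1)⟩)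
      (isBlockHamiltonian_HJH fun k => ⟨_, _,
        ⟨_, hv.opH (k + 1), _, hv.opJ (k + 1), hv.opH (k + 2)⟩, hv.leading (k + 1)⟩)
  · exact sub_mem ((hadapt (k + 1)).2.1 i) (Subalgebra.smul_mem _ ((hadapt k).2.1 i) R)
  · exact sub_mem ((vadapt (j + 1)).2.1 i) (Subalgebra.smul_mem _ ((vadapt j).2.1 i) S)
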